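/- Let $\mathbb K$ be a field of characteristic zero, $G$ an abelian group (written additively) and $\varepsilon:G\times G\to\mathbb K^\times$ an anti-symmetric bicharacter, i.e. $\varepsilon(g,h)\varepsilon(h,g)=1$, $\varepsilon(g,h+k)=\varepsilon(g,h)\varepsilon(g,k)$ and $\varepsilon(g+h,k)=\varepsilon(g,k)\varepsilon(h,k)$. Let $\mathfrak g=\bigoplus_{g\in G}\mathfrak g_g$ be a color Lie algebra over $\mathbb K$: a $G$-graded vector space with a bilinear bracket $\mu_0=[\cdot,\cdot]$ such that, for homogeneous $a,b,c$, $[\mathfrak g_g,\mathfrak g_h]\subseteq\mathfrak g_{g+h}$, $[a,b]=-\varepsilon(|a|,|b|)[b,a]$ and $$\varepsilon(|c|,|a|)[a,[b,c]]+\varepsilon(|a|,|b|)[b,[c,a]]+\varepsilon(|b|,|c|)[c,[a,b]]=0 .$$ Its universal enveloping algebra $\mathcal U(\mathfrak g)$ is the quotient of the tensor algebra $T(\mathfrak g)$ by the two-sided ideal generated by the elements $a\otimes b-\varepsilon(|a|,|b|)\,b\otimes a-[a,b]$ with $a,b$ homogeneous, with the $G$-grading induced from $T(\mathfrak g)$;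 let $\pi_0$ be its multiplication. A graded deformation of $\mathfrak g$ is a $\mathbb K[[t]]$-bilinear map $\mu_t=\sum_{n\ge0}\mu_nt^n$ on $\mathfrak g[[t]]$, where $\mu_0$ is the bracket and every $\mu_n:\mathfrak g\times\mathfrak g\to\mathfrak g$ is bilinear, homogeneous of degree zero and $\varepsilon$-skew-symmetric, such that $\mu_t$ is a color Lie bracket on $\mathfrak g[[t]]$ (a series is homogeneous of degree $g$ if all its coefficients are). A graded deformation of the associative algebra $\mathcal U(\mathfrak g)$ is a $\mathbb K[[t]]$-bilinear associative multiplication $\pi_t=\sum_{n\ge0}\pi_nt^n$ on $\mathcal U(\mathfrak g)[[t]]$ extending $\pi_0$ with every $\pi_n$ bilinear and homogeneous of degree zero. In both cases a deformation is trivial if it is equivalent to the undeformed multiplication: there is $f=\mathrm{id}+\sum_{n\ge1}f_nt^n$, with every $f_n$ linear and homogeneous of degree zero, which carries the deformed multiplication to the $\mathbb K[[t]]$-bilinear extension of the original one, i.e. $f(\mu_t(x,y))=\mu_0(f(x),f(y))$, respectively $f(\pi_t(x,y))=\pi_0(f(x),f(y))$, for all $x,y$. The color Lie algebra $\mathfrak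 g$, respectively the associative algebra $\mathcal U(\mathfrak g)$, is called graded rigid if all its graded deformations are trivial. If the associative algebra $\mathcal U(\mathfrak g)$ is graded rigid, then the color Lie algebra $\mathfrak g$ is graded rigid. -/

import Mathlib

open scoped DirectSum

/-! ## Color Lie algebras

The grading group `G` is an abelian group, written additively. -/

/-- `ε` is an anti-symmetric bicharacter on `G` with values in `Kˣ`. -/
structure IsAntisymmBicharacter {K G : Type*} [Field K] [AddCommGroup G]
    (ε : G → G → Kˣ) : Prop where
  antisymm : ∀ g h, ε g h * ε h g = 1
  add_right : ∀ g h k, ε g (h + k) = ε g h * ε g k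
  add_left : ∀ g h k, ε (g + h) k = ε g k * ε h k

/-- The axioms of a color Lie bracket `m` on a `K`-module `V` with homogeneous components `𝒱 g`:
compatibility with the degrees, `ε`-skew-symmetry and the `ε`-Jacobi identity. -/
structure IsColorLieBracket {K G V : Type*} [Field K] [AddCommGroup G]
    [AddCommGroup V] [Module K V]
    (ε : G → G → Kˣ) (𝒱 : G → Submodule K V) (m : V → V → V) : Prop where
  mem : ∀ g h a b, a ∈ 𝒱 g → b ∈ 𝒱 h → m a b ∈ 𝒱 (g + h)
  skew : ∀ g h a b, a ∈ 𝒱 g → b ∈ 𝒱 h → m a b = -((ε g h : K) • m b a)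
  jacobi : ∀ g h k a b c, a ∈ 𝒱 g → b ∈ 𝒱 h → c ∈ 𝒱 k →
    (ε k g : K) • m a (m b c) + (ε g h : K) • m b (m c a) + (ε h k : K) • m c (m a b) = 0

/-- A `G`-graded `ε`-Lie algebra (color Lie algebra) structure on the `K`-vector space `L`. -/
structure ColorLieAlgebra {K G : Type*} [Field K] [AddCommGroup G] [DecidableEq G]
    (ε : G → G → Kˣ) (L : Type*) [AddCommGroup L] [Module K L] where
  /-- The homogeneous components. -/
  grade : G → Submodule K L
  isInternal : DirectSum.IsInternal grade
  /-- The bracket. -/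
  bracket : L →ₗ[K] L →ₗ[K] L
  isColorLieBracket : IsColorLieBracket ε grade (fun a b => bracket a b)

/-! ## Formal power series with coefficients in a vector space

An element `∑ xₙ tⁿ` of `V[[t]]` is its sequence of coefficients `x : ℕ → V`. -/

section Formal

variable {K G V : Type*} [Field K] [AddCommGroup V] [Module K V]

/-- The homogeneous component of degree `g` of `V[[t]]`: the series with coefficients in `𝒱 g`. -/
def seriesGrade (𝒱 : G → Submodule K V) (g : G) : Submodule K (ℕ → V) :=
  Submodule.pi Set.univ (fun _ => 𝒱 g)

/-- The `K[[t]]`-linear map `∑ fₙ tⁿ` on `V[[t]]`. -/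
def seriesMap (f : ℕ → V →ₗ[K] V) (x : ℕ → V) : ℕ → V := fun n =>
  ∑ p ∈ Finset.HasAntidiagonal.antidiagonal n, f p.1 (x p.2)

/-- The `K[[t]]`-bilinear map `∑ φₙ tⁿ` on `V[[t]]`: the coefficient of `tⁿ` in the product
of `x` and `y` is the sum of all `φ_i (x_j) (y_k)` with `i + j + k = n`. -/
def seriesMul (φ : ℕ → V →ₗ[K] V →ₗ[K] V) (x y : ℕ → V) : ℕ → V := fun n =>
  ∑ p ∈ Finset.HasAntidiagonal.antidiagonal n, ∑ q ∈ Finset.HasAntidiagonal.antidiagonal p.2, φ p.1 (x q.1) (y q.2)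

/-- The multiplication `m`, extended `K[[t]]`-bilinearly to `V[[t]]`, as a family of
coefficients: `m + 0 t + 0 t² + ⋯`. -/
def constSeries (m : V →ₗ[K] V →ₗ[K] V) : ℕ → V →ₗ[K] V →ₗ[K] V := Pi.single 0 m

/-- Equivalence of two multiplications `φ₁ = ∑ φ₁ₙ tⁿ` and `φ₂ = ∑ φ₂ₙ tⁿ` on the graded module
`V[[t]]`: there is `f = id + t f₁ + t² f₂ + ⋯`, with all `fₙ` homogeneous of degree zero, such that
`f ∘ φ₂ = φ₁ ∘ (f × f)`. As `f` is invertible, this says `φ₂ = f⁻¹ ∘ φ₁ ∘ (f × f)`. -/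
def GradedEquivalent (𝒱 : G → Submodule K V) (φ₁ φ₂ : ℕ → V →ₗ[K] V →ₗ[K] V) : Prop :=
  ∃ f : ℕ → V →ₗ[K] V, f 0 = LinearMap.id ∧
    (∀ n g, ∀ v ∈ 𝒱 g, f n v ∈ 𝒱 g) ∧
    ∀ x y : ℕ → V, seriesMap f (seriesMul φ₂ x y) = seriesMul φ₁ (seriesMap f x) (seriesMap f y)

end Formal

/-! ## Graded deformations of associative algebras -/

section Assoc

variable {K G A : Type*} [Field K] [AddCommGroup G] [DecidableEq G] [Ring A] [Algebra K A]

/-- `π = ∑ πₙ tⁿ` is a graded deformation of the graded associative algebra `A`: `π₀` is the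
multiplication of `A`, every `πₙ` is homogeneous of degree zero, and `π` is associative
on `A[[t]]`. -/
structure IsGradedAssocDeformation (𝒜 : G → Submodule K A) [GradedAlgebra 𝒜]
    (π : ℕ → A →ₗ[K] A →ₗ[K] A) : Prop where
  zero : π 0 = LinearMap.mul K A
  mem : ∀ n g h a b, a ∈ 𝒜 g → b ∈ 𝒜 h → π n a b ∈ 𝒜 (g + h)
  assoc : ∀ x y z : ℕ → A, seriesMul π (seriesMul π x y) z = seriesMul π x (seriesMul π y z)

/-- A graded associative algebra is graded rigid if each of its graded deformations is trivial,
that is, equivalent to the undeformed multiplication. -/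
def IsGradedRigidAlgebra (𝒜 : G → Submodule K A) [GradedAlgebra 𝒜] : Prop :=
  ∀ π : ℕ → A →ₗ[K] A →ₗ[K] A, IsGradedAssocDeformation 𝒜 π →
    GradedEquivalent 𝒜 (constSeries (LinearMap.mul K A)) π

end Assoc

namespace ColorLieAlgebra

variable {K G : Type*} [Field K] [AddCommGroup G] [DecidableEq G]
  {ε : G → G → Kˣ} {L : Type*} [AddCommGroup L] [Module K L]

/-! ## Graded deformations of color Lie algebras -/

/-- `φ = ∑ φₙ tⁿ` is a graded deformation of `𝔤`: `φ₀` is the bracket of `𝔤`, every `φₙ` is a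
`2`-cochain of degree zero (homogeneous of degree zero and `ε`-skew-symmetric), and `φ` is a color
Lie bracket on `𝔤[[t]]`. -/
structure IsGradedDeformation (𝔤 : ColorLieAlgebra ε L) (φ : ℕ → L →ₗ[K] L →ₗ[K] L) : Prop where
  zero : φ 0 = 𝔤.bracket
  mem : ∀ n g h a b, a ∈ 𝔤.grade g → b ∈ 𝔤.grade h → φ n a b ∈ 𝔤.grade (g + h)
  skew : ∀ n g h a b, a ∈ 𝔤.grade g → b ∈ 𝔤.grade h → φ n a b = -((ε g h : K) • φ n b a)
  isColorLieBracket : IsColorLieBracket ε (seriesGrade 𝔤.grade) (seriesMul φ)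

/-- A color Lie algebra is graded rigid if each of its graded deformations is trivial,
that is, equivalent to the undeformed bracket. -/
def IsGradedRigid (𝔤 : ColorLieAlgebra ε L) : Prop :=
  ∀ φ : ℕ → L →ₗ[K] L →ₗ[K] L, 𝔤.IsGradedDeformation φ →
    GradedEquivalent 𝔤.grade (constSeries 𝔤.bracket) φ

/-! ## The universal enveloping algebra -/

/-- The defining relations `a ⊗ b = ε(|a|,|b|) b ⊗ a + [a,b]`, for homogeneous `a`, `b`. -/
inductive EnvelopingRel (𝔤 : ColorLieAlgebra ε L) : TensorAlgebra K L → TensorAlgebra K L → Prop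
  | of (g h : G) (a b : L) (ha : a ∈ 𝔤.grade g) (hb : b ∈ 𝔤.grade h) :
    EnvelopingRel 𝔤
      (TensorAlgebra.ι K a * TensorAlgebra.ι K b)
      ((ε g h : K) • (TensorAlgebra.ι K b * TensorAlgebra.ι K a)
        + TensorAlgebra.ι K (𝔤.bracket a b))

/-- The universal enveloping algebra `U(𝔤)`: the tensor algebra modulo the two-sided ideal
generated by the elements `a ⊗ b - ε(|a|,|b|) b ⊗ a - [a,b]` with `a`, `b` homogeneous. -/
abbrev Enveloping (𝔤 : ColorLieAlgebra ε L) := RingQuot 𝔤.EnvelopingRel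

/-- The canonical map `𝔤 → U(𝔤)`. -/
noncomputable def ι (𝔤 : ColorLieAlgebra ε L) : L →ₗ[K] 𝔤.Enveloping :=
  (RingQuot.mkAlgHom K 𝔤.EnvelopingRel).toLinearMap ∘ₗ TensorAlgebra.ι K

/-- The homogeneous component of degree `g` of `U(𝔤)`: the span of the (images of the) tensors
`a₁ ⊗ ⋯ ⊗ aₙ` with `aᵢ` homogeneous of degree `gᵢ` and `g₁ + ⋯ + gₙ = g`. -/
def envelopingGrade (𝔤 : ColorLieAlgebra ε L) (g : G) : Submodule K 𝔤.Enveloping :=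
  Submodule.span K {u | ∃ l : List (G × L), (∀ p ∈ l, p.2 ∈ 𝔤.grade p.1) ∧
    (l.map Prod.fst).sum = g ∧ (l.map fun p => 𝔤.ι p.2).prod = u}

theorem ι_mem (𝔤 : ColorLieAlgebra ε L) {g : G} {a : L} (ha : a ∈ 𝔤.grade g) :
    𝔤.ι a ∈ 𝔤.envelopingGrade g :=
  Submodule.subset_span (Set.mem_ofPred.2 ⟨[(g, a)], by simpa using ha, by simp, by simp⟩)

theorem ι_mul_ι (𝔤 : ColorLieAlgebra ε L) {g h : G} {a b : L}
    (ha : a ∈ 𝔤.grade g) (hb : b ∈ 𝔤.grade h) :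
    𝔤.ι a * 𝔤.ι b = (ε g h : K) • (𝔤.ι b * 𝔤.ι a) + 𝔤.ι (𝔤.bracket a b) := by
  have := RingQuot.mkAlgHom_rel K (EnvelopingRel.of (𝔤 := 𝔤) g h a b ha hb)
  simpa [ι] using this

instance envelopingGradedMonoid (𝔤 : ColorLieAlgebra ε L) :
    SetLike.GradedMonoid 𝔤.envelopingGrade where
  one_mem := Submodule.subset_span (Set.mem_ofPred.2 ⟨[], by simp, by simp, by simp⟩)
  mul_mem := by
    intro g h x y hx hy
    have key : 𝔤.envelopingGrade g * 𝔤.envelopingGrade h ≤ 𝔤.envelopingGrade (g + h) := by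
      rw [envelopingGrade, envelopingGrade, Submodule.span_mul_span]
      refine Submodule.span_mono ?_
      rintro _ ⟨_, ⟨l, hl, rfl, rfl⟩, _, ⟨l', hl', rfl, rfl⟩, rfl⟩
      refine ⟨l ++ l', ?_, by simp, by simp⟩
      intro p hp
      rcases List.mem_append.1 hp with hp | hp
      exacts [hl p hp, hl' p hp]
    exact key (Submodule.mul_mem_mul hx hy)

theorem bijective_coeLinearMap (𝔤 : ColorLieAlgebra ε L) :
    Function.Bijective (DirectSum.coeLinearMap 𝔤.grade) := 𝔤.isInternal

/-- The canonical map from `𝔤` to the external direct sum of the components of `U(𝔤)`. -/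
noncomputable def ιSum (𝔤 : ColorLieAlgebra ε L) : L →ₗ[K] ⨁ g, 𝔤.envelopingGrade g :=
  (DirectSum.toModule K G (⨁ g, 𝔤.envelopingGrade g) fun g =>
    DirectSum.lof K G (fun g => 𝔤.envelopingGrade g) g ∘ₗ
      (𝔤.ι ∘ₗ (𝔤.grade g).subtype).codRestrict (𝔤.envelopingGrade g)
        (fun a => 𝔤.ι_mem a.2)) ∘ₗ
  (LinearEquiv.ofBijective (DirectSum.coeLinearMap 𝔤.grade) 𝔤.bijective_coeLinearMap).symm.toLinearMap

theorem ιSum_of_mem (𝔤 : ColorLieAlgebra ε L) {g : G} {a : L} (ha : a ∈ 𝔤.grade g) :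
    𝔤.ιSum a = DirectSum.of (fun g => 𝔤.envelopingGrade g) g ⟨𝔤.ι a, 𝔤.ι_mem ha⟩ := by
  have h : (LinearEquiv.ofBijective (DirectSum.coeLinearMap 𝔤.grade) 𝔤.bijective_coeLinearMap).symm a
      = DirectSum.lof K G (fun g => 𝔤.grade g) g ⟨a, ha⟩ := by
    rw [LinearEquiv.symm_apply_eq]
    simp
  simp only [ιSum, LinearMap.comp_apply, LinearEquiv.coe_coe, h, DirectSum.toModule_lof]
  rfl

/-- The decomposition map `U(𝔤) → ⨁ U(𝔤)_g`. -/
noncomputable def envelopingDecompose (𝔤 : ColorLieAlgebra ε L) :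
    𝔤.Enveloping →ₐ[K] ⨁ g, 𝔤.envelopingGrade g :=
  RingQuot.liftAlgHom K ⟨TensorAlgebra.lift K 𝔤.ιSum, by
    rintro _ _ ⟨g, h, a, b, ha, hb⟩
    simp only [map_add, map_smul, map_mul, TensorAlgebra.lift_ι_apply]
    rw [𝔤.ιSum_of_mem ha, 𝔤.ιSum_of_mem hb,
      𝔤.ιSum_of_mem (𝔤.isColorLieBracket.mem g h a b ha hb),
      DirectSum.of_mul_of, DirectSum.of_mul_of]
    have e : DirectSum.of (fun g => 𝔤.envelopingGrade g) (h + g)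
        (GradedMonoid.GMul.mul (A := fun g => 𝔤.envelopingGrade g)
          (⟨𝔤.ι b, 𝔤.ι_mem hb⟩ : 𝔤.envelopingGrade h)
          (⟨𝔤.ι a, 𝔤.ι_mem ha⟩ : 𝔤.envelopingGrade g))
        = DirectSum.of (fun g => 𝔤.envelopingGrade g) (g + h)
          ⟨𝔤.ι b * 𝔤.ι a, add_comm h g ▸ SetLike.mul_mem_graded (𝔤.ι_mem hb) (𝔤.ι_mem ha)⟩ :=
      DirectSum.of_eq_of_gradedMonoid_eq
        (Sigma.subtype_ext (p := fun g x => x ∈ 𝔤.envelopingGrade g) (add_comm h g) rfl)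
    rw [e, ← DirectSum.lof_eq_of K, ← DirectSum.lof_eq_of K, ← DirectSum.lof_eq_of K,
      ← map_smul, ← map_add]
    congr 1
    exact Subtype.ext (𝔤.ι_mul_ι ha hb)⟩

theorem envelopingDecompose_ι (𝔤 : ColorLieAlgebra ε L) (a : L) :
    𝔤.envelopingDecompose (𝔤.ι a) = 𝔤.ιSum a := by
  simp [envelopingDecompose, ι]

/-- `U(𝔤)` is a `G`-graded algebra. -/
noncomputable instance envelopingGradedAlgebra (𝔤 : ColorLieAlgebra ε L) :
    GradedAlgebra 𝔤.envelopingGrade :=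
  GradedAlgebra.ofAlgHom 𝔤.envelopingGrade 𝔤.envelopingDecompose
    (by
      apply RingQuot.ringQuot_ext'
      apply TensorAlgebra.hom_ext
      ext a
      change DirectSum.coeAlgHom 𝔤.envelopingGrade (𝔤.envelopingDecompose (𝔤.ι a)) = 𝔤.ι a
      rw [envelopingDecompose_ι]
      obtain ⟨x, rfl⟩ := 𝔤.bijective_coeLinearMap.2 a
      induction x using DirectSum.induction_on with
      | zero => simp
      | of g x =>
        rw [← DirectSum.lof_eq_of K, DirectSum.coeLinearMap_lof, 𝔤.ιSum_of_mem x.2, DirectSum.coeAlgHom_of]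
      | add x y hx hy => simp only [map_add, hx, hy])
    (by
      rintro g ⟨x, hx⟩
      induction hx using Submodule.span_induction with
      | mem x hx =>
        obtain ⟨l, hl, rfl, rfl⟩ := hx
        change 𝔤.envelopingDecompose _ = _
        induction l with
        | nil =>
          simp only [List.map_nil, List.prod_nil, map_one]
          rfl
        | cons p l ih =>
          have hl' : ∀ q ∈ l, q.2 ∈ 𝔤.grade q.1 := fun q hq => hl q (List.mem_cons_of_mem _ hq)
          have hp := hl p List.mem_cons_self
          simp only [List.map_cons, List.prod_cons, map_mul]
          rw [ih hl', envelopingDecompose_ι, 𝔤.ιSum_of_mem hp, DirectSum.of_mul_of]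
          exact DirectSum.of_eq_of_gradedMonoid_eq
            (Sigma.subtype_ext (p := fun g x => x ∈ 𝔤.envelopingGrade g) List.sum_cons.symm rfl)
      | zero =>
        change 𝔤.envelopingDecompose 0 = _
        rw [map_zero]
        exact (map_zero (DirectSum.of (fun g => 𝔤.envelopingGrade g) g)).symm
      | add x y hx hy ihx ihy =>
        change 𝔤.envelopingDecompose (x + y) = _
        rw [map_add]
        refine (congrArg₂ (· + ·) ihx ihy).trans ?_
        exact (map_add (DirectSum.of (fun g => 𝔤.envelopingGrade g) g) ⟨x, hx⟩ ⟨y, hy⟩).symm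
      | smul c x hx ih =>
        change 𝔤.envelopingDecompose (c • x) = _
        rw [map_smul]
        refine (congrArg (c • ·) ih).trans ?_
        exact (map_smul (DirectSum.lof K G (fun g => 𝔤.envelopingGrade g) g) c ⟨x, hx⟩).symm)

end ColorLieAlgebra

/-!
# Rigidity of a color Lie algebra and of its enveloping algebra

Let `φ` be a graded deformation of the color Lie algebra `𝔤`. The proof has two halves: `φ` is the
commutator of a graded deformation of `U(𝔤)`, and a trivialization of that deformation of `U(𝔤)`
can be corrected so that it maps `𝔤` to `𝔤[[t]]`, where it trivializes `φ`.

*Deforming `U(𝔤)`.* The deformed color Lie algebra is made to act on `S[[t]]`, where `S` is the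
color symmetric algebra of `𝔤`. One looks for operators `ρ(x) = x + b(x)`, with `b(x)` not raising
the length of monomials, that satisfy the commutator relations. These relations have the form
`b(x) y - ε(|x|,|y|) b(y) x = e(x, y)`. On monomials of length `n`, the left-hand side involves
`b` on length `n + 1` and the right-hand side only involves `b` on lengths at most `n`. The
right-hand side is `ε`-skew-symmetric and, by the Jacobi identity for `φ`, closed in the sense of
the Koszul complex, so by the Poincaré lemma the equation is solved by a contraction: `contract`
is the homotopy, and the division by `n + 1` that Euler's identity `contract_mulPrecomp` requires
is one of the places where characteristic zero enters. The solution `exists_isSymRep` is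
normalized by the vanishing of the contraction of `b`.

The normalization implies that the symmetrization map intertwines `ρ` with left multiplication
(`IsSymmetrization.intertwines`). Applied to the symmetrization `σ` of `ρ` itself, this shows that
`s ⋆ s' = σ(s) s'` is an associative product on `S[[t]]` whose commutator on `𝔤` is the deformed
bracket. Applied to the constant term of `ρ` and the symmetrization `τ : S → U(𝔤)`, it yields the
Poincaré–Birkhoff–Witt theorem: `τ` is bijective, with inverse `IsSymRep.symbol`. Transport of
structure along `τ` proves `exists_assocDeformation`.

*Straightening the trivialization.* If the deformation of `U(𝔤)` is trivial, then its
trivialization restricts to `F : 𝔤 → U(𝔤)[[t]]` with `F₀` the inclusion, which sends the deformed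
bracket to the color commutator (`exists_isEnvelopingMap`). The symmetrization also intertwines
the adjoint actions, so the projection of `S` to its linear part induces a projection `P : U(𝔤) →
𝔤` that is equivariant for the adjoint action (`exists_equivariant_projection`). If `F₀, …,
F_{r-1}` take values in `𝔤`, then `Q = F_r - P F_r` is a derivation of `𝔤` in `U(𝔤)`; it extends
to a derivation `D` of `U(𝔤)`, and composing `F` with the automorphism `exp(-tʳ D)` moves `F_r`
into `𝔤` as well, without changing the coefficients below `r`
(`IsEnvelopingMap.exists_straighten`). In the limit all coefficients of `F` lie in `𝔤`, and they
form the required equivalence.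
-/

/-! ### Linear maps on internally graded modules -/

section Glue

variable {K ι V M : Type*} [Field K] [DecidableEq ι] [AddCommGroup V] [Module K V]
  [AddCommGroup M] [Module K M] {𝒱 : ι → Submodule K V}

theorem internal_bijective (h : DirectSum.IsInternal 𝒱) :
    Function.Bijective (DirectSum.coeLinearMap 𝒱) := h

/-- The linear map on an internal direct sum `V = ⨁ 𝒱 i` that agrees with `f i` on `𝒱 i`. -/
noncomputable def glue (h : DirectSum.IsInternal 𝒱) (f : ι → V →ₗ[K] M) : V →ₗ[K] M :=
  (DirectSum.toModule K ι M fun i => f i ∘ₗ (𝒱 i).subtype) ∘ₗ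
    (LinearEquiv.ofBijective (DirectSum.coeLinearMap 𝒱) (internal_bijective h)).symm.toLinearMap

theorem glue_apply (h : DirectSum.IsInternal 𝒱) (f : ι → V →ₗ[K] M) {i : ι} {v : V}
    (hv : v ∈ 𝒱 i) : glue h f v = f i v := by
  have e : (LinearEquiv.ofBijective (DirectSum.coeLinearMap 𝒱) (internal_bijective h)).symm v
      = DirectSum.lof K ι (fun i => 𝒱 i) i ⟨v, hv⟩ := by
    rw [LinearEquiv.symm_apply_eq]
    simp
  simp [glue, e]

theorem internal_induction (h : DirectSum.IsInternal 𝒱) {P : V → Prop} (h0 : P 0)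
    (hadd : ∀ x y, P x → P y → P (x + y)) (hP : ∀ i, ∀ v ∈ 𝒱 i, P v) (v : V) : P v := by
  obtain ⟨x, rfl⟩ := h.2 v
  induction x using DirectSum.induction_on with
  | zero => simpa using h0
  | of i x => simpa using hP i x x.2
  | add x y hx hy => rw [map_add]; exact hadd _ _ hx hy

theorem internal_ext (h : DirectSum.IsInternal 𝒱) {f f' : V →ₗ[K] M}
    (hf : ∀ i, ∀ v ∈ 𝒱 i, f v = f' v) : f = f' :=
  LinearMap.ext fun v => internal_induction h (P := fun v => f v = f' v) (by simp)
    (fun x y hx hy => by simp [hx, hy]) hf v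

end Glue

namespace IsAntisymmBicharacter

variable {K G : Type*} [Field K] [AddCommGroup G] {ε : G → G → Kˣ}

theorem mul_swap (hε : IsAntisymmBicharacter ε) (g h : G) : (ε g h : K) * ε h g = 1 := by
  rw [← Units.val_mul, hε.antisymm, Units.val_one]

theorem right (hε : IsAntisymmBicharacter ε) (g h k : G) :
    (ε g (h + k) : K) = ε g h * ε g k := by
  rw [hε.add_right, Units.val_mul]

theorem left (hε : IsAntisymmBicharacter ε) (g h k : G) :
    (ε (g + h) k : K) = ε g k * ε h k := by
  rw [hε.add_left, Units.val_mul]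

theorem zero_right (hε : IsAntisymmBicharacter ε) (g : G) : (ε g 0 : K) = 1 := by
  have h := hε.add_right g 0 0
  rw [add_zero] at h
  simpa using h

end IsAntisymmBicharacter

namespace ColorLieAlgebra

variable {K G : Type*} [Field K] [AddCommGroup G] [DecidableEq G]
  {ε : G → G → Kˣ} {L : Type*} [AddCommGroup L] [Module K L]
  {M : Type*} [AddCommGroup M] [Module K M]

/-! ### Color twists -/

/-- The operator on `𝔤` that multiplies the elements of degree `h` by `c h`. -/
noncomputable def scale (𝔤 : ColorLieAlgebra ε L) (c : G → K) : L →ₗ[K] L :=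
  glue 𝔤.isInternal fun h => c h • LinearMap.id

theorem scale_apply (𝔤 : ColorLieAlgebra ε L) (c : G → K) {h : G} {x : L}
    (hx : x ∈ 𝔤.grade h) : 𝔤.scale c x = c h • x := by
  simp [scale, glue_apply 𝔤.isInternal _ hx]

/-- The bilinear map given by `ε(|x|,|y|) B(x, y)` on homogeneous elements. -/
noncomputable def twist (𝔤 : ColorLieAlgebra ε L) (B : L →ₗ[K] L →ₗ[K] M) :
    L →ₗ[K] L →ₗ[K] M :=
  glue 𝔤.isInternal fun g => (LinearMap.lcomp K M (𝔤.scale fun h => (ε g h : K))) ∘ₗ B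

theorem twist_apply (𝔤 : ColorLieAlgebra ε L) (B : L →ₗ[K] L →ₗ[K] M) {g h : G} {x y : L}
    (hx : x ∈ 𝔤.grade g) (hy : y ∈ 𝔤.grade h) : 𝔤.twist B x y = (ε g h : K) • B x y := by
  simp [twist, glue_apply 𝔤.isInternal _ hx, scale_apply 𝔤 _ hy]

/-! ### The universal property of the enveloping algebra, and monomials -/

section Lift

variable {A : Type*} [Ring A] [Algebra K A]

/-- The algebra map `U(𝔤) → A` induced by a linear map `j : 𝔤 → A` that satisfies the color
commutator relations. -/
noncomputable def lift (𝔤 : ColorLieAlgebra ε L) (j : L →ₗ[K] A)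
    (hj : ∀ g h a b, a ∈ 𝔤.grade g → b ∈ 𝔤.grade h →
      j a * j b = (ε g h : K) • (j b * j a) + j (𝔤.bracket a b)) : 𝔤.Enveloping →ₐ[K] A :=
  RingQuot.liftAlgHom K ⟨TensorAlgebra.lift K j, by
    rintro _ _ ⟨g, h, a, b, ha, hb⟩
    simpa using hj g h a b ha hb⟩

theorem lift_ι (𝔤 : ColorLieAlgebra ε L) (j : L →ₗ[K] A)
    (hj : ∀ g h a b, a ∈ 𝔤.grade g → b ∈ 𝔤.grade h →
      j a * j b = (ε g h : K) • (j b * j a) + j (𝔤.bracket a b)) (x : L) :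
    𝔤.lift j hj (𝔤.ι x) = j x := by
  simp [lift, ι]

end Lift

/-- `𝔤.IsMonomial n g u`: the element `u` of `U(𝔤)` is a product of `n` homogeneous elements
of `𝔤` whose degrees add up to `g`. -/
inductive IsMonomial (𝔤 : ColorLieAlgebra ε L) : ℕ → G → 𝔤.Enveloping → Prop
  | one : IsMonomial 𝔤 0 0 1
  | mul {n : ℕ} {g h : G} {x : L} {s : 𝔤.Enveloping} (hx : x ∈ 𝔤.grade g)
      (hs : IsMonomial 𝔤 n h s) : IsMonomial 𝔤 (n + 1) (g + h) (𝔤.ι x * s)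

theorem isMonomial_ι (𝔤 : ColorLieAlgebra ε L) {g : G} {x : L} (hx : x ∈ 𝔤.grade g) :
    𝔤.IsMonomial 1 g (𝔤.ι x) := by
  simpa using IsMonomial.mul hx (IsMonomial.one (𝔤 := 𝔤))

theorem IsMonomial.list_prod (𝔤 : ColorLieAlgebra ε L) (l : List (G × L))
    (hl : ∀ p ∈ l, p.2 ∈ 𝔤.grade p.1) :
    𝔤.IsMonomial l.length (l.map Prod.fst).sum (l.map fun p => 𝔤.ι p.2).prod := by
  induction l with
  | nil => exact IsMonomial.one
  | cons p l ih =>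
    simp only [List.map_cons, List.prod_cons, List.sum_cons, List.length_cons]
    exact IsMonomial.mul (hl p List.mem_cons_self)
      (ih fun q hq => hl q (List.mem_cons_of_mem _ hq))

theorem IsMonomial.mem {𝔤 : ColorLieAlgebra ε L} {n : ℕ} {g : G} {s : 𝔤.Enveloping}
    (hs : 𝔤.IsMonomial n g s) : s ∈ 𝔤.envelopingGrade g := by
  induction hs with
  | one => exact SetLike.GradedOne.one_mem
  | mul hx _ ih => exact SetLike.mul_mem_graded (𝔤.ι_mem hx) ih

theorem envelopingGrade_eq_span (𝔤 : ColorLieAlgebra ε L) (g : G) :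
    𝔤.envelopingGrade g = Submodule.span K {s | ∃ n, 𝔤.IsMonomial n g s} := by
  apply le_antisymm
  · refine Submodule.span_mono ?_
    rintro _ ⟨l, hl, rfl, rfl⟩
    exact ⟨_, IsMonomial.list_prod 𝔤 l hl⟩
  · rw [Submodule.span_le]
    rintro s ⟨n, hs⟩
    exact hs.mem

theorem envelopingGrade_induction (𝔤 : ColorLieAlgebra ε L) {g : G} {N : Submodule K M}
    {f : 𝔤.Enveloping →ₗ[K] M} (hf : ∀ n s, 𝔤.IsMonomial n g s → f s ∈ N) {u : 𝔤.Enveloping}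
    (hu : u ∈ 𝔤.envelopingGrade g) : f u ∈ N := by
  have : 𝔤.envelopingGrade g ≤ N.comap f := by
    rw [envelopingGrade_eq_span, Submodule.span_le]
    rintro s ⟨n, hs⟩
    exact hf n s hs
  exact this hu

theorem envelopingGrade_isInternal (𝔤 : ColorLieAlgebra ε L) :
    DirectSum.IsInternal 𝔤.envelopingGrade :=
  DirectSum.Decomposition.isInternal 𝔤.envelopingGrade

theorem span_monomials (𝔤 : ColorLieAlgebra ε L) :
    Submodule.span K {s | ∃ n g, 𝔤.IsMonomial n g s} = ⊤ := by
  refine eq_top_iff.2 fun u _ => ?_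
  refine internal_induction 𝔤.envelopingGrade_isInternal
    (P := fun u => u ∈ Submodule.span K {s | ∃ n g, 𝔤.IsMonomial n g s})
    (zero_mem _) (fun x y => add_mem) (fun g v hv => ?_) u
  exact envelopingGrade_induction 𝔤 (f := LinearMap.id)
    (fun n s hs => Submodule.subset_span (Set.mem_ofPred.2 ⟨n, g, hs⟩)) hv

theorem monomial_ext (𝔤 : ColorLieAlgebra ε L) {f f' : 𝔤.Enveloping →ₗ[K] M}
    (h : ∀ n g s, 𝔤.IsMonomial n g s → f s = f' s) : f = f' :=
  LinearMap.ext_on 𝔤.span_monomials (by rintro s ⟨n, g, hs⟩; exact h n g s hs)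

/-- A linear subspace of `U(𝔤)` containing `1` and stable under left multiplication by the
homogeneous elements of `𝔤` is everything. -/
theorem mem_of_left_stable (𝔤 : ColorLieAlgebra ε L) (N : Submodule K 𝔤.Enveloping) (h1 : 1 ∈ N)
    (hmul : ∀ g, ∀ x ∈ 𝔤.grade g, ∀ s ∈ N, 𝔤.ι x * s ∈ N) (u : 𝔤.Enveloping) : u ∈ N := by
  have : Submodule.span K {s | ∃ n g, 𝔤.IsMonomial n g s} ≤ N := by
    rw [Submodule.span_le]
    rintro s ⟨n, g, hs⟩
    induction hs with
    | one => exact h1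
    | mul hx _ ih => exact hmul _ _ hx _ ih
  exact this (𝔤.span_monomials ▸ Submodule.mem_top)

end ColorLieAlgebra

namespace ColorLieAlgebra

open scoped TensorProduct

variable {K G : Type*} [Field K] [AddCommGroup G] [DecidableEq G]
  {ε : G → G → Kˣ} {L : Type*} [AddCommGroup L] [Module K L]
  {M : Type*} [AddCommGroup M] [Module K M]

/-! ### The color symmetric algebra and its contraction operators -/

/-- The graded vector space underlying `𝔤`, with the zero bracket. -/
abbrev abelian (𝔤 : ColorLieAlgebra ε L) : ColorLieAlgebra ε L where
  grade := 𝔤.grade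
  isInternal := 𝔤.isInternal
  bracket := 0
  isColorLieBracket := ⟨by simp, by simp, by simp⟩

/-- The color symmetric algebra of the graded vector space underlying `𝔤`: the enveloping algebra
of the zero bracket. -/
abbrev Sym (𝔤 : ColorLieAlgebra ε L) := 𝔤.abelian.Enveloping

/-- The canonical map from `𝔤` to its color symmetric algebra. -/
noncomputable abbrev ιS (𝔤 : ColorLieAlgebra ε L) : L →ₗ[K] 𝔤.Sym := 𝔤.abelian.ι

theorem ιS_comm (𝔤 : ColorLieAlgebra ε L) {g h : G} {x y : L}
    (hx : x ∈ 𝔤.grade g) (hy : y ∈ 𝔤.grade h) :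
    𝔤.ιS x * 𝔤.ιS y = (ε g h : K) • (𝔤.ιS y * 𝔤.ιS x) := by
  simpa using 𝔤.abelian.ι_mul_ι hx hy

theorem ιS_comm_mul (𝔤 : ColorLieAlgebra ε L) {g h : G} {x y : L}
    (hx : x ∈ 𝔤.grade g) (hy : y ∈ 𝔤.grade h) (s : 𝔤.Sym) :
    𝔤.ιS x * (𝔤.ιS y * s) = (ε g h : K) • (𝔤.ιS y * (𝔤.ιS x * s)) := by
  rw [← mul_assoc, 𝔤.ιS_comm hx hy, smul_mul_assoc, mul_assoc]

/-- The action of `𝔤` on `𝔤 ⊗ S` through the second factor: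
`x · (z ⊗ s) = ε(|x|,|z|) z ⊗ x s`. -/
noncomputable def tensorAction (𝔤 : ColorLieAlgebra ε L) :
    L →ₗ[K] (L ⊗[K] 𝔤.Sym) →ₗ[K] (L ⊗[K] 𝔤.Sym) :=
  (TensorProduct.uncurry (.id K) L 𝔤.Sym (L ⊗[K] 𝔤.Sym)) ∘ₗ
    𝔤.twist (LinearMap.mk₂ K
      (fun x z => (TensorProduct.mk K L 𝔤.Sym z) ∘ₗ LinearMap.mulLeft K (𝔤.ιS x))
      (fun _ _ _ => by ext; simp [add_mul, TensorProduct.tmul_add])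
      (fun _ _ _ => by ext; simp)
      (fun _ _ _ => by ext; simp)
      (fun _ _ _ => by ext; simp [TensorProduct.smul_tmul']))

theorem tensorAction_tmul (𝔤 : ColorLieAlgebra ε L) {g h : G} {x z : L}
    (hx : x ∈ 𝔤.grade g) (hz : z ∈ 𝔤.grade h) (s : 𝔤.Sym) :
    𝔤.tensorAction x (z ⊗ₜ s) = (ε g h : K) • z ⊗ₜ[K] (𝔤.ιS x * s) := by
  simp [tensorAction, 𝔤.twist_apply _ hx hz]

/-- Two linear maps on `𝔤 ⊗ V` agree if they agree on `z ⊗ s` for all homogeneous `z`. -/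
theorem tensor_ext (𝔤 : ColorLieAlgebra ε L) {V : Type*} [AddCommGroup V] [Module K V]
    {f f' : L ⊗[K] V →ₗ[K] M}
    (h : ∀ g, ∀ z ∈ 𝔤.grade g, ∀ s, f (z ⊗ₜ s) = f' (z ⊗ₜ s)) : f = f' := by
  apply TensorProduct.ext
  refine internal_ext 𝔤.isInternal fun g z hz => ?_
  ext s
  exact h g z hz s

theorem tensorAction_comm (𝔤 : ColorLieAlgebra ε L) {g h : G}
    {x y : L} (hx : x ∈ 𝔤.grade g) (hy : y ∈ 𝔤.grade h) (w : L ⊗[K] 𝔤.Sym) :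
    𝔤.tensorAction x (𝔤.tensorAction y w)
      = (ε g h : K) • 𝔤.tensorAction y (𝔤.tensorAction x w) := by
  have : 𝔤.tensorAction x ∘ₗ 𝔤.tensorAction y
      = (ε g h : K) • (𝔤.tensorAction y ∘ₗ 𝔤.tensorAction x) := by
    refine 𝔤.tensor_ext fun k z hz s => ?_
    simp only [LinearMap.comp_apply, LinearMap.smul_apply, 𝔤.tensorAction_tmul hx hz,
      𝔤.tensorAction_tmul hy hz, map_smul, smul_smul, 𝔤.ιS_comm_mul hx hy, TensorProduct.tmul_smul]
    congr 1
    ring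
  exact LinearMap.congr_fun this w

/-- The action of `𝔤` on `S × (𝔤 ⊗ S)` that defines the derivation `S → 𝔤 ⊗ S`. -/
noncomputable def derivationAction (𝔤 : ColorLieAlgebra ε L) :
    L →ₗ[K] Module.End K (𝔤.Sym × (L ⊗[K] 𝔤.Sym)) :=
  LinearMap.mk₂ K (fun x v => (𝔤.ιS x * v.1, x ⊗ₜ v.1 + 𝔤.tensorAction x v.2))
    (fun _ _ _ => by ext <;> simp [add_mul, TensorProduct.add_tmul]; abel)
    (fun _ _ _ => by ext <;> simp [TensorProduct.smul_tmul'])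
    (fun _ _ _ => by ext <;> simp [mul_add, TensorProduct.tmul_add]; abel)
    (fun _ _ _ => by ext <;> simp)

theorem derivationAction_apply (𝔤 : ColorLieAlgebra ε L) (x : L) (v : 𝔤.Sym × (L ⊗[K] 𝔤.Sym)) :
    𝔤.derivationAction x v = (𝔤.ιS x * v.1, x ⊗ₜ v.1 + 𝔤.tensorAction x v.2) := rfl

theorem derivationAction_rel (𝔤 : ColorLieAlgebra ε L) (hε : IsAntisymmBicharacter ε)
    (g h : G) (a b : L) (ha : a ∈ 𝔤.abelian.grade g) (hb : b ∈ 𝔤.abelian.grade h) :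
    𝔤.derivationAction a * 𝔤.derivationAction b =
      (ε g h : K) • (𝔤.derivationAction b * 𝔤.derivationAction a)
        + 𝔤.derivationAction (𝔤.abelian.bracket a b) := by
  refine LinearMap.ext fun v => Prod.ext ?_ ?_
  · simp [derivationAction_apply, 𝔤.ιS_comm_mul ha hb]
  · simp only [LinearMap.zero_apply, map_zero, add_zero, Module.End.mul_apply,
      derivationAction_apply, map_add, LinearMap.smul_apply, Prod.smul_mk,
      𝔤.tensorAction_tmul ha hb, 𝔤.tensorAction_tmul hb ha, 𝔤.tensorAction_comm ha hb v.2,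
      smul_add, smul_smul, hε.mul_swap, one_smul]
    abel

/-- The algebra map `S → End(S × (𝔤 ⊗ S))` that extends `derivationAction`. -/
noncomputable def derivationHom (𝔤 : ColorLieAlgebra ε L) (hε : IsAntisymmBicharacter ε) :
    𝔤.Sym →ₐ[K] Module.End K (𝔤.Sym × (L ⊗[K] 𝔤.Sym)) :=
  lift (A := Module.End K (𝔤.Sym × (L ⊗[K] 𝔤.Sym))) 𝔤.abelian 𝔤.derivationAction
    (𝔤.derivationAction_rel hε)

theorem derivationHom_ι (𝔤 : ColorLieAlgebra ε L) (hε : IsAntisymmBicharacter ε) (x : L) :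
    𝔤.derivationHom hε (𝔤.ιS x) = 𝔤.derivationAction x :=
  lift_ι (A := Module.End K (𝔤.Sym × (L ⊗[K] 𝔤.Sym))) _ _ _ x

/-- The derivation `δ : S → 𝔤 ⊗ S` with `δ(1) = 0` and `δ(x s) = x ⊗ s + x · δ(s)`. -/
noncomputable def symDerivation (𝔤 : ColorLieAlgebra ε L) (hε : IsAntisymmBicharacter ε) :
    𝔤.Sym →ₗ[K] L ⊗[K] 𝔤.Sym :=
  LinearMap.snd K 𝔤.Sym (L ⊗[K] 𝔤.Sym) ∘ₗ
    LinearMap.applyₗ ((1, 0) : 𝔤.Sym × (L ⊗[K] 𝔤.Sym)) ∘ₗ (𝔤.derivationHom hε).toLinearMap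

theorem symDerivation_one (𝔤 : ColorLieAlgebra ε L) (hε : IsAntisymmBicharacter ε) :
    𝔤.symDerivation hε 1 = 0 := by
  simp [symDerivation]

theorem symDerivation_ι_mul (𝔤 : ColorLieAlgebra ε L) (hε : IsAntisymmBicharacter ε) (x : L)
    (s : 𝔤.Sym) : 𝔤.symDerivation hε (𝔤.ιS x * s)
      = x ⊗ₜ s + 𝔤.tensorAction x (𝔤.symDerivation hε s) := by
  have h1 : ∀ s : 𝔤.Sym,
      (𝔤.derivationHom hε s (1, 0)).1 = s := by
    intro s
    refine 𝔤.abelian.mem_of_left_stable (LinearMap.eqLocus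
      (LinearMap.fst K 𝔤.Sym (L ⊗[K] 𝔤.Sym) ∘ₗ LinearMap.applyₗ ((1, 0) : 𝔤.Sym × (L ⊗[K] 𝔤.Sym)) ∘ₗ
        (𝔤.derivationHom hε).toLinearMap)
      LinearMap.id) (by simp) ?_ s
    intro g x hx s hs
    simp only [LinearMap.mem_eqLocus, LinearMap.comp_apply, AlgHom.toLinearMap_apply,
      LinearMap.applyₗ_apply_apply, LinearMap.fst_apply, LinearMap.id_apply] at hs ⊢
    rw [map_mul, derivationHom_ι, Module.End.mul_apply, derivationAction_apply, hs]
  simp only [symDerivation, LinearMap.comp_apply, AlgHom.toLinearMap_apply,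
      LinearMap.applyₗ_apply_apply, LinearMap.snd_apply]
  rw [map_mul, derivationHom_ι, Module.End.mul_apply, derivationAction_apply, h1]

/-- For bilinear `E : 𝔤 × S → M`, the linear map `S → M` that sends `z₁ ⋯ zₙ` to the sum of the
`E(zᵢ, z₁ ⋯ ẑᵢ ⋯ zₙ)` with the signs `ε` of moving `zᵢ` to the front. -/
noncomputable def contract (𝔤 : ColorLieAlgebra ε L) (hε : IsAntisymmBicharacter ε) :
    (L →ₗ[K] 𝔤.Sym →ₗ[K] M) →ₗ[K] (𝔤.Sym →ₗ[K] M) :=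
  LinearMap.lcomp K M (𝔤.symDerivation hε) ∘ₗ TensorProduct.uncurry (.id K) L 𝔤.Sym M

/-- The bilinear map `(z, s) ↦ ε(g,|z|) E(z, x s)`, where `g` is the degree of `x`. -/
noncomputable def shift (𝔤 : ColorLieAlgebra ε L) (g : G) (x : L) (E : L →ₗ[K] 𝔤.Sym →ₗ[K] M) :
    L →ₗ[K] 𝔤.Sym →ₗ[K] M :=
  LinearMap.lcomp K M (LinearMap.mulLeft K (𝔤.ιS x)) ∘ₗ E ∘ₗ 𝔤.scale fun h => (ε g h : K)

theorem shift_apply (𝔤 : ColorLieAlgebra ε L) (g : G) (x : L) (E : L →ₗ[K] 𝔤.Sym →ₗ[K] M)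
    {h : G} {z : L} (hz : z ∈ 𝔤.grade h) (s : 𝔤.Sym) :
    𝔤.shift g x E z s = (ε g h : K) • E z (𝔤.ιS x * s) := by
  simp [shift, 𝔤.scale_apply _ hz]

section Contract

variable (𝔤 : ColorLieAlgebra ε L) (hε : IsAntisymmBicharacter ε)

theorem contract_one (E : L →ₗ[K] 𝔤.Sym →ₗ[K] M) : 𝔤.contract hε E 1 = 0 := by
  simp [contract, symDerivation_one]

theorem contract_ι_mul (E : L →ₗ[K] 𝔤.Sym →ₗ[K] M) {g : G} {x : L} (hx : x ∈ 𝔤.grade g)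
    (s : 𝔤.Sym) : 𝔤.contract hε E (𝔤.ιS x * s) = E x s + 𝔤.contract hε (𝔤.shift g x E) s := by
  have : TensorProduct.uncurry (.id K) L 𝔤.Sym M E ∘ₗ 𝔤.tensorAction x
      = TensorProduct.uncurry (.id K) L 𝔤.Sym M (𝔤.shift g x E) := by
    refine 𝔤.tensor_ext fun h z hz s => ?_
    simp [𝔤.tensorAction_tmul hx hz, 𝔤.shift_apply g x E hz]
  have h2 := LinearMap.congr_fun this (𝔤.symDerivation hε s)
  simp only [LinearMap.comp_apply] at h2
  simp [contract, symDerivation_ι_mul, h2]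

theorem contract_ι (E : L →ₗ[K] 𝔤.Sym →ₗ[K] M) (x : L) :
    𝔤.contract hε E (𝔤.ιS x) = E x 1 := by
  have : 𝔤.contract hε E ∘ₗ 𝔤.ιS = E.flip 1 := by
    refine internal_ext 𝔤.isInternal fun g x hx => ?_
    have := 𝔤.contract_ι_mul hε E hx 1
    rwa [mul_one, contract_one, add_zero] at this
  exact LinearMap.congr_fun this x

/-- Values of a contraction on monomials lie in every subspace that contains the values of `E`
on the monomials of length one less and of complementary degree. -/
theorem contract_mem (N : Submodule K M) {n : ℕ} {k : G} (E : L →ₗ[K] 𝔤.Sym →ₗ[K] M)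
    (hE : ∀ g h z s, z ∈ 𝔤.grade g → 𝔤.abelian.IsMonomial n h s → g + h = k → E z s ∈ N)
    {s : 𝔤.Sym} (hs : 𝔤.abelian.IsMonomial (n + 1) k s) : 𝔤.contract hε E s ∈ N := by
  obtain ⟨m, hm⟩ : ∃ m, m = n + 1 := ⟨_, rfl⟩
  rw [← hm] at hs
  induction hs generalizing E n with
  | one => omega
  | @mul m g h x s hx hs ih =>
    obtain rfl : m = n := by omega
    rw [𝔤.contract_ι_mul hε E hx]
    refine add_mem (hE _ _ _ _ hx hs rfl) ?_
    cases m with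
    | zero => cases hs; rw [contract_one]; exact zero_mem _
    | succ m =>
      refine ih _ (fun g' h' z s hz hs e => ?_) rfl
      rw [𝔤.shift_apply _ _ _ hz]
      refine N.smul_mem _ (hE _ _ _ _ hz (IsMonomial.mul hx hs) ?_)
      rw [← e]
      abel

theorem contract_congr {n : ℕ} {k : G} {E E' : L →ₗ[K] 𝔤.Sym →ₗ[K] M}
    (hE : ∀ g h z s, z ∈ 𝔤.grade g → 𝔤.abelian.IsMonomial n h s → g + h = k → E z s = E' z s)
    {s : 𝔤.Sym} (hs : 𝔤.abelian.IsMonomial (n + 1) k s) :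
    𝔤.contract hε E s = 𝔤.contract hε E' s := by
  have := 𝔤.contract_mem hε ⊥ (E - E') (k := k)
    (fun g h z s hz hs e => by simp [hE g h z s hz hs e]) hs
  rw [map_sub, LinearMap.sub_apply, Submodule.mem_bot, sub_eq_zero] at this
  exact this

theorem contract_sub_smul_congr {n : ℕ} {k : G} {E E' E'' : L →ₗ[K] 𝔤.Sym →ₗ[K] M} (c : K)
    (hE : ∀ g h z s, z ∈ 𝔤.grade g → 𝔤.abelian.IsMonomial n h s → g + h = k →
      E z s - c • E' z s = E'' z s) {s : 𝔤.Sym} (hs : 𝔤.abelian.IsMonomial (n + 1) k s) :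
    𝔤.contract hε E s - c • 𝔤.contract hε E' s = 𝔤.contract hε E'' s := by
  rw [← 𝔤.contract_congr hε (E := E - c • E') hE hs, map_sub, map_smul]
  rfl

/-- The bilinear map `(z, s) ↦ f(z s)`. -/
noncomputable def mulPrecomp (f : 𝔤.Sym →ₗ[K] M) : L →ₗ[K] 𝔤.Sym →ₗ[K] M :=
  (LinearMap.mul K 𝔤.Sym).compr₂ f ∘ₗ 𝔤.ιS

theorem mulPrecomp_apply (f : 𝔤.Sym →ₗ[K] M) (z : L) (s : 𝔤.Sym) :
    𝔤.mulPrecomp f z s = f (𝔤.ιS z * s) := rfl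

/-- Euler's identity. -/
theorem contract_mulPrecomp (f : 𝔤.Sym →ₗ[K] M) {n : ℕ} {k : G} {s : 𝔤.Sym}
    (hs : 𝔤.abelian.IsMonomial n k s) : 𝔤.contract hε (𝔤.mulPrecomp f) s = (n : K) • f s := by
  induction hs generalizing f with
  | one => simp [contract_one]
  | @mul m g h x s hx hs ih =>
    have e : 𝔤.shift g x (𝔤.mulPrecomp f) = 𝔤.mulPrecomp (f ∘ₗ LinearMap.mulLeft K (𝔤.ιS x)) := by
      refine internal_ext 𝔤.isInternal fun k z hz => LinearMap.ext fun s => ?_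
      rw [𝔤.shift_apply _ _ _ hz, mulPrecomp_apply, mulPrecomp_apply, LinearMap.comp_apply,
        LinearMap.mulLeft_apply, 𝔤.ιS_comm_mul hx hz, map_smul]
    rw [𝔤.contract_ι_mul hε _ hx, e, ih, mulPrecomp_apply, LinearMap.comp_apply,
      LinearMap.mulLeft_apply, Nat.cast_add, Nat.cast_one, add_smul, one_smul, add_comm]

/-- Contracting an `ε`-skew-symmetric map twice gives zero. -/
theorem contract_contract_skew (e : L →ₗ[K] L →ₗ[K] 𝔤.Sym →ₗ[K] M)
    (he : ∀ g h x y s, x ∈ 𝔤.grade g → y ∈ 𝔤.grade h → e x y s = -((ε g h : K) • e y x s))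
    (s : 𝔤.Sym) : 𝔤.contract hε (𝔤.contract hε ∘ₗ e) s = 0 := by
  have : 𝔤.contract hε (𝔤.contract hε ∘ₗ e) = 0 := by
    refine 𝔤.abelian.monomial_ext fun n k s hs => ?_
    rw [LinearMap.zero_apply]
    induction hs generalizing e with
    | one => simp [contract_one]
    | @mul m g h x s hx hs ih =>
      -- the part of the shift in which the second contraction picks `x`, and the remainder
      let e' : L →ₗ[K] L →ₗ[K] 𝔤.Sym →ₗ[K] M :=
        LinearMap.mk₂ K (fun z y => LinearMap.lcomp K M (LinearMap.mulLeft K (𝔤.ιS x))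
            (e (𝔤.scale (fun h => (ε g h : K)) z) (𝔤.scale (fun h => (ε g h : K)) y)))
          (fun _ _ _ => by simp) (fun _ _ _ => by simp) (fun _ _ _ => by simp)
          (fun _ _ _ => by simp)
      have key : 𝔤.shift g x (𝔤.contract hε ∘ₗ e) = -e x + 𝔤.contract hε ∘ₗ e' := by
        refine internal_ext 𝔤.isInternal fun k z hz => LinearMap.ext fun s => ?_
        have h1 : e' z = (ε g k : K) • 𝔤.shift g x (e z) := by
          refine internal_ext 𝔤.isInternal fun l y hy => LinearMap.ext fun s => ?_
          simp [e', 𝔤.scale_apply _ hz, 𝔤.scale_apply _ hy, 𝔤.shift_apply _ _ _ hy,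
            smul_comm (ε g l : K)]
        rw [𝔤.shift_apply _ _ _ hz, LinearMap.comp_apply, 𝔤.contract_ι_mul hε _ hx]
        simp [h1, he g k x z s hx hz]
      have h2 := ih e' (by
        intro g' h' y z s hy hz
        simp only [e', LinearMap.mk₂_apply, 𝔤.scale_apply _ hy, 𝔤.scale_apply _ hz, map_smul,
          LinearMap.smul_apply, LinearMap.lcomp_apply', LinearMap.comp_apply]
        rw [he g' h' y z _ hy hz]
        simp only [smul_neg, smul_smul]
        congr 2
        ring)
      rw [𝔤.contract_ι_mul hε _ hx, key, map_add, LinearMap.add_apply, h2]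
      simp
  rw [this, LinearMap.zero_apply]

end Contract

end ColorLieAlgebra

/-! ### The algebra of linear operators -/

/-- The algebra of linear operators on `V`: a copy of `Module.End K V` whose additive and scalar
structures come from the ring and algebra structures only. -/
def Op (K V : Type*) [Field K] [AddCommGroup V] [Module K V] := V →ₗ[K] V

namespace Op

variable {K V : Type*} [Field K] [AddCommGroup V] [Module K V]

/-- The linear map underlying an operator. -/
def toLin (T : Op K V) : V →ₗ[K] V := T

/-- A linear map as an operator. -/
def ofLin (T : V →ₗ[K] V) : Op K V := T

noncomputable instance : Ring (Op K V) := inferInstanceAs (Ring (Module.End K V))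

noncomputable instance : Algebra K (Op K V) := inferInstanceAs (Algebra K (Module.End K V))

instance : FunLike (Op K V) V V where
  coe T := T.toLin
  coe_injective _ _ h := LinearMap.ext (congrFun h)

instance : LinearMapClass (Op K V) K V V where
  map_add T := T.toLin.map_add
  map_smulₛₗ T := T.toLin.map_smul

@[simp] theorem toLin_apply (T : Op K V) (v : V) : T.toLin v = T v := rfl

@[simp] theorem ofLin_apply (T : V →ₗ[K] V) (v : V) : ofLin T v = T v := rfl

@[simp] theorem zero_apply (v : V) : (0 : Op K V) v = 0 := rfl

@[simp] theorem one_apply (v : V) : (1 : Op K V) v = v := rfl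

@[simp] theorem add_apply (T T' : Op K V) (v : V) : (T + T') v = T v + T' v := rfl

@[simp] theorem sub_apply (T T' : Op K V) (v : V) : (T - T') v = T v - T' v := rfl

@[simp] theorem smul_apply (c : K) (T : Op K V) (v : V) : (c • T) v = c • T v := rfl

@[simp] theorem mul_apply (T T' : Op K V) (v : V) : (T * T') v = T (T' v) := rfl

@[ext] theorem ext {T T' : Op K V} (h : ∀ v, T v = T' v) : T = T' := LinearMap.ext h

/-- Evaluation at a vector. -/
noncomputable def eval (v : V) : Op K V →ₗ[K] V where
  toFun T := T v
  map_add' _ _ := rfl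
  map_smul' _ _ := rfl

@[simp] theorem eval_apply (T : Op K V) (v : V) : eval v T = T v := rfl

@[simp] theorem sum_apply {ι : Type*} (s : Finset ι) (T : ι → Op K V) (v : V) :
    (∑ i ∈ s, T i) v = ∑ i ∈ s, T i v :=
  map_sum (eval v) T s

/-- Bilinear maps as linear families of operators. -/
noncomputable def ofBilin {W : Type*} [AddCommGroup W] [Module K W] :
    (W →ₗ[K] V →ₗ[K] V) →ₗ[K] W →ₗ[K] Op K V where
  toFun B :=
    { toFun := fun w => ofLin (B w)
      map_add' := fun _ _ => B.map_add _ _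
      map_smul' := fun _ _ => B.map_smul _ _ }
  map_add' _ _ := rfl
  map_smul' _ _ := rfl

@[simp] theorem ofBilin_apply {W : Type*} [AddCommGroup W] [Module K W] (B : W →ₗ[K] V →ₗ[K] V)
    (w : W) (v : V) : ofBilin B w v = B w v := rfl

/-- Linear families of operators as bilinear maps. -/
noncomputable def toBilin {W : Type*} [AddCommGroup W] [Module K W] :
    (W →ₗ[K] Op K V) →ₗ[K] W →ₗ[K] V →ₗ[K] V where
  toFun B :=
    { toFun := fun w => (B w).toLin
      map_add' := fun _ _ => B.map_add _ _
      map_smul' := fun _ _ => B.map_smul _ _ }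
  map_add' _ _ := rfl
  map_smul' _ _ := rfl

end Op

/-! ### Series with values in an algebra -/

section Series

open Finset

theorem sum_antidiagonal_assoc {M : Type*} [AddCommMonoid M] (f : ℕ → ℕ → ℕ → M) (n : ℕ) :
    ∑ p ∈ antidiagonal n, ∑ q ∈ antidiagonal p.1, f q.1 q.2 p.2 =
      ∑ p ∈ antidiagonal n, ∑ q ∈ antidiagonal p.2, f p.1 q.1 q.2 := by
  simp only [Finset.sum_sigma']
  apply Finset.sum_nbij' (fun ⟨⟨_i, j⟩, ⟨k, l⟩⟩ ↦ ⟨(k, l + j), (l, j)⟩)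
    (fun ⟨⟨i, _j⟩, ⟨k, l⟩⟩ ↦ ⟨(i + k, l), (i, k)⟩)
  · rintro ⟨⟨i, j⟩, ⟨k, l⟩⟩ h
    simp only [mem_sigma, HasAntidiagonal.mem_antidiagonal] at h ⊢
    exact ⟨by omega, trivial⟩
  · rintro ⟨⟨i, j⟩, ⟨k, l⟩⟩ h
    simp only [mem_sigma, HasAntidiagonal.mem_antidiagonal] at h ⊢
    exact ⟨by omega, trivial⟩
  · rintro ⟨⟨i, j⟩, ⟨k, l⟩⟩ h
    simp only [mem_sigma, HasAntidiagonal.mem_antidiagonal] at h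
    simp [h.2]
  · rintro ⟨⟨i, j⟩, ⟨k, l⟩⟩ h
    simp only [mem_sigma, HasAntidiagonal.mem_antidiagonal] at h
    simp [h.2]
  · rintro ⟨⟨i, j⟩, ⟨k, l⟩⟩ h
    rfl

theorem sum_antidiagonal_left_comm {M : Type*} [AddCommMonoid M] (f : ℕ → ℕ → ℕ → M) (n : ℕ) :
    ∑ p ∈ antidiagonal n, ∑ q ∈ antidiagonal p.2, f p.1 q.1 q.2 =
      ∑ p ∈ antidiagonal n, ∑ q ∈ antidiagonal p.2, f q.1 p.1 q.2 := by
  rw [← sum_antidiagonal_assoc, ← sum_antidiagonal_assoc fun i j k => f j i k]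
  refine Finset.sum_congr rfl fun p _ => ?_
  exact (Finset.Nat.sum_antidiagonal_swap (n := p.1) (f := fun q : ℕ × ℕ => f q.2 q.1 p.2))

theorem sum_antidiagonal_antidiagonal {M : Type*} [AddCommMonoid M] (f : ℕ → ℕ → ℕ → ℕ → M)
    (n : ℕ) : ∑ p ∈ antidiagonal n, ∑ q ∈ antidiagonal p.1, ∑ r ∈ antidiagonal p.2,
        f q.1 q.2 r.1 r.2
      = ∑ p ∈ antidiagonal n, ∑ q ∈ antidiagonal p.1, ∑ r ∈ antidiagonal p.2,
        f q.1 r.1 q.2 r.2 := by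
  simp only [sum_sigma']
  refine sum_nbij' (fun ⟨_, ⟨i, j⟩, ⟨k, l⟩⟩ => ⟨(i + k, j + l), (i, k), (j, l)⟩)
    (fun ⟨_, ⟨i, j⟩, ⟨k, l⟩⟩ => ⟨(i + k, j + l), (i, k), (j, l)⟩) ?_ ?_ ?_ ?_ ?_
  · rintro ⟨⟨a, b⟩, ⟨i, j⟩, ⟨k, l⟩⟩ h
    simp only [mem_sigma, HasAntidiagonal.mem_antidiagonal] at h ⊢
    exact ⟨by omega, trivial, trivial⟩
  · rintro ⟨⟨a, b⟩, ⟨i, j⟩, ⟨k, l⟩⟩ h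
    simp only [mem_sigma, HasAntidiagonal.mem_antidiagonal] at h ⊢
    exact ⟨by omega, trivial, trivial⟩
  · rintro ⟨⟨a, b⟩, ⟨i, j⟩, ⟨k, l⟩⟩ h
    simp only [mem_sigma, HasAntidiagonal.mem_antidiagonal] at h
    obtain ⟨-, rfl, rfl⟩ := h
    rfl
  · rintro ⟨⟨a, b⟩, ⟨i, j⟩, ⟨k, l⟩⟩ h
    simp only [mem_sigma, HasAntidiagonal.mem_antidiagonal] at h
    obtain ⟨-, rfl, rfl⟩ := h
    rfl
  · rintro ⟨⟨a, b⟩, ⟨i, j⟩, ⟨k, l⟩⟩ _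
    rfl

theorem sum_antidiagonal_eq_add {M : Type*} [AddCommMonoid M] {r : ℕ} (hr : 0 < r)
    (f : ℕ × ℕ → M) (hf : ∀ i j, i + j = r → 0 < i → 0 < j → f (i, j) = 0) :
    ∑ p ∈ antidiagonal r, f p = f (0, r) + f (r, 0) := by
  refine sum_eq_add_of_mem (0, r) (r, 0) (by simp) (by simp) ?_ fun p hp hne => ?_
  · intro h
    exact hr.ne (Prod.mk.inj h).1
  · obtain ⟨i, j⟩ := p
    rw [HasAntidiagonal.mem_antidiagonal] at hp
    simp only at hp
    refine hf i j hp (Nat.pos_of_ne_zero ?_) (Nat.pos_of_ne_zero ?_)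
    · rintro rfl
      exact hne.1 (by simp [← hp])
    · rintro rfl
      exact hne.2 (by simp [← hp])

theorem sum_antidiagonal_eq_first {M : Type*} [AddCommMonoid M] {r : ℕ}
    (f : ℕ × ℕ → M) (hf : ∀ i j, i + j = r → 0 < i → f (i, j) = 0) :
    ∑ p ∈ antidiagonal r, f p = f (0, r) := by
  refine sum_eq_single_of_mem (0, r) (by simp) fun p hp hne => ?_
  obtain ⟨i, j⟩ := p
  rw [HasAntidiagonal.mem_antidiagonal] at hp
  simp only at hp
  refine hf i j hp (Nat.pos_of_ne_zero ?_)
  rintro rfl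
  exact hne (by simp [← hp])

theorem sum_antidiagonal_eq_last {M : Type*} [AddCommMonoid M] {r : ℕ}
    (f : ℕ × ℕ → M) (hf : ∀ i j, i + j = r → 0 < j → f (i, j) = 0) :
    ∑ p ∈ antidiagonal r, f p = f (r, 0) := by
  rw [← Nat.sum_antidiagonal_swap]
  exact sum_antidiagonal_eq_first (fun p => f p.swap) fun i j h hi => hf j i (by omega) hi

theorem sum_antidiagonal_mul_left {M : Type*} [AddCommMonoid M] {r : ℕ} (hr : 0 < r) (m : ℕ)
    (f : ℕ × ℕ → M) (hf : ∀ p, p.1 + p.2 = r * m → ¬ r ∣ p.1 → f p = 0) :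
    ∑ p ∈ antidiagonal (r * m), f p = ∑ q ∈ antidiagonal m, f (r * q.1, r * q.2) := by
  symm
  refine sum_of_injOn (fun q => (r * q.1, r * q.2)) ?_ ?_ ?_ fun _ _ => rfl
  · rintro ⟨i, j⟩ _ ⟨i', j'⟩ _ h
    simp only [Prod.mk.injEq, Nat.mul_right_inj hr.ne'] at h
    exact Prod.ext h.1 h.2
  · rintro ⟨i, j⟩ h
    simp only [mem_coe, HasAntidiagonal.mem_antidiagonal] at h ⊢
    rw [← mul_add, h]
  · rintro ⟨i, j⟩ hp hn
    rw [HasAntidiagonal.mem_antidiagonal] at hp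
    refine hf _ hp fun ⟨k, hk⟩ => hn ?_
    simp only at hk hp
    subst hk
    have hkm : k ≤ m := Nat.le_of_mul_le_mul_left (by omega) hr
    refine ⟨(k, m - k), by simp [hkm], ?_⟩
    simp only [Prod.mk.injEq, true_and]
    rw [Nat.mul_sub]
    omega

variable {K V W A B : Type*} [Field K] [AddCommGroup V] [Module K V] [AddCommGroup W] [Module K W]
  [Ring A] [Algebra K A] [Ring B] [Algebra K B]

theorem coeff_smul' (n : ℕ) (c : K) (a : PowerSeries A) :
    PowerSeries.coeff n (c • a) = c • PowerSeries.coeff n a := rfl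

/-- The `n`-th coefficient, as a `K`-linear map. -/
noncomputable def coeffLin (K : Type*) {A : Type*} [Field K] [Ring A] [Algebra K A] (n : ℕ) :
    PowerSeries A →ₗ[K] A where
  toFun := PowerSeries.coeff n
  map_add' := map_add _
  map_smul' _ _ := rfl

@[simp]
theorem coeffLin_apply (n : ℕ) (a : PowerSeries A) : coeffLin K n a = PowerSeries.coeff n a := rfl

/-- The coefficients of a power series, transported by a linear map. -/
noncomputable def mapCoeffs (e : A →ₗ[K] W) : PowerSeries A →ₗ[K] (ℕ → W) :=
  LinearMap.pi fun n => e ∘ₗ coeffLin K n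

@[simp]
theorem mapCoeffs_apply (e : A →ₗ[K] W) (a : PowerSeries A) (n : ℕ) :
    mapCoeffs e a n = e (PowerSeries.coeff n a) := rfl

/-- The `K[[t]]`-linear extension `V[[t]] → A[[t]]` of a linear map `V → A[[t]]`. -/
noncomputable def seriesLift : (V →ₗ[K] PowerSeries A) →ₗ[K] (ℕ → V) →ₗ[K] PowerSeries A :=
  LinearMap.mk₂ K
    (fun f x => PowerSeries.mk fun n => ∑ p ∈ antidiagonal n, PowerSeries.coeff p.2 (f (x p.1)))
    (fun _ _ _ => by ext; simp [sum_add_distrib])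
    (fun _ _ _ => by ext; simp [smul_sum])
    (fun _ _ _ => by ext; simp [sum_add_distrib])
    (fun _ _ _ => by ext; simp [smul_sum])

theorem coeff_seriesLift (f : V →ₗ[K] PowerSeries A) (x : ℕ → V) (n : ℕ) :
    PowerSeries.coeff n (seriesLift f x)
      = ∑ p ∈ antidiagonal n, PowerSeries.coeff p.2 (f (x p.1)) := by
  simp [seriesLift]

theorem seriesLift_single (f : V →ₗ[K] PowerSeries A) (v : V) :
    seriesLift f (Pi.single 0 v) = f v := by
  ext n
  rw [coeff_seriesLift, sum_antidiagonal_eq_first]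
  · simp
  · intro i j _ hi
    simp [Pi.single_eq_of_ne hi.ne']

theorem seriesLift_mul (f : V →ₗ[K] PowerSeries A) (x : ℕ → V) (a : PowerSeries A) :
    seriesLift f x * a = seriesLift (LinearMap.mulRight K a ∘ₗ f) x := by
  ext n
  simp only [coeff_seriesLift, PowerSeries.coeff_mul, LinearMap.comp_apply,
    LinearMap.mulRight_apply, sum_mul]
  exact sum_antidiagonal_assoc
    (fun i j k => PowerSeries.coeff j (f (x i)) * PowerSeries.coeff k a) n

theorem mul_seriesLift (f : V →ₗ[K] PowerSeries A) (x : ℕ → V) (a : PowerSeries A) :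
    a * seriesLift f x = seriesLift (LinearMap.mulLeft K a ∘ₗ f) x := by
  ext n
  simp only [coeff_seriesLift, PowerSeries.coeff_mul, LinearMap.comp_apply,
    LinearMap.mulLeft_apply, mul_sum]
  exact sum_antidiagonal_left_comm
    (fun i j k => PowerSeries.coeff i a * PowerSeries.coeff k (f (x j))) n

theorem seriesLift_mapCoeffs (f : W →ₗ[K] PowerSeries A) (e : B →ₗ[K] W)
    (h : V →ₗ[K] PowerSeries B) (x : ℕ → V) :
    seriesLift f (mapCoeffs e (seriesLift h x))
      = seriesLift (seriesLift f ∘ₗ mapCoeffs e ∘ₗ h) x := by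
  ext n
  simp only [coeff_seriesLift, LinearMap.comp_apply, mapCoeffs_apply, map_sum]
  exact sum_antidiagonal_assoc
    (fun i j k => PowerSeries.coeff k (f (e (PowerSeries.coeff j (h (x i)))))) n

/-- The constant power series, as a `K`-linear map. -/
noncomputable def constLin (K : Type*) {A : Type*} [Field K] [Ring A] [Algebra K A] :
    A →ₗ[K] PowerSeries A where
  toFun := PowerSeries.C
  map_add' := map_add _
  map_smul' c a := by
    ext n
    rw [coeff_smul', RingHom.id_apply, PowerSeries.coeff_C, PowerSeries.coeff_C]
    split_ifs <;> simp

@[simp]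
theorem constLin_apply (a : A) : constLin K a = PowerSeries.C a := rfl

theorem coeff_seriesLift_const (f : V →ₗ[K] A) (x : ℕ → V) (n : ℕ) :
    PowerSeries.coeff n (seriesLift (constLin K ∘ₗ f) x) = f (x n) := by
  rw [coeff_seriesLift, sum_antidiagonal_eq_last]
  · simp
  · intro i j _ hj
    simp [PowerSeries.coeff_C, hj.ne']

theorem seriesMap_single (f : ℕ → V →ₗ[K] V) (v : V) :
    seriesMap f (Pi.single 0 v) = fun n => f n v := by
  ext n
  rw [seriesMap, sum_antidiagonal_eq_last]
  · simp
  · intro i j _ hj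
    simp [Pi.single_eq_of_ne hj.ne']

/-- The `K[[t]]`-linear action of a series of endomorphisms of `V` on `V[[t]]`. -/
noncomputable def act (T : PowerSeries (Op K V)) (x : ℕ → V) : ℕ → V :=
  seriesMap (fun n => (PowerSeries.coeff n T).toLin) x

theorem act_apply (T : PowerSeries (Op K V)) (x : ℕ → V) (n : ℕ) :
    act T x n = ∑ p ∈ antidiagonal n, PowerSeries.coeff p.1 T (x p.2) := rfl

theorem act_mul (T T' : PowerSeries (Op K V)) (x : ℕ → V) :
    act (T * T') x = act T (act T' x) := by
  ext n
  simp only [act_apply, PowerSeries.coeff_mul, Op.sum_apply, Op.mul_apply, map_sum]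
  exact sum_antidiagonal_assoc
    (fun i j k => PowerSeries.coeff i T (PowerSeries.coeff j T' (x k))) n

/-- The value of a series of endomorphisms of `V` on a vector. -/
noncomputable def evalSeries (T : PowerSeries (Op K V)) : V →ₗ[K] (ℕ → V) :=
  LinearMap.pi fun n => (PowerSeries.coeff n T).toLin

@[simp]
theorem evalSeries_apply (T : PowerSeries (Op K V)) (v : V) (n : ℕ) :
    evalSeries T v n = PowerSeries.coeff n T v := rfl

theorem act_single (T : PowerSeries (Op K V)) (v : V) :
    act T (Pi.single 0 v) = evalSeries T v :=
  seriesMap_single _ v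

theorem evalSeries_mul (T T' : PowerSeries (Op K V)) (v : V) :
    evalSeries (T * T') v = act T (evalSeries T' v) := by
  ext n
  simp [act_apply, PowerSeries.coeff_mul]

theorem seriesLift_act (f : V →ₗ[K] PowerSeries A) (T : PowerSeries (Op K V))
    (x : ℕ → V) : seriesLift f (act T x) = seriesLift (seriesLift f ∘ₗ evalSeries T) x := by
  ext n
  simp only [coeff_seriesLift, act_apply, LinearMap.comp_apply, evalSeries_apply, map_sum]
  rw [sum_antidiagonal_assoc
    (fun i j k => PowerSeries.coeff k (f (PowerSeries.coeff i T (x j))))]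
  exact sum_antidiagonal_left_comm
    (fun i j k => PowerSeries.coeff k (f (PowerSeries.coeff i T (x j)))) n

theorem seriesMul_single_right (φ : ℕ → V →ₗ[K] V →ₗ[K] V) (x : ℕ → V) (z : V) (n : ℕ) :
    seriesMul φ x (Pi.single 0 z) n = ∑ p ∈ antidiagonal n, φ p.1 (x p.2) z := by
  unfold seriesMul
  refine sum_congr rfl fun p _ => ?_
  rw [sum_antidiagonal_eq_last]
  · simp
  · intro i j _ hj
    simp [Pi.single_eq_of_ne hj.ne']

theorem seriesMul_single_single (φ : ℕ → V →ₗ[K] V →ₗ[K] V) (x z : V) :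
    seriesMul φ (Pi.single 0 x) (Pi.single 0 z) = fun n => φ n x z := by
  ext n
  rw [seriesMul_single_right, sum_antidiagonal_eq_last]
  · simp
  · intro i j _ hj
    simp [Pi.single_eq_of_ne hj.ne']

/-- The bilinear map `(x, y) ↦ (φₙ(x, y))ₙ` with values in sequences. -/
def coeffSeq (φ : ℕ → V →ₗ[K] V →ₗ[K] W) : V →ₗ[K] V →ₗ[K] (ℕ → W) :=
  LinearMap.mk₂ K (fun x y n => φ n x y)
    (fun _ _ _ => by ext; simp) (fun _ _ _ => by ext; simp)
    (fun _ _ _ => by ext; simp) (fun _ _ _ => by ext; simp)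

@[simp]
theorem coeffSeq_apply (φ : ℕ → V →ₗ[K] V →ₗ[K] W) (x y : V) (n : ℕ) :
    coeffSeq φ x y n = φ n x y := rfl

theorem seriesLift_coeffSeq (ρ : V →ₗ[K] PowerSeries A) (φ : ℕ → V →ₗ[K] V →ₗ[K] V)
    (x : ℕ → V) (z : V) :
    seriesLift (seriesLift ρ ∘ₗ (coeffSeq φ).flip z) x
      = seriesLift ρ (seriesMul φ x (Pi.single 0 z)) := by
  ext n
  simp only [coeff_seriesLift, LinearMap.comp_apply, LinearMap.flip_apply, coeffSeq_apply,
    seriesMul_single_right, map_sum]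
  rw [sum_antidiagonal_assoc (fun i j k => PowerSeries.coeff k (ρ (φ i (x j) z)))]
  exact sum_antidiagonal_left_comm
    (fun j i k => PowerSeries.coeff k (ρ (φ i (x j) z))) n

end Series

namespace ColorLieAlgebra

/-! ### The grading of the color symmetric algebra by length -/

variable {K G : Type*} [Field K] [AddCommGroup G] [DecidableEq G]
  {ε : G → G → Kˣ} {L : Type*} [AddCommGroup L] [Module K L]
  {M : Type*} [AddCommGroup M] [Module K M]

/-- The span of the monomials of length `n` in the color symmetric algebra. -/
def lengthPart (𝔤 : ColorLieAlgebra ε L) (n : ℕ) : Submodule K 𝔤.Sym :=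
  Submodule.span K {s | ∃ g, 𝔤.abelian.IsMonomial n g s}

theorem mem_lengthPart {𝔤 : ColorLieAlgebra ε L} {n : ℕ} {g : G} {s : 𝔤.Sym}
    (hs : 𝔤.abelian.IsMonomial n g s) : s ∈ 𝔤.lengthPart n :=
  Submodule.subset_span (Set.mem_ofPred.2 ⟨g, hs⟩)

variable [CharZero K]

/-- Monomials of different lengths are eigenvectors of the Euler operator for different
eigenvalues, because the characteristic is zero. -/
theorem lengthPart_isInternal (𝔤 : ColorLieAlgebra ε L) (hε : IsAntisymmBicharacter ε) :
    DirectSum.IsInternal 𝔤.lengthPart := by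
  apply DirectSum.isInternal_submodule_of_iSupIndep_of_iSup_eq_top
  · have h := (Module.End.eigenspaces_iSupIndep
      (𝔤.contract hε (𝔤.mulPrecomp LinearMap.id))).comp (Nat.cast_injective (R := K))
    refine h.mono fun n => ?_
    rw [lengthPart, Submodule.span_le]
    rintro s ⟨g, hs⟩
    exact Module.End.mem_eigenspace_iff.2 (𝔤.contract_mulPrecomp hε LinearMap.id hs)
  · rw [eq_top_iff, ← 𝔤.abelian.span_monomials, Submodule.span_le]
    rintro s ⟨n, g, hs⟩
    exact Submodule.mem_iSup_of_mem n (mem_lengthPart hs)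

/-- The operator on the color symmetric algebra that multiplies monomials of length `n`
by `c n`. -/
noncomputable def lengthScale (𝔤 : ColorLieAlgebra ε L) (hε : IsAntisymmBicharacter ε)
    (c : ℕ → K) : 𝔤.Sym →ₗ[K] 𝔤.Sym :=
  glue (𝔤.lengthPart_isInternal hε) fun n => c n • LinearMap.id

theorem lengthScale_apply (𝔤 : ColorLieAlgebra ε L) (hε : IsAntisymmBicharacter ε) (c : ℕ → K)
    {n : ℕ} {g : G} {s : 𝔤.Sym} (hs : 𝔤.abelian.IsMonomial n g s) :
    𝔤.lengthScale hε c s = c n • s := by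
  simp [lengthScale, glue_apply (𝔤.lengthPart_isInternal hε) _ (mem_lengthPart hs)]

/-- A sequence of linear maps whose values on each monomial are eventually constant has a
limit. -/
theorem exists_limit (𝔤 : ColorLieAlgebra ε L) (hε : IsAntisymmBicharacter ε)
    (f : ℕ → 𝔤.Sym →ₗ[K] M)
    (hf : ∀ k n g s, 𝔤.abelian.IsMonomial n g s → n < k → f (k + 1) s = f k s) :
    ∃ F : 𝔤.Sym →ₗ[K] M, ∀ k n g s, 𝔤.abelian.IsMonomial n g s → n < k → F s = f k s := by
  refine ⟨glue (𝔤.lengthPart_isInternal hε) fun n => f (n + 1), fun k n g s hs hk => ?_⟩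
  rw [glue_apply (𝔤.lengthPart_isInternal hε) _ (mem_lengthPart hs)]
  induction k, hk using Nat.le_induction with
  | base => rfl
  | succ k hk ih => rw [ih, hf k n g s hs hk]

end ColorLieAlgebra

namespace ColorLieAlgebra

open Finset

variable {K G : Type*} [Field K] [AddCommGroup G] [DecidableEq G]
  {ε : G → G → Kˣ} {L : Type*} [AddCommGroup L] [Module K L]

/-! ### Filtrations on series of endomorphisms of the color symmetric algebra -/

/-- The ring of series of endomorphisms of the color symmetric algebra. -/
abbrev OpSeries (𝔤 : ColorLieAlgebra ε L) := PowerSeries (Op K 𝔤.Sym)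

/-- Left multiplication by the elements of `𝔤` on the color symmetric algebra, as a constant
series. -/
noncomputable def mulOp (𝔤 : ColorLieAlgebra ε L) : L →ₗ[K] 𝔤.OpSeries :=
  constLin K ∘ₗ Op.ofBilin (LinearMap.mul K 𝔤.Sym ∘ₗ 𝔤.ιS)

theorem coeff_mul_mulOp (𝔤 : ColorLieAlgebra ε L) (m : ℕ) (a : 𝔤.OpSeries) (x : L) (s : 𝔤.Sym) :
    PowerSeries.coeff m (a * 𝔤.mulOp x) s = PowerSeries.coeff m a (𝔤.ιS x * s) := by
  simp [mulOp]

theorem coeff_mulOp (𝔤 : ColorLieAlgebra ε L) (m : ℕ) (x : L) (s : 𝔤.Sym) :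
    PowerSeries.coeff m (𝔤.mulOp x) s = if m = 0 then 𝔤.ιS x * s else 0 := by
  simp only [mulOp, LinearMap.comp_apply, constLin_apply, PowerSeries.coeff_C]
  split_ifs <;> simp

theorem mulOp_comm (𝔤 : ColorLieAlgebra ε L) {g h : G} {x y : L} (hx : x ∈ 𝔤.grade g)
    (hy : y ∈ 𝔤.grade h) : 𝔤.mulOp x * 𝔤.mulOp y = (ε g h : K) • (𝔤.mulOp y * 𝔤.mulOp x) := by
  ext m s
  rw [coeff_smul', Op.smul_apply, coeff_mul_mulOp, coeff_mul_mulOp, coeff_mulOp,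
    coeff_mulOp, 𝔤.ιS_comm_mul hx hy]
  split_ifs <;> simp

/-- The span of the monomials of degree `g` and length at most `n`. -/
def symFilt (𝔤 : ColorLieAlgebra ε L) (n : ℕ) (g : G) : Submodule K 𝔤.Sym :=
  Submodule.span K {s | ∃ m ≤ n, 𝔤.abelian.IsMonomial m g s}

theorem IsMonomial.mem_symFilt {𝔤 : ColorLieAlgebra ε L} {m n : ℕ} {g : G} {s : 𝔤.Sym}
    (hs : 𝔤.abelian.IsMonomial m g s) (h : m ≤ n) : s ∈ 𝔤.symFilt n g :=
  Submodule.subset_span (Set.mem_ofPred.2 ⟨m, h, hs⟩)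

theorem symFilt_mono (𝔤 : ColorLieAlgebra ε L) {m n : ℕ} (h : m ≤ n) (g : G) :
    𝔤.symFilt m g ≤ 𝔤.symFilt n g := by
  refine Submodule.span_mono ?_
  rintro s ⟨k, hk, hs⟩
  exact ⟨k, hk.trans h, hs⟩

theorem symFilt_le_envelopingGrade (𝔤 : ColorLieAlgebra ε L) (n : ℕ) (g : G) :
    𝔤.symFilt n g ≤ 𝔤.abelian.envelopingGrade g := by
  rw [symFilt, Submodule.span_le]
  rintro s ⟨k, -, hs⟩
  exact hs.mem

/-- The series of operators whose coefficients raise the length by at most `d` and the degree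
by `h`. -/
def opFilt (𝔤 : ColorLieAlgebra ε L) (d : ℕ) (h : G) : Submodule K 𝔤.OpSeries where
  carrier := {a | ∀ m n g s, 𝔤.abelian.IsMonomial n g s →
    PowerSeries.coeff m a s ∈ 𝔤.symFilt (n + d) (g + h)}
  zero_mem' m n g s _ := by simp
  add_mem' ha hb m n g s hs := by
    rw [map_add, Op.add_apply]
    exact add_mem (ha m n g s hs) (hb m n g s hs)
  smul_mem' c a ha m n g s hs := by
    rw [coeff_smul', Op.smul_apply]
    exact Submodule.smul_mem _ _ (ha m n g s hs)

/-- The series of operators that vanish on the monomials of length less than `k`. -/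
def vanishing (𝔤 : ColorLieAlgebra ε L) (k : ℕ) : Submodule K 𝔤.OpSeries where
  carrier := {a | ∀ m n g s, 𝔤.abelian.IsMonomial n g s → n < k → PowerSeries.coeff m a s = 0}
  zero_mem' m n g s _ _ := by simp
  add_mem' ha hb m n g s hs hk := by
    rw [map_add, Op.add_apply, ha m n g s hs hk, hb m n g s hs hk, add_zero]
  smul_mem' c a ha m n g s hs hk := by
    rw [coeff_smul', Op.smul_apply, ha m n g s hs hk, smul_zero]

section Filtrations

variable (𝔤 : ColorLieAlgebra ε L)

theorem opFilt_symFilt {d : ℕ} {h : G} {a : 𝔤.OpSeries} (ha : a ∈ 𝔤.opFilt d h) (m : ℕ) {n : ℕ}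
    {g : G} {s : 𝔤.Sym} (hs : s ∈ 𝔤.symFilt n g) :
    PowerSeries.coeff m a s ∈ 𝔤.symFilt (n + d) (g + h) := by
  have : 𝔤.symFilt n g ≤ (𝔤.symFilt (n + d) (g + h)).comap (PowerSeries.coeff m a).toLin := by
    rw [symFilt, Submodule.span_le]
    rintro s ⟨k, hk, hs⟩
    exact 𝔤.symFilt_mono (by omega) _ (ha m k g s hs)
  exact this hs

theorem mul_mem_opFilt {d d' : ℕ} {h h' : G} {a a' : 𝔤.OpSeries} (ha : a ∈ 𝔤.opFilt d h)
    (ha' : a' ∈ 𝔤.opFilt d' h') : a * a' ∈ 𝔤.opFilt (d + d') (h + h') := by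
  intro m n g s hs
  rw [PowerSeries.coeff_mul, Op.sum_apply]
  refine sum_mem fun p _ => ?_
  rw [add_comm d d', add_comm h h', ← add_assoc, ← add_assoc]
  exact 𝔤.opFilt_symFilt ha _ (ha' _ n g s hs)

theorem opFilt_mono {d d' : ℕ} (hd : d ≤ d') (h : G) : 𝔤.opFilt d h ≤ 𝔤.opFilt d' h :=
  fun _ ha m n g s hs => 𝔤.symFilt_mono (by omega) _ (ha m n g s hs)

theorem mulOp_mem_opFilt {h : G} {x : L} (hx : x ∈ 𝔤.grade h) : 𝔤.mulOp x ∈ 𝔤.opFilt 1 h := by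
  intro m n g s hs
  rw [coeff_mulOp]
  split_ifs
  · rw [add_comm g h]
    exact (IsMonomial.mul (𝔤 := 𝔤.abelian) hx hs).mem_symFilt le_rfl
  · exact zero_mem _

theorem seriesLift_mem_opFilt {d : ℕ} {h h' : G} {ρ : L →ₗ[K] 𝔤.OpSeries}
    (hρ : ∀ x ∈ 𝔤.grade h, ρ x ∈ 𝔤.opFilt d h') {x : ℕ → L} (hx : ∀ n, x n ∈ 𝔤.grade h) :
    seriesLift ρ x ∈ 𝔤.opFilt d h' := by
  intro m n g s hs
  rw [coeff_seriesLift, Op.sum_apply]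
  exact sum_mem fun p _ => hρ _ (hx _) _ n g s hs

theorem seriesLift_mem_vanishing {k : ℕ} {h : G} {ρ : L →ₗ[K] 𝔤.OpSeries}
    (hρ : ∀ x ∈ 𝔤.grade h, ρ x ∈ 𝔤.vanishing k) {x : ℕ → L} (hx : ∀ n, x n ∈ 𝔤.grade h) :
    seriesLift ρ x ∈ 𝔤.vanishing k := by
  intro m n g s hs hk
  rw [coeff_seriesLift, Op.sum_apply]
  exact sum_eq_zero fun p _ => hρ _ (hx _) _ n g s hs hk

theorem mul_mem_vanishing {k : ℕ} (a : 𝔤.OpSeries) {c : 𝔤.OpSeries} (hc : c ∈ 𝔤.vanishing k) :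
    a * c ∈ 𝔤.vanishing k := by
  intro m n g s hs hk
  rw [PowerSeries.coeff_mul, Op.sum_apply]
  exact sum_eq_zero fun p _ => by rw [Op.mul_apply, hc _ n g s hs hk, map_zero]

theorem vanishing_apply {k : ℕ} {c : 𝔤.OpSeries} (hc : c ∈ 𝔤.vanishing k) (m : ℕ) {n : ℕ} {g : G}
    {s : 𝔤.Sym} (hs : s ∈ 𝔤.symFilt n g) (hk : n < k) : PowerSeries.coeff m c s = 0 := by
  have : 𝔤.symFilt n g ≤ LinearMap.ker (PowerSeries.coeff m c).toLin := by
    rw [symFilt, Submodule.span_le]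
    rintro s ⟨n', hn, hs⟩
    exact hc m n' g s hs (by omega)
  exact this hs

theorem vanishing_mul_mem {k : ℕ} {c a : 𝔤.OpSeries} {h : G} (hc : c ∈ 𝔤.vanishing k)
    (ha : a ∈ 𝔤.opFilt 0 h) : c * a ∈ 𝔤.vanishing k := by
  intro m n g s hs hk
  rw [PowerSeries.coeff_mul, Op.sum_apply]
  exact sum_eq_zero fun p _ => 𝔤.vanishing_apply hc _ (ha _ n g s hs) hk

theorem eq_zero_of_mem_vanishing {a : 𝔤.OpSeries} (ha : ∀ k, a ∈ 𝔤.vanishing k) : a = 0 := by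
  ext1 m
  refine 𝔤.abelian.monomial_ext (f := Op.toLin _) (f' := Op.toLin _) fun n g s hs => ?_
  rw [Op.toLin_apply, ha (n + 1) m n g s hs (Nat.lt_succ_self n)]
  simp

end Filtrations

/-! ### The deformed action on the color symmetric algebra -/

section Action

variable (𝔤 : ColorLieAlgebra ε L) (hε : IsAntisymmBicharacter ε) (φ : ℕ → L →ₗ[K] L →ₗ[K] L)

/-- The bilinear map `e(x, y) = ρ([x, y]) - ρ(x) b(y) + ε(|x|,|y|) ρ(y) b(x)`, where
`ρ(x) = x + b(x)` and the bracket is the one with coefficients `φ`. The operators `ρ(x)` satisfy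
the commutator relations if and only if `b(x) y - ε(|x|,|y|) b(y) x = e(x, y)`. -/
noncomputable def errorTerm (b : L →ₗ[K] 𝔤.OpSeries) : L →ₗ[K] L →ₗ[K] 𝔤.OpSeries :=
  (coeffSeq φ).compr₂ (seriesLift (𝔤.mulOp + b))
    - (LinearMap.mul K 𝔤.OpSeries).compl₁₂ (𝔤.mulOp + b) b
    + 𝔤.twist (M := 𝔤.OpSeries) ((LinearMap.mul K 𝔤.OpSeries).compl₁₂ (𝔤.mulOp + b) b).flip

variable {φ}

theorem errorTerm_apply (b : L →ₗ[K] 𝔤.OpSeries) {g h : G} {x y : L} (hx : x ∈ 𝔤.grade g)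
    (hy : y ∈ 𝔤.grade h) : 𝔤.errorTerm φ b x y =
      seriesLift (𝔤.mulOp + b) (coeffSeq φ x y) - (𝔤.mulOp + b) x * b y
        + (ε g h : K) • ((𝔤.mulOp + b) y * b x) := by
  simp [errorTerm, 𝔤.twist_apply _ hx hy, add_mul]

end Action

end ColorLieAlgebra

namespace ColorLieAlgebra

open Finset

variable {K G : Type*} [Field K] [AddCommGroup G] {ε : G → G → Kˣ}

section Jacobi

variable {V : Type*} [AddCommGroup V] [Module K V]

/-- The Jacobi identity with all brackets nested on the left. -/
theorem _root_.IsColorLieBracket.jacobi' {𝒱 : G → Submodule K V} {m : V → V → V}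
    (hε : IsAntisymmBicharacter ε) (hm : IsColorLieBracket ε 𝒱 m)
    (hlin : ∀ (y u : V) (c : K), m y (c • u) = c • m y u) {g h k : G} {x y z : V}
    (hx : x ∈ 𝒱 g) (hy : y ∈ 𝒱 h) (hz : z ∈ 𝒱 k) :
    m (m x y) z - (ε h k : K) • m (m x z) y
      + ((ε g h : K) * ε g k) • m (m y z) x = 0 := by
  have hJ := hm.jacobi g h k x y z hx hy hz
  rw [hm.skew _ _ _ _ (hm.mem _ _ _ _ hx hy) hz, hm.skew _ _ _ _ (hm.mem _ _ _ _ hx hz) hy,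
    hm.skew _ _ _ _ (hm.mem _ _ _ _ hy hz) hx, hm.skew _ _ _ _ hx hz,
    ← neg_smul (ε g k : K) (m z x), hlin]
  have e1 := hε.mul_swap g h
  have e2 := hε.mul_swap g k
  have e3 := hε.mul_swap h k
  simp only [hε.left]
  have : (ε g k : K) • ((ε k g : K) • m x (m y z) + (ε g h : K) • m y (m z x)
      + (ε h k : K) • m z (m x y)) = 0 := by rw [hJ, smul_zero]
  rw [← neg_eq_zero, ← this]
  match_scalars
  · ring
  · linear_combination (ε g h * ε g k : K) * e3
  · linear_combination (ε g k * ε k g : K) * e1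

end Jacobi

variable [DecidableEq G] {L : Type*} [AddCommGroup L] [Module K L]

section Action

variable (𝔤 : ColorLieAlgebra ε L) (hε : IsAntisymmBicharacter ε) {φ : ℕ → L →ₗ[K] L →ₗ[K] L}

/-- The `m`-th coefficient of the error term, as a map to operators and then as a bilinear map in
its second argument and the operand. -/
noncomputable def errorCoeff (φ : ℕ → L →ₗ[K] L →ₗ[K] L) (b : L →ₗ[K] 𝔤.OpSeries) (m : ℕ) :
    L →ₗ[K] L →ₗ[K] 𝔤.Sym →ₗ[K] 𝔤.Sym :=
  Op.toBilin ∘ₗ (𝔤.errorTerm φ b).compr₂ (coeffLin K m)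

@[simp]
theorem errorCoeff_apply (b : L →ₗ[K] 𝔤.OpSeries) (m : ℕ) (y z : L) (s : 𝔤.Sym) :
    𝔤.errorCoeff φ b m y z s = PowerSeries.coeff m (𝔤.errorTerm φ b y z) s := rfl

/-- The coefficients of a deformation are bilinear maps of degree zero. -/
def IsHomogeneousFamily (φ : ℕ → L →ₗ[K] L →ₗ[K] L) : Prop :=
  ∀ n g h a b, a ∈ 𝔤.grade g → b ∈ 𝔤.grade h → φ n a b ∈ 𝔤.grade (g + h)

/-- The linear family of operators `b` has degree zero and does not raise the length. -/
def IsFiltered (b : L →ₗ[K] 𝔤.OpSeries) : Prop :=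
  ∀ h, ∀ y ∈ 𝔤.grade h, b y ∈ 𝔤.opFilt 0 h

variable {𝔤}

theorem IsFiltered.add_mulOp {b : L →ₗ[K] 𝔤.OpSeries} (hb : 𝔤.IsFiltered b) {h : G} {y : L}
    (hy : y ∈ 𝔤.grade h) : (𝔤.mulOp + b) y ∈ 𝔤.opFilt 1 h :=
  add_mem (𝔤.mulOp_mem_opFilt hy) (𝔤.opFilt_mono zero_le_one h (hb h y hy))

theorem errorTerm_mem (hφ : 𝔤.IsHomogeneousFamily φ) {b : L →ₗ[K] 𝔤.OpSeries}
    (hb : 𝔤.IsFiltered b) {g h : G} {x y : L} (hx : x ∈ 𝔤.grade g) (hy : y ∈ 𝔤.grade h) :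
    𝔤.errorTerm φ b x y ∈ 𝔤.opFilt 1 (g + h) := by
  rw [𝔤.errorTerm_apply b hx hy]
  have h1 : seriesLift (𝔤.mulOp + b) (coeffSeq φ x y) ∈ 𝔤.opFilt 1 (g + h) :=
    𝔤.seriesLift_mem_opFilt (h := g + h) (fun z hz => hb.add_mulOp hz)
      fun n => hφ n g h x y hx hy
  have h2 := 𝔤.mul_mem_opFilt (hb.add_mulOp hx) (hb _ _ hy)
  have h3 := 𝔤.mul_mem_opFilt (hb.add_mulOp hy) (hb _ _ hx)
  rw [add_comm h g] at h3
  exact add_mem (sub_mem h1 h2) (Submodule.smul_mem _ _ h3)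

/-- On monomials of length less than `k`, the error term only depends on the values of `b` on
these monomials. -/
theorem errorTerm_sub_mem {b b' : L →ₗ[K] 𝔤.OpSeries} (hφ : 𝔤.IsHomogeneousFamily φ)
    (hb' : 𝔤.IsFiltered b') {k : ℕ}
    (hbb : ∀ h, ∀ y ∈ 𝔤.grade h, b y - b' y ∈ 𝔤.vanishing k) {g h : G} {x y : L}
    (hx : x ∈ 𝔤.grade g) (hy : y ∈ 𝔤.grade h) :
    𝔤.errorTerm φ b x y - 𝔤.errorTerm φ b' x y ∈ 𝔤.vanishing k := by
  have key : ∀ {g h : G} {x y : L}, x ∈ 𝔤.grade g → y ∈ 𝔤.grade h →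
      (𝔤.mulOp + b) x * b y - (𝔤.mulOp + b') x * b' y ∈ 𝔤.vanishing k := by
    intro g h x y hx hy
    have e : (𝔤.mulOp + b) x * b y - (𝔤.mulOp + b') x * b' y
        = (𝔤.mulOp + b) x * (b y - b' y) + (b x - b' x) * b' y := by
      simp only [LinearMap.add_apply]
      noncomm_ring
    rw [e]
    exact add_mem (𝔤.mul_mem_vanishing _ (hbb _ _ hy))
      (𝔤.vanishing_mul_mem (hbb _ _ hx) (hb' _ _ hy))
  have h1 : seriesLift (𝔤.mulOp + b) (coeffSeq φ x y) - seriesLift (𝔤.mulOp + b') (coeffSeq φ x y)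
      ∈ 𝔤.vanishing k := by
    rw [← LinearMap.sub_apply, ← map_sub]
    refine 𝔤.seriesLift_mem_vanishing (fun z hz => ?_) fun n => hφ n g h x y hx hy
    simpa using hbb _ _ hz
  rw [𝔤.errorTerm_apply b hx hy, 𝔤.errorTerm_apply b' hx hy]
  convert add_mem (sub_mem h1 (key hx hy))
    (Submodule.smul_mem _ (ε g h : K) (key hy hx)) using 1
  rw [smul_sub]
  abel

variable [CharZero K] (φ)

variable (𝔤) in
/-- The family of operators whose values on monomials of length `n` are the contractions of the
error term of `b`, divided by `n + 1`. -/
noncomputable def improve (b : L →ₗ[K] 𝔤.OpSeries) : L →ₗ[K] 𝔤.OpSeries where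
  toFun y := PowerSeries.mk fun m => Op.ofLin
    (𝔤.contract hε (𝔤.errorCoeff φ b m y) ∘ₗ 𝔤.lengthScale hε fun n => ((n : K) + 1)⁻¹)
  map_add' x y := by ext m s; simp
  map_smul' c y := by ext m s; simp

variable {φ}

theorem coeff_improve (b : L →ₗ[K] 𝔤.OpSeries) (m : ℕ) (y : L) {n : ℕ} {g : G} {s : 𝔤.Sym}
    (hs : 𝔤.abelian.IsMonomial n g s) : PowerSeries.coeff m (𝔤.improve hε φ b y) s
      = ((n : K) + 1)⁻¹ • 𝔤.contract hε (𝔤.errorCoeff φ b m y) s := by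
  simp [improve, 𝔤.lengthScale_apply hε _ hs]

theorem IsFiltered.improve (hφ : 𝔤.IsHomogeneousFamily φ) {b : L →ₗ[K] 𝔤.OpSeries}
    (hb : 𝔤.IsFiltered b) : 𝔤.IsFiltered (𝔤.improve hε φ b) := by
  intro h y hy m n g s hs
  rw [coeff_improve hε b m y hs]
  refine Submodule.smul_mem _ _ ?_
  cases n with
  | zero => cases hs; rw [contract_one]; exact zero_mem _
  | succ n =>
    refine 𝔤.contract_mem hε _ _ (k := g) (fun k h' z s hz hs e => ?_) hs
    have := errorTerm_mem hφ hb hy hz m n h' s hs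
    rw [errorCoeff_apply]
    convert this using 2
    rw [← e]
    abel

/-- The improvement operation gains one step in the filtration by length, because the contraction
of a monomial only evaluates the error term on monomials that are shorter by one. -/
theorem improve_sub_mem (hφ : 𝔤.IsHomogeneousFamily φ) {b b' : L →ₗ[K] 𝔤.OpSeries}
    (hb' : 𝔤.IsFiltered b') {k : ℕ}
    (hbb : ∀ h, ∀ y ∈ 𝔤.grade h, b y - b' y ∈ 𝔤.vanishing k) {h : G} {y : L}
    (hy : y ∈ 𝔤.grade h) :
    𝔤.improve hε φ b y - 𝔤.improve hε φ b' y ∈ 𝔤.vanishing (k + 1) := by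
  intro m n g s hs hk
  rw [map_sub, Op.sub_apply, coeff_improve hε b m y hs, coeff_improve hε b' m y hs, sub_eq_zero]
  cases n with
  | zero => cases hs; simp [contract_one]
  | succ n =>
    congr 1
    refine 𝔤.contract_congr hε (fun g' h' z s' hz hs' _ => ?_) hs
    have := errorTerm_sub_mem hφ hb' hbb hy hz m n h' s' hs' (by omega)
    rw [map_sub, Op.sub_apply, sub_eq_zero] at this
    exact this

/-- The improvement operation has a fixed point, because it is contracting for the filtration by
length. -/
theorem exists_improve_eq (hφ : 𝔤.IsHomogeneousFamily φ) :
    ∃ b : L →ₗ[K] 𝔤.OpSeries, 𝔤.IsFiltered b ∧ 𝔤.improve hε φ b = b := by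
  let f : ℕ → L →ₗ[K] 𝔤.OpSeries := fun k => (𝔤.improve hε φ)^[k] 0
  have fsucc : ∀ k, f (k + 1) = 𝔤.improve hε φ (f k) := fun k =>
    Function.iterate_succ_apply' _ _ _
  have hf : ∀ k, 𝔤.IsFiltered (f k) := by
    intro k
    induction k with
    | zero => exact fun h y _ => zero_mem (𝔤.opFilt 0 h)
    | succ k ih => rw [fsucc]; exact ih.improve hε hφ
  have hstep : ∀ k h, ∀ y ∈ 𝔤.grade h, f (k + 1) y - f k y ∈ 𝔤.vanishing k := by
    intro k
    induction k with
    | zero => intro h y _ m n g s _ hk; omega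
    | succ k ih =>
      intro h y hy
      rw [fsucc (k + 1), fsucc k]
      rw [fsucc k] at ih
      exact improve_sub_mem hε hφ (hf k) ih hy
  let F : ℕ → 𝔤.Sym →ₗ[K] L →ₗ[K] (ℕ → 𝔤.Sym) := fun k =>
    LinearMap.mk₂ K (fun s y m => PowerSeries.coeff m (f k y) s)
      (fun _ _ _ => by ext; simp) (fun _ _ _ => by ext; simp)
      (fun _ _ _ => by ext; simp) (fun _ _ _ => by ext; simp)
  have hF : ∀ k n g s, 𝔤.abelian.IsMonomial n g s → n < k → F (k + 1) s = F k s := by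
    intro k n g s hs hk
    refine internal_ext (M := ℕ → 𝔤.Sym) 𝔤.isInternal fun h y hy => ?_
    ext m
    have := hstep k h y hy m n g s hs hk
    rw [map_sub, Op.sub_apply, sub_eq_zero] at this
    exact this
  obtain ⟨B, hB⟩ := 𝔤.exists_limit (M := L →ₗ[K] (ℕ → 𝔤.Sym)) hε F hF
  let b : L →ₗ[K] 𝔤.OpSeries :=
    { toFun := fun y => PowerSeries.mk fun m =>
        Op.ofLin (LinearMap.proj m ∘ₗ LinearMap.applyₗ y ∘ₗ B)
      map_add' := fun x y => by ext m s; simp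
      map_smul' := fun c y => by ext m s; simp }
  have hb : ∀ k m n g s y, 𝔤.abelian.IsMonomial n g s → n < k →
      PowerSeries.coeff m (b y) s = PowerSeries.coeff m (f k y) s := by
    intro k m n g s y hs hk
    have := congrFun (LinearMap.congr_fun (hB k n g s hs hk) y) m
    simpa [b, F] using this
  have hbk : ∀ k y, b y - f k y ∈ 𝔤.vanishing k := by
    intro k y m n g s hs hk
    rw [map_sub, Op.sub_apply, hb k m n g s y hs hk, sub_self]
  refine ⟨b, ?_, ?_⟩
  · intro h y hy m n g s hs
    rw [hb (n + 1) m n g s y hs (Nat.lt_succ_self n)]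
    exact hf (n + 1) h y hy m n g s hs
  · refine internal_ext 𝔤.isInternal fun h y hy => ?_
    rw [← sub_eq_zero]
    refine 𝔤.eq_zero_of_mem_vanishing fun k => ?_
    have h1 := improve_sub_mem hε hφ (hf k) (fun h y _ => hbk k y) hy
    rw [← fsucc] at h1
    have h2 := sub_mem h1 (hbk (k + 1) y)
    rw [sub_sub_sub_cancel_right] at h2
    exact fun m n g s hs hk => h2 m n g s hs (by omega)

end Action

end ColorLieAlgebra

namespace ColorLieAlgebra

open Finset

variable {K G : Type*} [Field K] [AddCommGroup G] {ε : G → G → Kˣ} [DecidableEq G]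
  {L : Type*} [AddCommGroup L] [Module K L]

section Relations

variable {𝔤 : ColorLieAlgebra ε L} {φ : ℕ → L →ₗ[K] L →ₗ[K] L}

theorem IsGradedDeformation.isHomogeneousFamily (hφ : 𝔤.IsGradedDeformation φ) :
    𝔤.IsHomogeneousFamily φ := hφ.mem

theorem single_mem_seriesGrade {g : G} {x : L} (hx : x ∈ 𝔤.grade g) :
    (Pi.single 0 x : ℕ → L) ∈ seriesGrade 𝔤.grade g := by
  intro n _
  by_cases h : n = 0
  · subst h; simpa using hx
  · simp [Pi.single_eq_of_ne h]

/-- The Jacobi identity of a deformation, on three elements of `𝔤`. -/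
theorem IsGradedDeformation.jacobi (hφ : 𝔤.IsGradedDeformation φ)
    (hε : IsAntisymmBicharacter ε) {g h k : G} {x y z : L}
    (hx : x ∈ 𝔤.grade g) (hy : y ∈ 𝔤.grade h) (hz : z ∈ 𝔤.grade k) :
    seriesMul φ (coeffSeq φ x y) (Pi.single 0 z)
      - (ε h k : K) • seriesMul φ (coeffSeq φ x z) (Pi.single 0 y)
      + ((ε g h : K) * ε g k) • seriesMul φ (coeffSeq φ y z) (Pi.single 0 x) = 0 := by
  have := hφ.isColorLieBracket.jacobi' hε
    (fun y u c => by ext n; simp [seriesMul, Finset.smul_sum])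
    (single_mem_seriesGrade hx) (single_mem_seriesGrade hy) (single_mem_seriesGrade hz)
  rw [seriesMul_single_single, seriesMul_single_single, seriesMul_single_single] at this
  exact this

variable (𝔤) in
/-- The defect of the commutator relation of `x` and `y` for the operators `ρ`. -/
noncomputable def relDefect (φ : ℕ → L →ₗ[K] L →ₗ[K] L) (ρ : L →ₗ[K] 𝔤.OpSeries) (c : K)
    (x y : L) : 𝔤.OpSeries :=
  ρ x * ρ y - c • (ρ y * ρ x) - seriesLift ρ (coeffSeq φ x y)

/-- The commutator relations, up to the filtration by length, for a series `w` in place of an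
element of `𝔤`. -/
theorem relDefect_series_mem {ρ : L →ₗ[K] 𝔤.OpSeries} {k : ℕ} {g : G} {c : K} {z : L}
    (h : ∀ x ∈ 𝔤.grade g, 𝔤.relDefect φ ρ c x z ∈ 𝔤.vanishing k) {w : ℕ → L}
    (hw : ∀ n, w n ∈ 𝔤.grade g) :
    seriesLift ρ w * ρ z - c • (ρ z * seriesLift ρ w)
      - seriesLift ρ (seriesMul φ w (Pi.single 0 z)) ∈ 𝔤.vanishing k := by
  rw [seriesLift_mul, mul_seriesLift, ← seriesLift_coeffSeq, ← LinearMap.smul_apply, ← map_smul,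
    ← LinearMap.sub_apply, ← map_sub, ← LinearMap.sub_apply, ← map_sub]
  exact 𝔤.seriesLift_mem_vanishing h hw

/-- The error term differs from the left-hand side of the equation for `b` by the defect of the
commutator relation. -/
theorem errorTerm_eq (b : L →ₗ[K] 𝔤.OpSeries) {g h : G} {x y : L} (hx : x ∈ 𝔤.grade g)
    (hy : y ∈ 𝔤.grade h) : 𝔤.errorTerm φ b x y = b x * 𝔤.mulOp y
      - (ε g h : K) • (b y * 𝔤.mulOp x) - 𝔤.relDefect φ (𝔤.mulOp + b) (ε g h) x y := by
  rw [𝔤.errorTerm_apply b hx hy, relDefect]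
  simp only [LinearMap.add_apply, add_mul, mul_add, 𝔤.mulOp_comm hx hy, smul_add]
  abel

theorem errorTerm_skew (hε : IsAntisymmBicharacter ε) (hφ : 𝔤.IsGradedDeformation φ)
    (b : L →ₗ[K] 𝔤.OpSeries) {g h : G} {x y : L}
    (hx : x ∈ 𝔤.grade g) (hy : y ∈ 𝔤.grade h) :
    𝔤.errorTerm φ b x y = -((ε g h : K) • 𝔤.errorTerm φ b y x) := by
  have e : coeffSeq φ x y = -((ε g h : K) • coeffSeq φ y x) := by
    ext n
    exact hφ.skew n g h x y hx hy
  rw [𝔤.errorTerm_apply b hx hy, 𝔤.errorTerm_apply b hy hx, e, map_neg, map_smul]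
  simp only [smul_add, smul_sub, smul_smul, hε.mul_swap, one_smul]
  abel

/-- If the commutator relations hold on monomials of length less than `k`, then the error term
satisfies there the cocycle condition of the Koszul complex. -/
theorem errorTerm_closed (hε : IsAntisymmBicharacter ε) (hφ : 𝔤.IsGradedDeformation φ)
    {b : L →ₗ[K] 𝔤.OpSeries}
    (hb : 𝔤.IsFiltered b) {k : ℕ}
    (hr : ∀ g h x y, x ∈ 𝔤.grade g → y ∈ 𝔤.grade h →
      𝔤.relDefect φ (𝔤.mulOp + b) (ε g h) x y ∈ 𝔤.vanishing k)
    {g h l : G} {x y z : L} (hx : x ∈ 𝔤.grade g) (hy : y ∈ 𝔤.grade h) (hz : z ∈ 𝔤.grade l) :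
    𝔤.errorTerm φ b x y * 𝔤.mulOp z - (ε h l : K) • (𝔤.errorTerm φ b x z * 𝔤.mulOp y)
      + ((ε g h : K) * ε g l) • (𝔤.errorTerm φ b y z * 𝔤.mulOp x) ∈ 𝔤.vanishing k := by
  set ρ := 𝔤.mulOp + b with hρ
  set H1 := seriesLift ρ (coeffSeq φ x y) with hH1
  set H2 := seriesLift ρ (coeffSeq φ x z) with hH2
  set H3 := seriesLift ρ (coeffSeq φ y z) with hH3
  set J1 := seriesLift ρ (seriesMul φ (coeffSeq φ x y) (Pi.single 0 z))
  set J2 := seriesLift ρ (seriesMul φ (coeffSeq φ x z) (Pi.single 0 y))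
  set J3 := seriesLift ρ (seriesMul φ (coeffSeq φ y z) (Pi.single 0 x))
  set r1 := 𝔤.relDefect φ ρ (ε g h) x y with hr1
  set r2 := 𝔤.relDefect φ ρ (ε g l) x z with hr2
  set r3 := 𝔤.relDefect φ ρ (ε h l) y z with hr3
  have hJ : J1 - (ε h l : K) • J2 + ((ε g h : K) * ε g l) • J3 = 0 := by
    have := congrArg (seriesLift ρ) (hφ.jacobi hε hx hy hz)
    rwa [map_add, map_sub, map_smul, map_smul, map_zero] at this
  have M1 : H1 * ρ z - ((ε g l : K) * ε h l) • (ρ z * H1) - J1 ∈ 𝔤.vanishing k := by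
    have := relDefect_series_mem (φ := φ) (fun w hw => hr (g + h) l w z hw hz)
      (w := coeffSeq φ x y) fun n => hφ.mem n g h x y hx hy
    rwa [hε.left] at this
  have M2 : (ε h l : K) • (H2 * ρ y) - (ε g h : K) • (ρ y * H2) - (ε h l : K) • J2
      ∈ 𝔤.vanishing k := by
    have := relDefect_series_mem (φ := φ) (fun w hw => hr (g + l) h w y hw hy)
      (w := coeffSeq φ x z) fun n => hφ.mem n g l x z hx hz
    convert Submodule.smul_mem _ (ε h l : K) this using 1
    simp only [hε.left, smul_sub, smul_smul, mul_left_comm (ε h l : K), hε.mul_swap, mul_one]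
    rfl
  have M3 : ((ε g h : K) * ε g l) • (H3 * ρ x) - ρ x * H3 - ((ε g h : K) * ε g l) • J3
      ∈ 𝔤.vanishing k := by
    have := relDefect_series_mem (φ := φ) (fun w hw => hr (h + l) g w x hw hx)
      (w := coeffSeq φ y z) fun n => hφ.mem n h l y z hy hz
    convert Submodule.smul_mem _ ((ε g h : K) * ε g l) this using 1
    have e : (ε g h : K) * ε g l * (ε h g * ε l g) = 1 := by
      rw [mul_mul_mul_comm, hε.mul_swap, hε.mul_swap, one_mul]
    simp only [hε.left, smul_sub, smul_smul, e, one_smul]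
    rfl
  have m1 : r1 ∈ 𝔤.vanishing k := hr _ _ _ _ hx hy
  have m2 : r2 ∈ 𝔤.vanishing k := hr _ _ _ _ hx hz
  have m3 : r3 ∈ 𝔤.vanishing k := hr _ _ _ _ hy hz
  -- by the commutation rules of the left multiplications only the defects contribute
  have s1 : 𝔤.errorTerm φ b x y * 𝔤.mulOp z - (ε h l : K) • (𝔤.errorTerm φ b x z * 𝔤.mulOp y)
      + ((ε g h : K) * ε g l) • (𝔤.errorTerm φ b y z * 𝔤.mulOp x)
      = -(r1 * 𝔤.mulOp z - (ε h l : K) • (r2 * 𝔤.mulOp y)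
        + ((ε g h : K) * ε g l) • (r3 * 𝔤.mulOp x)) := by
    rw [errorTerm_eq b hx hy, errorTerm_eq b hx hz, errorTerm_eq b hy hz]
    simp only [sub_mul, smul_mul_assoc, mul_assoc, 𝔤.mulOp_comm hx hy, 𝔤.mulOp_comm hx hz,
      𝔤.mulOp_comm hy hz, mul_smul_comm]
    module
  have s2 : r1 * 𝔤.mulOp z - (ε h l : K) • (r2 * 𝔤.mulOp y)
        + ((ε g h : K) * ε g l) • (r3 * 𝔤.mulOp x)
      = (r1 * ρ z - (ε h l : K) • (r2 * ρ y) + ((ε g h : K) * ε g l) • (r3 * ρ x))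
        - (r1 * b z - (ε h l : K) • (r2 * b y) + ((ε g h : K) * ε g l) • (r3 * b x)) := by
    simp only [hρ, LinearMap.add_apply, mul_add]
    module
  have s3 : r1 * ρ z - (ε h l : K) • (r2 * ρ y) + ((ε g h : K) * ε g l) • (r3 * ρ x)
      = (ρ x * r3 - (ε g h : K) • (ρ y * r2) + ((ε g l : K) * ε h l) • (ρ z * r1))
        - (H1 * ρ z - ((ε g l : K) * ε h l) • (ρ z * H1) - J1)
        + ((ε h l : K) • (H2 * ρ y) - (ε g h : K) • (ρ y * H2) - (ε h l : K) • J2)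
        - (((ε g h : K) * ε g l) • (H3 * ρ x) - ρ x * H3 - ((ε g h : K) * ε g l) • J3)
        - (J1 - (ε h l : K) • J2 + ((ε g h : K) * ε g l) • J3) := by
    rw [hr1, hr2, hr3, relDefect, relDefect, relDefect, ← hH1, ← hH2, ← hH3]
    simp only [sub_mul, mul_sub, smul_mul_assoc, mul_smul_comm, mul_assoc]
    module
  rw [s1, s2, s3, hJ, sub_zero]
  refine neg_mem (sub_mem (sub_mem (add_mem (sub_mem ?_ M1) M2) M3) ?_)
  · exact add_mem (sub_mem (𝔤.mul_mem_vanishing _ m3)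
      (Submodule.smul_mem _ _ (𝔤.mul_mem_vanishing _ m2)))
      (Submodule.smul_mem _ _ (𝔤.mul_mem_vanishing _ m1))
  · exact add_mem (sub_mem (𝔤.vanishing_mul_mem m1 (hb _ _ hz))
      (Submodule.smul_mem _ _ (𝔤.vanishing_mul_mem m2 (hb _ _ hy))))
      (Submodule.smul_mem _ _ (𝔤.vanishing_mul_mem m3 (hb _ _ hx)))

variable [CharZero K]

theorem contract_errorCoeff (hε : IsAntisymmBicharacter ε) {b : L →ₗ[K] 𝔤.OpSeries}
    (hfix : 𝔤.improve hε φ b = b) (m : ℕ) (y : L) {n : ℕ} {g : G} {s : 𝔤.Sym}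
    (hs : 𝔤.abelian.IsMonomial n g s) : 𝔤.contract hε (𝔤.errorCoeff φ b m y) s
      = ((n : K) + 1) • PowerSeries.coeff m (b y) s := by
  have h := coeff_improve hε (φ := φ) b m y hs
  rw [hfix] at h
  rw [h, smul_smul, mul_inv_cancel₀ (Nat.cast_add_one_ne_zero n), one_smul]

/-- The Poincaré lemma for the Koszul complex, in the form needed here: the contraction of a
closed error term solves the equation for the commutator relations in one degree more. -/
theorem relDefect_mem_succ (hε : IsAntisymmBicharacter ε) (hφ : 𝔤.IsGradedDeformation φ)
    {b : L →ₗ[K] 𝔤.OpSeries} (hb : 𝔤.IsFiltered b) (hfix : 𝔤.improve hε φ b = b) {k : ℕ}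
    (hr : ∀ g h x y, x ∈ 𝔤.grade g → y ∈ 𝔤.grade h →
      𝔤.relDefect φ (𝔤.mulOp + b) (ε g h) x y ∈ 𝔤.vanishing k)
    {g h : G} {x y : L} (hx : x ∈ 𝔤.grade g) (hy : y ∈ 𝔤.grade h) :
    𝔤.relDefect φ (𝔤.mulOp + b) (ε g h) x y ∈ 𝔤.vanishing (k + 1) := by
  intro m n d s hs hk
  have e0 : 𝔤.relDefect φ (𝔤.mulOp + b) (ε g h) x y
      = b x * 𝔤.mulOp y - (ε g h : K) • (b y * 𝔤.mulOp x) - 𝔤.errorTerm φ b x y := by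
    rw [errorTerm_eq b hx hy]
    abel
  rw [e0, map_sub, map_sub, coeff_smul', Op.sub_apply, Op.sub_apply, Op.smul_apply,
    coeff_mul_mulOp, coeff_mul_mulOp, sub_eq_zero]
  have hx' := contract_errorCoeff hε hfix m x (IsMonomial.mul (𝔤 := 𝔤.abelian) hy hs)
  have hy' := contract_errorCoeff hε hfix m y (IsMonomial.mul (𝔤 := 𝔤.abelian) hx hs)
  rw [𝔤.contract_ι_mul hε _ hy] at hx'
  rw [𝔤.contract_ι_mul hε _ hx] at hy'
  set E := 𝔤.errorCoeff φ b m with hE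
  have hskew : E x y s = -((ε g h : K) • E y x s) := by
    simp only [hE, errorCoeff_apply]
    rw [errorTerm_skew hε hφ b hx hy, map_neg, coeff_smul']
    rfl
  have hshift : 𝔤.contract hε (𝔤.shift h y (E x)) s
      - (ε g h : K) • 𝔤.contract hε (𝔤.shift g x (E y)) s = (n : K) • E x y s := by
    rw [← 𝔤.contract_mulPrecomp hε (E x y) hs]
    cases n with
    | zero => cases hs; rw [contract_one, contract_one, contract_one, smul_zero, sub_zero]
    | succ n =>
      refine 𝔤.contract_sub_smul_congr hε _ (fun l l' z s' hz hs' _ => ?_) hs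
      have := errorTerm_closed hε hφ hb hr hx hy hz m n l' s' hs' (by omega)
      rw [map_add, map_sub, coeff_smul', coeff_smul', Op.add_apply, Op.sub_apply, Op.smul_apply,
        Op.smul_apply, coeff_mul_mulOp, coeff_mul_mulOp, coeff_mul_mulOp] at this
      rw [𝔤.shift_apply _ _ _ hz, 𝔤.shift_apply _ _ _ hz, mulPrecomp_apply, smul_smul]
      simp only [hE, errorCoeff_apply]
      rw [← sub_eq_zero, ← neg_eq_zero, ← this]
      module
  have hne : (((n + 1 : ℕ) : K) + 1) ≠ 0 := Nat.cast_add_one_ne_zero (n + 1)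
  have key : (((n + 1 : ℕ) : K) + 1) • (PowerSeries.coeff m (b x) (𝔤.ιS y * s)
      - (ε g h : K) • PowerSeries.coeff m (b y) (𝔤.ιS x * s))
      = (((n + 1 : ℕ) : K) + 1) • E x y s := by
    rw [smul_sub, smul_comm _ (ε g h : K), ← hx', ← hy']
    have e1 : (((n + 1 : ℕ) : K) + 1) • E x y s = E x y s + E x y s + (n : K) • E x y s := by
      push_cast
      module
    rw [e1, ← hshift]
    nth_rewrite 3 [hskew]
    module
  exact smul_right_injective _ hne key

/-- The operators `ρ(x)`, `x ∈ 𝔤`, on the color symmetric algebra with coefficients in `K[[t]]`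
form a representation of the deformed color Lie algebra that is a perturbation of the left
multiplications; the last condition normalizes them such that symmetrization intertwines them
with left multiplication. -/
structure IsSymRep (𝔤 : ColorLieAlgebra ε L) (hε : IsAntisymmBicharacter ε)
    (φ : ℕ → L →ₗ[K] L →ₗ[K] L) (ρ : L →ₗ[K] 𝔤.OpSeries) : Prop where
  filtered : 𝔤.IsFiltered (ρ - 𝔤.mulOp)
  rel : ∀ g h x y, x ∈ 𝔤.grade g → y ∈ 𝔤.grade h →
    ρ x * ρ y - (ε g h : K) • (ρ y * ρ x) = seriesLift ρ (coeffSeq φ x y)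
  normalized : ∀ m s, 𝔤.contract hε (Op.toBilin (coeffLin K m ∘ₗ (ρ - 𝔤.mulOp))) s = 0

/-- Every graded deformation of `𝔤` acts on the color symmetric algebra, by a normalized
perturbation of the left multiplications. -/
theorem exists_isSymRep (hε : IsAntisymmBicharacter ε) (hφ : 𝔤.IsGradedDeformation φ) :
    ∃ ρ, 𝔤.IsSymRep hε φ ρ := by
  obtain ⟨b, hb, hfix⟩ := exists_improve_eq hε hφ.isHomogeneousFamily
  refine ⟨𝔤.mulOp + b, ?_, ?_, ?_⟩
  · rwa [add_sub_cancel_left]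
  · intro g h x y hx hy
    have key : ∀ k g h x y, x ∈ 𝔤.grade g → y ∈ 𝔤.grade h →
        𝔤.relDefect φ (𝔤.mulOp + b) (ε g h) x y ∈ 𝔤.vanishing k := by
      intro k
      induction k with
      | zero => intro g h x y _ _ m n d s _ hk; omega
      | succ k ih => exact fun g h x y hx hy => relDefect_mem_succ hε hφ hb hfix ih hx hy
    exact sub_eq_zero.1 (𝔤.eq_zero_of_mem_vanishing fun k => key k g h x y hx hy)
  · intro m s
    rw [add_sub_cancel_left]
    have : 𝔤.contract hε (Op.toBilin (coeffLin K m ∘ₗ b)) = 0 := by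
      refine 𝔤.abelian.monomial_ext fun n d s hs => ?_
      cases n with
      | zero => cases hs; rw [contract_one, LinearMap.zero_apply]
      | succ n =>
        have h1 := 𝔤.contract_contract_skew hε (𝔤.errorCoeff φ b m) (fun g h x y s hx hy => by
          rw [errorCoeff_apply, errorTerm_skew hε hφ b hx hy, map_neg, coeff_smul']
          rfl) s
        have h2 : 𝔤.contract hε (𝔤.contract hε ∘ₗ 𝔤.errorCoeff φ b m) s
            = 𝔤.contract hε (((n : K) + 1) • Op.toBilin (coeffLin K m ∘ₗ b)) s := by
          refine 𝔤.contract_congr hε (fun l l' z s' _ hs' _ => ?_) hs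
          rw [LinearMap.comp_apply, contract_errorCoeff hε hfix m z hs']
          rfl
        rw [h1, map_smul, LinearMap.smul_apply] at h2
        rw [LinearMap.zero_apply]
        exact (smul_eq_zero.1 h2.symm).resolve_left (Nat.cast_add_one_ne_zero n)
    rw [this, LinearMap.zero_apply]

end Relations

end ColorLieAlgebra

namespace ColorLieAlgebra

open Finset

variable {K G : Type*} [Field K] [AddCommGroup G] {ε : G → G → Kˣ} [DecidableEq G]
  {L : Type*} [AddCommGroup L] [Module K L]

/-! ### Symmetrization -/

section Counit

/-- The augmentation of the color symmetric algebra. -/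
noncomputable def counit (𝔤 : ColorLieAlgebra ε L) : 𝔤.Sym →ₐ[K] K :=
  𝔤.abelian.lift 0 (by simp)

variable {𝔤 : ColorLieAlgebra ε L}

theorem counit_ι_mul (x : L) (s : 𝔤.Sym) : 𝔤.counit (𝔤.ιS x * s) = 0 := by
  rw [map_mul, counit, lift_ι, LinearMap.zero_apply, zero_mul]

theorem counit_of_isMonomial {n : ℕ} {g : G} {s : 𝔤.Sym}
    (hs : 𝔤.abelian.IsMonomial (n + 1) g s) : 𝔤.counit s = 0 := by
  cases hs with
  | mul hx hs => exact counit_ι_mul _ _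

end Counit

theorem contract_compr₂ (𝔤 : ColorLieAlgebra ε L) (hε : IsAntisymmBicharacter ε) {M N : Type*}
    [AddCommGroup M] [Module K M] [AddCommGroup N] [Module K N] (E : L →ₗ[K] 𝔤.Sym →ₗ[K] M)
    (f : M →ₗ[K] N) (s : 𝔤.Sym) : 𝔤.contract hε (E.compr₂ f) s = f (𝔤.contract hε E s) := by
  have : TensorProduct.uncurry (.id K) L 𝔤.Sym N (E.compr₂ f)
      = f ∘ₗ TensorProduct.uncurry (.id K) L 𝔤.Sym M E := by
    refine 𝔤.tensor_ext fun g z _ s => ?_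
    simp
  exact LinearMap.congr_fun this _

section Symmetrization

variable (𝔤 : ColorLieAlgebra ε L) (hε : IsAntisymmBicharacter ε)
  {A B : Type*} [Ring A] [Algebra K A] [Ring B] [Algebra K B]

/-- The linear map `σ` from the color symmetric algebra to `A` is the symmetrization of
`j : 𝔤 → A`: it sends `z₁ ⋯ zₙ` to the average over all permutations of the products of the `j zᵢ`,
with the signs given by `ε`. This is encoded by a recursion on the first factor. -/
structure IsSymmetrization (j : L →ₗ[K] A) (σ : 𝔤.Sym →ₗ[K] A) : Prop where
  one : σ 1 = 1
  smul_apply : ∀ n g s, 𝔤.abelian.IsMonomial n g s →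
    (n : K) • σ s = 𝔤.contract hε ((LinearMap.mul K A).compl₁₂ j σ) s

variable {𝔤 hε} {j : L →ₗ[K] A} {σ : 𝔤.Sym →ₗ[K] A}

theorem IsSymmetrization.apply_ι (hσ : 𝔤.IsSymmetrization hε j σ) (x : L) : σ (𝔤.ιS x) = j x := by
  have : σ ∘ₗ 𝔤.ιS = j := by
    refine internal_ext 𝔤.isInternal fun g x hx => ?_
    have := hσ.smul_apply 1 g _ (𝔤.abelian.isMonomial_ι hx)
    rw [contract_ι] at this
    simpa [hσ.one] using this
  exact LinearMap.congr_fun this x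

/-- Symmetrization is functorial for maps compatible with multiplication by the `j x` from the
left. -/
theorem IsSymmetrization.map (hσ : 𝔤.IsSymmetrization hε j σ) {j' : L →ₗ[K] B} (f : A →ₗ[K] B)
    (h1 : f 1 = 1) (hmul : ∀ x a, f (j x * a) = j' x * f a) :
    𝔤.IsSymmetrization hε j' (f ∘ₗ σ) := by
  refine ⟨by rw [LinearMap.comp_apply, hσ.one, h1], fun n g s hs => ?_⟩
  rw [LinearMap.comp_apply, ← map_smul, hσ.smul_apply n g s hs, ← contract_compr₂]
  congr 2
  refine LinearMap.ext₂ fun x s => ?_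
  exact hmul x (σ s)

variable [CharZero K]

theorem IsSymmetrization.unique {σ' : 𝔤.Sym →ₗ[K] A} (hσ : 𝔤.IsSymmetrization hε j σ)
    (hσ' : 𝔤.IsSymmetrization hε j σ') : σ = σ' := by
  refine 𝔤.abelian.monomial_ext fun n => ?_
  induction n with
  | zero => intro g s hs; cases hs; rw [hσ.one, hσ'.one]
  | succ n ih =>
    intro g s hs
    refine smul_right_injective _ (Nat.cast_ne_zero (R := K).2 n.succ_ne_zero) ?_
    change ((n + 1 : ℕ) : K) • σ s = ((n + 1 : ℕ) : K) • σ' s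
    rw [hσ.smul_apply _ g s hs, hσ'.smul_apply _ g s hs]
    refine 𝔤.contract_congr hε (fun g' h z s' _ hs' _ => ?_) hs
    simp [ih h s' hs']

variable (𝔤 hε j) in
theorem exists_isSymmetrization : ∃ σ, 𝔤.IsSymmetrization hε j σ := by
  -- `step` solves the recursion for monomials that are longer by one; the augmentation
  -- supplies the value at `1`
  let step : (𝔤.Sym →ₗ[K] A) → 𝔤.Sym →ₗ[K] A := fun τ =>
    Algebra.linearMap K A ∘ₗ 𝔤.counit.toLinearMap
      + 𝔤.contract hε ((LinearMap.mul K A).compl₁₂ j τ) ∘ₗ 𝔤.lengthScale hε fun n => (n : K)⁻¹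
  let f : ℕ → 𝔤.Sym →ₗ[K] A := fun k => step^[k] 0
  have hf1 : ∀ k, f (k + 1) 1 = 1 := by
    intro k
    simp [f, step, Function.iterate_succ_apply', 𝔤.lengthScale_apply hε _ IsMonomial.one]
  have hfs : ∀ k n g s, 𝔤.abelian.IsMonomial (n + 1) g s → f (k + 1) s
      = ((n + 1 : ℕ) : K)⁻¹ • 𝔤.contract hε ((LinearMap.mul K A).compl₁₂ j (f k)) s := by
    intro k n g s hs
    simp only [f, Function.iterate_succ_apply']
    simp [step, 𝔤.lengthScale_apply hε _ hs, counit_of_isMonomial hs]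
  have hf : ∀ k n g s, 𝔤.abelian.IsMonomial n g s → n < k → f (k + 1) s = f k s := by
    intro k
    induction k with
    | zero => intro n g s _ h; omega
    | succ k ih =>
      intro n g s hs hk
      cases n with
      | zero => cases hs; rw [hf1, hf1]
      | succ n =>
        rw [hfs (k + 1) n g s hs, hfs k n g s hs]
        congr 1
        refine 𝔤.contract_congr hε (fun g' h z s' _ hs' _ => ?_) hs
        simp [ih n h s' hs' (by omega)]
  obtain ⟨σ, hσ⟩ := 𝔤.exists_limit hε f hf
  refine ⟨σ, ?_, fun n g s hs => ?_⟩
  · rw [hσ 1 0 0 1 IsMonomial.one zero_lt_one, hf1]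
  · cases n with
    | zero => cases hs; rw [contract_one]; simp
    | succ n =>
      rw [hσ (n + 2) _ g s hs (by omega), hfs (n + 1) n g s hs, smul_smul,
        mul_inv_cancel₀ (Nat.cast_ne_zero.2 n.succ_ne_zero), one_smul]
      refine 𝔤.contract_congr hε (fun g' h z s' _ hs' _ => ?_) hs
      simp [hσ (n + 1) n h s' hs' (by omega)]

end Symmetrization

section Intertwining

variable {𝔤 : ColorLieAlgebra ε L} {hε : IsAntisymmBicharacter ε}
  {φ : ℕ → L →ₗ[K] L →ₗ[K] L} {ρ : L →ₗ[K] 𝔤.OpSeries}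
  {A : Type*} [Ring A] [Algebra K A] (j : L →ₗ[K] PowerSeries A) (σ : 𝔤.Sym →ₗ[K] PowerSeries A)

variable (ρ) in
/-- The defect of `σ` to intertwine the operators `ρ x` with the multiplications by `j x`. -/
noncomputable def intertwiningDefect : L →ₗ[K] 𝔤.Sym →ₗ[K] PowerSeries A :=
  LinearMap.mk₂ K (fun x s => seriesLift σ (evalSeries (ρ x) s) - j x * σ s)
    (fun x y s => by
      have : evalSeries (ρ (x + y)) s = evalSeries (ρ x) s + evalSeries (ρ y) s := by
        ext m; simp
      rw [this]; simp only [map_add, add_mul]; abel)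
    (fun c x s => by
      have : evalSeries (ρ (c • x)) s = c • evalSeries (ρ x) s := by
        ext m; simp
      rw [this]; simp only [map_smul, smul_mul_assoc, smul_sub])
    (fun x s s' => by simp only [map_add, mul_add]; abel)
    (fun c x s => by simp only [map_smul, mul_smul_comm, smul_sub])

theorem intertwiningDefect_apply (x : L) (s : 𝔤.Sym) :
    intertwiningDefect ρ j σ x s = seriesLift σ (evalSeries (ρ x) s) - j x * σ s := rfl

theorem seriesLift_intertwiningDefect (x : L) (v : ℕ → 𝔤.Sym) :
    seriesLift (intertwiningDefect ρ j σ x) v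
      = seriesLift σ (act (ρ x) v) - j x * seriesLift σ v := by
  rw [seriesLift_act, mul_seriesLift, ← LinearMap.sub_apply, ← map_sub]
  rfl

theorem seriesLift_flip_intertwiningDefect (w : ℕ → L) (s : 𝔤.Sym) :
    seriesLift ((intertwiningDefect ρ j σ).flip s) w
      = seriesLift σ (evalSeries (seriesLift ρ w) s) - seriesLift j w * σ s := by
  have e : evalSeries (seriesLift ρ w) s = mapCoeffs (Op.eval s) (seriesLift ρ w) := rfl
  rw [e, seriesLift_mapCoeffs, seriesLift_mul, ← LinearMap.sub_apply, ← map_sub]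
  rfl

theorem seriesLift_eq_zero {V : Type*} [AddCommGroup V] [Module K V] {f : V →ₗ[K] PowerSeries A}
    {v : ℕ → V} (h : ∀ n, f (v n) = 0) : seriesLift f v = 0 := by
  ext n
  rw [coeff_seriesLift]
  exact sum_eq_zero fun p _ => by rw [h, map_zero]

/-- The bilinear map `(x, s) ↦ ρ(x) s - x s` with values in `S[[t]]`. -/
noncomputable def perturbation (ρ : L →ₗ[K] 𝔤.OpSeries) : L →ₗ[K] 𝔤.Sym →ₗ[K] (ℕ → 𝔤.Sym) :=
  LinearMap.mk₂ K (fun x s => evalSeries ((ρ - 𝔤.mulOp) x) s)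
    (fun _ _ _ => by ext m; simp only [map_add, evalSeries_apply, Op.add_apply, Pi.add_apply])
    (fun _ _ _ => by
      ext m; simp only [map_smul, evalSeries_apply, coeff_smul', Op.smul_apply, Pi.smul_apply])
    (fun _ _ _ => map_add _ _ _)
    (fun _ _ _ => map_smul _ _ _)

theorem perturbation_apply (ρ : L →ₗ[K] 𝔤.OpSeries) (x : L) (s : 𝔤.Sym) :
    perturbation ρ x s = evalSeries ((ρ - 𝔤.mulOp) x) s := rfl

theorem evalSeries_eq_single_add (ρ : L →ₗ[K] 𝔤.OpSeries) (x : L) (s : 𝔤.Sym) :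
    evalSeries (ρ x) s = Pi.single 0 (𝔤.ιS x * s) + perturbation ρ x s := by
  ext m
  simp only [Pi.add_apply, perturbation_apply, evalSeries_apply, LinearMap.sub_apply, map_sub,
    Op.sub_apply, coeff_mulOp]
  by_cases hm : m = 0
  · subst hm; simp
  · simp [hm]

theorem IsSymRep.contract_perturbation (hρ : 𝔤.IsSymRep hε φ ρ) (s : 𝔤.Sym) :
    𝔤.contract hε (perturbation ρ) s = 0 := by
  ext m
  have := 𝔤.contract_compr₂ hε (perturbation ρ) (LinearMap.proj m) s
  rw [LinearMap.proj_apply] at this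
  rw [← this]
  exact hρ.normalized m s

variable {j σ}

/-- If the intertwining defect vanishes on monomials shorter than `s`, then it is symmetric on
monomials of the length of `s`. -/
theorem intertwiningDefect_symm (hφ : 𝔤.IsHomogeneousFamily φ) (hρ : 𝔤.IsSymRep hε φ ρ)
    (hj : ∀ g h x y, x ∈ 𝔤.grade g → y ∈ 𝔤.grade h →
      j x * j y - (ε g h : K) • (j y * j x) = seriesLift j (coeffSeq φ x y)) {n : ℕ}
    (ih : ∀ m ≤ n, ∀ g h x s, x ∈ 𝔤.grade g → 𝔤.abelian.IsMonomial m h s →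
      intertwiningDefect ρ j σ x s = 0)
    {g h k : G} {x y : L} {s : 𝔤.Sym} (hx : x ∈ 𝔤.grade g) (hy : y ∈ 𝔤.grade h)
    (hs : 𝔤.abelian.IsMonomial n k s) : intertwiningDefect ρ j σ x (𝔤.ιS y * s)
      = (ε g h : K) • intertwiningDefect ρ j σ y (𝔤.ιS x * s) := by
  have key : ∀ {g h : G} {x y : L}, x ∈ 𝔤.grade g → y ∈ 𝔤.grade h →
      intertwiningDefect ρ j σ x (𝔤.ιS y * s)
        = seriesLift σ (evalSeries (ρ x * ρ y) s) - j x * (j y * σ s) := by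
    intro g h x y hx hy
    have e1 : seriesLift (intertwiningDefect ρ j σ x) (perturbation ρ y s) = 0 := by
      refine seriesLift_eq_zero fun m => ?_
      have hm := hρ.filtered h y hy m n k s hs
      have : 𝔤.symFilt n (k + h) ≤ LinearMap.ker (intertwiningDefect ρ j σ x) := by
        rw [symFilt, Submodule.span_le]
        rintro s' ⟨m', hm', hs'⟩
        exact ih m' hm' g _ x s' hx hs'
      exact this hm
    have e2 : seriesLift σ (evalSeries (ρ y) s) = j y * σ s :=
      sub_eq_zero.1 (ih n le_rfl h k y s hy hs)
    have e3 := seriesLift_intertwiningDefect (ρ := ρ) j σ x (evalSeries (ρ y) s)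
    rw [← evalSeries_mul, e2] at e3
    rw [← e3, evalSeries_eq_single_add, map_add, e1, seriesLift_single, add_zero]
  rw [key hx hy, key hy hx, ← sub_eq_zero]
  have e4 := seriesLift_flip_intertwiningDefect (ρ := ρ) j σ (coeffSeq φ x y) s
  rw [seriesLift_eq_zero (f := (intertwiningDefect ρ j σ).flip s) (v := coeffSeq φ x y)
      fun m => ih n le_rfl _ _ _ _ (hφ m g h x y hx hy) hs,
    ← hρ.rel g h x y hx hy, ← hj g h x y hx hy] at e4
  have e5 : evalSeries (ρ x * ρ y - (ε g h : K) • (ρ y * ρ x)) s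
      = evalSeries (ρ x * ρ y) s - (ε g h : K) • evalSeries (ρ y * ρ x) s := by
    ext m; simp
  rw [e5, map_sub, map_smul, sub_mul, smul_mul_assoc, mul_assoc, mul_assoc] at e4
  rw [e4]
  module

/-- The contraction of the defect vanishes, by the recursion for `σ` and the normalization
of `ρ`. -/
theorem contract_intertwiningDefect (hρ : 𝔤.IsSymRep hε φ ρ) (hσ : 𝔤.IsSymmetrization hε j σ)
    {n : ℕ} {g : G} {s : 𝔤.Sym} (hs : 𝔤.abelian.IsMonomial n g s) :
    𝔤.contract hε (intertwiningDefect ρ j σ) s = 0 := by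
  have e : intertwiningDefect ρ j σ + (LinearMap.mul K (PowerSeries A)).compl₁₂ j σ
      = 𝔤.mulPrecomp σ + (perturbation ρ).compr₂ (seriesLift σ) := by
    refine LinearMap.ext₂ fun x s => ?_
    rw [LinearMap.add_apply, LinearMap.add_apply, intertwiningDefect_apply,
      evalSeries_eq_single_add, map_add, seriesLift_single]
    exact sub_add_cancel _ _
  have h := congrArg (fun B => 𝔤.contract hε B s) e
  simp only [map_add, LinearMap.add_apply, contract_compr₂, hρ.contract_perturbation, map_zero,
    add_zero, 𝔤.contract_mulPrecomp hε σ hs, ← hσ.smul_apply n g s hs] at h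
  exact right_eq_add.1 h.symm

variable [CharZero K]

/-- Symmetrization intertwines the action on the color symmetric algebra with left
multiplication. -/
theorem IsSymmetrization.intertwines (hσ : 𝔤.IsSymmetrization hε j σ)
    (hφ : 𝔤.IsHomogeneousFamily φ) (hρ : 𝔤.IsSymRep hε φ ρ)
    (hj : ∀ g h x y, x ∈ 𝔤.grade g → y ∈ 𝔤.grade h →
      j x * j y - (ε g h : K) • (j y * j x) = seriesLift j (coeffSeq φ x y))
    (x : L) (s : 𝔤.Sym) : seriesLift σ (evalSeries (ρ x) s) = j x * σ s := by
  have key : ∀ n g h x s, x ∈ 𝔤.grade g → 𝔤.abelian.IsMonomial n h s →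
      intertwiningDefect ρ j σ x s = 0 := by
    intro n
    induction n using Nat.strong_induction_on with
    | _ n ih =>
      intro g h x s hx hs
      have h1 := contract_intertwiningDefect hρ hσ (IsMonomial.mul (𝔤 := 𝔤.abelian) hx hs)
      have h2 : 𝔤.contract hε (𝔤.shift g x (intertwiningDefect ρ j σ)) s
          = (n : K) • intertwiningDefect ρ j σ x s := by
        rw [← 𝔤.contract_mulPrecomp hε _ hs]
        cases n with
        | zero => cases hs; rw [contract_one, contract_one]
        | succ n =>
          -- by symmetry, all the terms of the contraction are equal
          refine 𝔤.contract_congr hε (fun k l z s' hz hs' _ => ?_) hs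
          rw [𝔤.shift_apply _ _ _ hz, mulPrecomp_apply,
            intertwiningDefect_symm hφ hρ hj (fun m hm => ih m (by omega)) hx hz hs']
      rw [𝔤.contract_ι_mul hε _ hx, h2] at h1
      have h3 : ((n : K) + 1) • intertwiningDefect ρ j σ x s = 0 := by
        rw [← h1]; module
      exact (smul_eq_zero.1 h3).resolve_left (Nat.cast_add_one_ne_zero n)
  have : intertwiningDefect ρ j σ = 0 := by
    refine internal_ext 𝔤.isInternal fun g x hx => ?_
    exact 𝔤.abelian.monomial_ext fun n h s hs => key n g h x s hx hs
  have h := LinearMap.congr_fun₂ this x s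
  exact sub_eq_zero.1 h

end Intertwining

end ColorLieAlgebra

namespace ColorLieAlgebra

open Finset

variable {K G : Type*} [Field K] [AddCommGroup G] {ε : G → G → Kˣ} [DecidableEq G]
  {L : Type*} [AddCommGroup L] [Module K L]

/-! ### The star product -/

section Star

variable {𝔤 : ColorLieAlgebra ε L} {hε : IsAntisymmBicharacter ε}
  {φ : ℕ → L →ₗ[K] L →ₗ[K] L} {ρ : L →ₗ[K] 𝔤.OpSeries} {σ : 𝔤.Sym →ₗ[K] 𝔤.OpSeries}

/-- The normalization of a representation `ρ` says that `ρ(a) 1 = a`. -/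
theorem IsSymRep.evalSeries_one (hρ : 𝔤.IsSymRep hε φ ρ) (a : L) :
    evalSeries (ρ a) 1 = Pi.single 0 (𝔤.ιS a) := by
  have := hρ.contract_perturbation (𝔤.ιS a)
  rw [contract_ι] at this
  rw [evalSeries_eq_single_add, this, add_zero, mul_one]

theorem IsSymRep.mem_opFilt (hρ : 𝔤.IsSymRep hε φ ρ) {g : G} {x : L} (hx : x ∈ 𝔤.grade g) :
    ρ x ∈ 𝔤.opFilt 1 g := by
  have := hρ.filtered.add_mulOp hx
  rwa [add_sub_cancel] at this

theorem opFilt_envelopingGrade {d : ℕ} {h : G} {a : 𝔤.OpSeries} (ha : a ∈ 𝔤.opFilt d h) (m : ℕ)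
    {g : G} {s : 𝔤.Sym} (hs : s ∈ 𝔤.abelian.envelopingGrade g) :
    PowerSeries.coeff m a s ∈ 𝔤.abelian.envelopingGrade (g + h) :=
  𝔤.abelian.envelopingGrade_induction (f := (PowerSeries.coeff m a).toLin)
    (fun n s hs => 𝔤.symFilt_le_envelopingGrade (n + d) (g + h) (ha m n g s hs)) hs

variable (σ) in
/-- The coefficients of the star product `s ⋆ s' = σ(s) s'` on the color symmetric algebra. -/
noncomputable def star (m : ℕ) : 𝔤.Sym →ₗ[K] 𝔤.Sym →ₗ[K] 𝔤.Sym :=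
  Op.toBilin (coeffLin K m ∘ₗ σ)

theorem star_apply (m : ℕ) (s s' : 𝔤.Sym) :
    star σ m s s' = PowerSeries.coeff m (σ s) s' := rfl

theorem seriesMul_star (x y : ℕ → 𝔤.Sym) : seriesMul (star σ) x y = act (seriesLift σ x) y := by
  ext n
  simp only [seriesMul, act_apply, coeff_seriesLift, star_apply, Op.sum_apply]
  rw [sum_antidiagonal_assoc (fun i j k => PowerSeries.coeff j (σ (x i)) (y k))]
  exact sum_antidiagonal_left_comm (fun i j k => PowerSeries.coeff i (σ (x j)) (y k)) n

/-- The star commutator of elements of `𝔤` is the deformed bracket. -/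
theorem IsSymmetrization.star_commutator (hσ : 𝔤.IsSymmetrization hε ρ σ)
    (hρ : 𝔤.IsSymRep hε φ ρ) (m : ℕ) {g h : G} {a b : L} (ha : a ∈ 𝔤.grade g)
    (hb : b ∈ 𝔤.grade h) : star σ m (𝔤.ιS a) (𝔤.ιS b)
      - (ε g h : K) • star σ m (𝔤.ιS b) (𝔤.ιS a) = 𝔤.ιS (φ m a b) := by
  have h1 : ∀ a b : L, star σ m (𝔤.ιS a) (𝔤.ιS b) = PowerSeries.coeff m (ρ a * ρ b) 1 := by
    intro a b
    have := congrFun (evalSeries_mul (ρ a) (ρ b) 1) m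
    rw [hρ.evalSeries_one, act_single] at this
    rw [star_apply, hσ.apply_ι]
    exact this.symm
  have h2 := congrArg (fun T : 𝔤.OpSeries => PowerSeries.coeff m T 1) (hρ.rel g h a b ha hb)
  simp only [map_sub, coeff_smul', Op.sub_apply, Op.smul_apply] at h2
  rw [h1, h1, h2, coeff_seriesLift, Op.sum_apply, sum_antidiagonal_eq_last]
  · exact congrFun (hρ.evalSeries_one (φ m a b)) 0
  · intro i j _ hj
    have := congrFun (hρ.evalSeries_one (coeffSeq φ a b i)) j
    rw [Pi.single_eq_of_ne hj.ne'] at this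
    exact this

variable [CharZero K]

/-- Symmetrization with respect to a representation inverts the evaluation of operators at `1`. -/
theorem IsSymmetrization.evalSeries_one (hσ : 𝔤.IsSymmetrization hε ρ σ)
    (hρ : 𝔤.IsSymRep hε φ ρ) (s : 𝔤.Sym) : evalSeries (σ s) 1 = Pi.single 0 s := by
  have key : mapCoeffs (Op.eval 1) ∘ₗ σ = LinearMap.single K (fun _ => 𝔤.Sym) 0 := by
    refine 𝔤.abelian.monomial_ext fun n => ?_
    induction n with
    | zero =>
      intro g s hs
      cases hs
      ext m
      by_cases hm : m = 0
      · subst hm; simp [hσ.one]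
      · simp [hσ.one, hm, PowerSeries.coeff_one]
    | succ n ih =>
      intro g s hs
      refine smul_right_injective _ (Nat.cast_ne_zero (R := K).2 n.succ_ne_zero) ?_
      change ((n + 1 : ℕ) : K) • mapCoeffs (Op.eval 1) (σ s)
        = ((n + 1 : ℕ) : K) • LinearMap.single K (fun _ => 𝔤.Sym) 0 s
      rw [← map_smul, hσ.smul_apply _ g s hs, ← contract_compr₂, ← 𝔤.contract_mulPrecomp hε _ hs]
      have e : 𝔤.contract hε
          (((LinearMap.mul K 𝔤.OpSeries).compl₁₂ ρ σ).compr₂ (mapCoeffs (Op.eval 1))) s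
          = 𝔤.contract hε
            (𝔤.mulPrecomp (LinearMap.single K (fun _ => 𝔤.Sym) 0) + perturbation ρ) s := by
        refine 𝔤.contract_congr hε (fun g' h z s' _ hs' _ => ?_) hs
        have h1 : evalSeries (σ s') 1 = Pi.single 0 s' := ih h s' hs'
        have h2 : evalSeries (ρ z * σ s') 1 = evalSeries (ρ z) s' := by
          rw [evalSeries_mul, h1, act_single]
        rw [evalSeries_eq_single_add] at h2
        exact h2
      rw [e, map_add, LinearMap.add_apply, hρ.contract_perturbation, add_zero]
  exact LinearMap.congr_fun key s

/-- Values of a symmetrization on monomials lie in every filtration by subspaces that is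
compatible with multiplication by the `j z`. -/
theorem IsSymmetrization.mem {A : Type*} [Ring A] [Algebra K A] {j : L →ₗ[K] A}
    {τ : 𝔤.Sym →ₗ[K] A} (hτ : 𝔤.IsSymmetrization hε j τ) (N : ℕ → G → Submodule K A)
    (h1 : 1 ∈ N 0 0) (hmul : ∀ n g h x a, x ∈ 𝔤.grade g → a ∈ N n h → j x * a ∈ N (n + 1) (g + h))
    {n : ℕ} {g : G} {s : 𝔤.Sym} (hs : 𝔤.abelian.IsMonomial n g s) : τ s ∈ N n g := by
  induction n generalizing g s with
  | zero => cases hs; rwa [hτ.one]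
  | succ n ih =>
    rw [← Submodule.smul_mem_iff _ (Nat.cast_ne_zero (R := K).2 n.succ_ne_zero),
      hτ.smul_apply _ g s hs]
    refine 𝔤.contract_mem hε _ _ (fun g' h z s' hz hs' e => ?_) hs
    rw [← e]
    exact hmul n g' h z _ hz (ih hs')

theorem IsSymmetrization.mem_opFilt (hσ : 𝔤.IsSymmetrization hε ρ σ)
    (hρ : 𝔤.IsSymRep hε φ ρ) {n : ℕ} {g : G} {s : 𝔤.Sym} (hs : 𝔤.abelian.IsMonomial n g s) :
    σ s ∈ 𝔤.opFilt n g := by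
  refine hσ.mem 𝔤.opFilt (fun m n g s hs => ?_) (fun n g h x a hx ha => ?_) hs
  · rw [PowerSeries.coeff_one]
    split_ifs
    · simpa using hs.mem_symFilt le_rfl
    · exact zero_mem _
  · rw [add_comm n 1]
    exact 𝔤.mul_mem_opFilt (hρ.mem_opFilt hx) ha

/-- The star product is compatible with the composition of operators. -/
theorem IsSymmetrization.mul_eq (hσ : 𝔤.IsSymmetrization hε ρ σ)
    (hφ : 𝔤.IsHomogeneousFamily φ) (hρ : 𝔤.IsSymRep hε φ ρ) (s s' : 𝔤.Sym) :
    seriesLift σ (evalSeries (σ s) s') = σ s * σ s' := by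
  -- the operators with which `σ` intertwines left multiplication form a subalgebra
  let N : Submodule K 𝔤.OpSeries :=
    { carrier := {T | ∀ s', seriesLift σ (evalSeries T s') = T * σ s'}
      zero_mem' := fun s' => by
        have : evalSeries (0 : 𝔤.OpSeries) s' = 0 := by ext; simp
        rw [this, map_zero, zero_mul]
      add_mem' := fun {T T'} hT hT' s' => by
        have : evalSeries (T + T') s' = evalSeries T s' + evalSeries T' s' := by ext; simp
        rw [this, map_add, add_mul, hT s', hT' s']
      smul_mem' := fun c T hT s' => by
        have : evalSeries (c • T) s' = c • evalSeries T s' := by ext; simp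
        rw [this, map_smul, smul_mul_assoc, hT s'] }
  have hmul : ∀ T ∈ N, ∀ T' ∈ N, T * T' ∈ N := by
    intro T hT T' hT' s'
    have e : seriesLift σ ∘ₗ evalSeries T = LinearMap.mulLeft K T ∘ₗ σ := LinearMap.ext hT
    rw [evalSeries_mul, seriesLift_act, e, ← mul_seriesLift, hT' s', mul_assoc]
  have h1 : (1 : 𝔤.OpSeries) ∈ N := by
    intro s'
    have : evalSeries (1 : 𝔤.OpSeries) s' = Pi.single 0 s' := by
      ext m
      by_cases hm : m = 0
      · subst hm; simp
      · simp [hm, PowerSeries.coeff_one]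
    rw [this, seriesLift_single, one_mul]
  have hN : σ s ∈ N := by
    refine 𝔤.abelian.monomial_ext (f := N.mkQ ∘ₗ σ) (f' := 0) (fun n g s hs => ?_)
      |> fun h => (Submodule.Quotient.mk_eq_zero N).1 (LinearMap.congr_fun h s)
    refine (Submodule.Quotient.mk_eq_zero N).2
      (hσ.mem (fun _ _ => N) h1 (fun n g h x a hx ha => hmul _ ?_ _ ha) hs)
    exact fun s' => hσ.intertwines hφ hρ hρ.rel x s'
  exact hN s'

theorem IsSymmetrization.star_assoc (hσ : 𝔤.IsSymmetrization hε ρ σ)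
    (hφ : 𝔤.IsHomogeneousFamily φ) (hρ : 𝔤.IsSymRep hε φ ρ) (x y z : ℕ → 𝔤.Sym) :
    seriesMul (star σ) (seriesMul (star σ) x y) z
      = seriesMul (star σ) x (seriesMul (star σ) y z) := by
  have h1 : seriesLift σ ∘ₗ evalSeries (seriesLift σ x)
      = LinearMap.mulLeft K (seriesLift σ x) ∘ₗ σ := by
    refine LinearMap.ext fun s' => ?_
    have e : evalSeries (seriesLift σ x) s' = mapCoeffs (Op.eval s') (seriesLift σ x) := rfl
    have e2 : seriesLift σ ∘ₗ mapCoeffs (Op.eval s') ∘ₗ σ = LinearMap.mulRight K (σ s') ∘ₗ σ :=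
      LinearMap.ext fun s => hσ.mul_eq hφ hρ s s'
    rw [LinearMap.comp_apply, e, seriesLift_mapCoeffs, e2, ← seriesLift_mul]
    rfl
  rw [seriesMul_star, seriesMul_star, seriesMul_star, seriesMul_star, seriesLift_act, h1,
    ← mul_seriesLift, act_mul]

end Star

end ColorLieAlgebra

namespace ColorLieAlgebra

open Finset

variable {K G : Type*} [Field K] [AddCommGroup G] {ε : G → G → Kˣ} [DecidableEq G]
  {L : Type*} [AddCommGroup L] [Module K L]

/-! ### The Poincaré–Birkhoff–Witt theorem -/

section PBW

variable {𝔤 : ColorLieAlgebra ε L} {hε : IsAntisymmBicharacter ε}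
  {φ : ℕ → L →ₗ[K] L →ₗ[K] L} {ρ : L →ₗ[K] 𝔤.OpSeries}

/-- The constant term of a representation of a deformation is a representation of the
undeformed color Lie algebra. -/
theorem IsSymRep.const (hρ : 𝔤.IsSymRep hε φ ρ) :
    𝔤.IsSymRep hε (constSeries (φ 0)) (constLin K ∘ₗ coeffLin K 0 ∘ₗ ρ) := by
  have hc : ∀ m x s, PowerSeries.coeff m ((constLin K ∘ₗ coeffLin K 0 ∘ₗ ρ - 𝔤.mulOp) x) s
      = if m = 0 then PowerSeries.coeff 0 ((ρ - 𝔤.mulOp) x) s else 0 := by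
    intro m x s
    simp only [LinearMap.sub_apply, map_sub, Op.sub_apply, coeff_mulOp, LinearMap.comp_apply,
      constLin_apply, PowerSeries.coeff_C, coeffLin_apply]
    split_ifs <;> simp
  refine ⟨fun h y hy m n g s hs => ?_, fun g h x y hx hy => ?_, fun m s => ?_⟩
  · rw [hc]
    split_ifs
    · exact hρ.filtered h y hy 0 n g s hs
    · exact zero_mem _
  · ext1 m
    have h0 := congrArg (PowerSeries.coeff 0) (hρ.rel g h x y hx hy)
    rw [coeff_seriesLift_const (coeffLin K 0 ∘ₗ ρ)]
    rw [map_sub, coeff_smul', PowerSeries.coeff_mul, PowerSeries.coeff_mul, coeff_seriesLift] at h0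
    simp only [Nat.antidiagonal_zero, sum_singleton, coeffSeq_apply] at h0
    simp only [LinearMap.comp_apply, constLin_apply, coeffLin_apply, ← map_mul, map_sub,
      coeff_smul', PowerSeries.coeff_C, coeffSeq_apply, constSeries]
    by_cases hm : m = 0
    · subst hm; simpa using h0
    · simp [hm]
  · by_cases hm : m = 0
    · subst hm
      rw [← hρ.normalized 0 s]
      congr 2
      refine LinearMap.ext₂ fun x s => ?_
      exact (hc 0 x s).trans (if_pos rfl)
    · have : Op.toBilin (coeffLin K m ∘ₗ (constLin K ∘ₗ coeffLin K 0 ∘ₗ ρ - 𝔤.mulOp)) = 0 := by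
        refine LinearMap.ext₂ fun x s => ?_
        exact (hc m x s).trans (if_neg hm)
      rw [this, map_zero, LinearMap.zero_apply]

/-- The action of the enveloping algebra on the color symmetric algebra, given by the constant
term of a representation of a deformation. -/
noncomputable def IsSymRep.envelopingAction (hρ : 𝔤.IsSymRep hε φ ρ) (h0 : φ 0 = 𝔤.bracket) :
    𝔤.Enveloping →ₐ[K] Op K 𝔤.Sym :=
  𝔤.lift (coeffLin K 0 ∘ₗ ρ) fun g h a b ha hb => by
    have := congrArg (PowerSeries.coeff 0) (hρ.rel g h a b ha hb)
    rw [map_sub, coeff_smul', PowerSeries.coeff_mul, PowerSeries.coeff_mul, coeff_seriesLift,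
      Nat.antidiagonal_zero, sum_singleton, sum_singleton, sum_singleton, sub_eq_iff_eq_add',
      coeffSeq_apply, h0] at this
    exact this

theorem IsSymRep.envelopingAction_ι (hρ : 𝔤.IsSymRep hε φ ρ) (h0 : φ 0 = 𝔤.bracket) (x : L) :
    hρ.envelopingAction h0 (𝔤.ι x) = PowerSeries.coeff 0 (ρ x) :=
  lift_ι _ _ _ x

/-- The inverse of symmetrization: the action on the element `1`. -/
noncomputable def IsSymRep.symbol (hρ : 𝔤.IsSymRep hε φ ρ) (h0 : φ 0 = 𝔤.bracket) :
    𝔤.Enveloping →ₗ[K] 𝔤.Sym :=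
  Op.eval 1 ∘ₗ (hρ.envelopingAction h0).toLinearMap

theorem IsSymRep.symbol_ι (hρ : 𝔤.IsSymRep hε φ ρ) (h0 : φ 0 = 𝔤.bracket) (x : L) :
    hρ.symbol h0 (𝔤.ι x) = 𝔤.ιS x := by
  have := congrFun (hρ.evalSeries_one x) 0
  rw [evalSeries_apply, Pi.single_eq_same] at this
  rw [← this, ← hρ.envelopingAction_ι h0]
  rfl

theorem IsSymRep.symbol_mem (hρ : 𝔤.IsSymRep hε φ ρ) (h0 : φ 0 = 𝔤.bracket) {g : G}
    {u : 𝔤.Enveloping} (hu : u ∈ 𝔤.envelopingGrade g) :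
    hρ.symbol h0 u ∈ 𝔤.abelian.envelopingGrade g := by
  refine 𝔤.envelopingGrade_induction (fun n s hs => ?_) hu
  clear hu
  induction hs with
  | one =>
    have : hρ.symbol h0 1 = 1 := by simp [symbol]
    rw [this]
    exact IsMonomial.one.mem
  | @mul n g h x s hx hs ih =>
    have : hρ.symbol h0 (𝔤.ι x * s) = PowerSeries.coeff 0 (ρ x) (hρ.symbol h0 s) := by
      simp [symbol, hρ.envelopingAction_ι]
    rw [this, add_comm]
    exact opFilt_envelopingGrade (hρ.mem_opFilt hx) 0 ih

variable [CharZero K] {τ : 𝔤.Sym →ₗ[K] 𝔤.Enveloping}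

theorem IsSymmetrization.mem_envelopingGrade (hτ : 𝔤.IsSymmetrization hε 𝔤.ι τ) {g : G}
    {s : 𝔤.Sym} (hs : s ∈ 𝔤.abelian.envelopingGrade g) : τ s ∈ 𝔤.envelopingGrade g :=
  𝔤.abelian.envelopingGrade_induction (fun _ _ hs => hτ.mem (fun _ => 𝔤.envelopingGrade)
    SetLike.GradedOne.one_mem
    (fun _ _ _ _ _ hx ha => SetLike.mul_mem_graded (𝔤.ι_mem hx) ha) hs) hs

/-- Symmetrization is a map of `U(𝔤)`-modules. -/
theorem IsSymmetrization.envelopingAction (hτ : 𝔤.IsSymmetrization hε 𝔤.ι τ)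
    (hφ : 𝔤.IsHomogeneousFamily φ) (hρ : 𝔤.IsSymRep hε φ ρ) (h0 : φ 0 = 𝔤.bracket)
    (u : 𝔤.Enveloping) (s : 𝔤.Sym) : τ (hρ.envelopingAction h0 u s) = u * τ s := by
  have hτ' : 𝔤.IsSymmetrization hε (constLin K ∘ₗ 𝔤.ι) (constLin K ∘ₗ τ) :=
    hτ.map _ (map_one (PowerSeries.C (R := 𝔤.Enveloping))) fun x a =>
      map_mul (PowerSeries.C (R := 𝔤.Enveloping)) _ _
  have hφ' : 𝔤.IsHomogeneousFamily (constSeries (φ 0)) := by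
    intro n g h a b ha hb
    by_cases hn : n = 0
    · subst hn; simpa [constSeries] using hφ 0 g h a b ha hb
    · simp [constSeries, hn]
  have hx : ∀ x s, τ (PowerSeries.coeff 0 (ρ x) s) = 𝔤.ι x * τ s := by
    intro x s
    have := hτ'.intertwines hφ' hρ.const (fun g h x y hx hy => by
      ext1 m
      rw [coeff_seriesLift_const, map_sub, coeff_smul']
      simp only [LinearMap.comp_apply, constLin_apply, ← map_mul, PowerSeries.coeff_C,
        coeffSeq_apply, constSeries]
      by_cases hm : m = 0
      · subst hm; simp [h0, 𝔤.ι_mul_ι hx hy]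
      · simp [hm]) x s
    have := congrArg (PowerSeries.coeff 0) this
    rw [coeff_seriesLift_const] at this
    simpa using this
  refine 𝔤.mem_of_left_stable (LinearMap.eqLocus
    (τ ∘ₗ Op.eval s ∘ₗ (hρ.envelopingAction h0).toLinearMap) (LinearMap.mulRight K (τ s)))
    (by simp) (fun g x _ u hu => ?_) u
  simp only [LinearMap.mem_eqLocus, LinearMap.comp_apply, AlgHom.toLinearMap_apply,
    Op.eval_apply, LinearMap.mulRight_apply] at hu ⊢
  rw [map_mul, Op.mul_apply, hρ.envelopingAction_ι h0, hx, hu, mul_assoc]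

theorem IsSymmetrization.apply_symbol (hτ : 𝔤.IsSymmetrization hε 𝔤.ι τ)
    (hφ : 𝔤.IsHomogeneousFamily φ) (hρ : 𝔤.IsSymRep hε φ ρ) (h0 : φ 0 = 𝔤.bracket)
    (u : 𝔤.Enveloping) : τ (hρ.symbol h0 u) = u := by
  have := hτ.envelopingAction hφ hρ h0 u 1
  rwa [hτ.one, mul_one] at this

theorem IsSymmetrization.envelopingAction_apply (hτ : 𝔤.IsSymmetrization hε 𝔤.ι τ)
    (hρ : 𝔤.IsSymRep hε φ ρ) (h0 : φ 0 = 𝔤.bracket) {σ : 𝔤.Sym →ₗ[K] 𝔤.OpSeries}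
    (hσ : 𝔤.IsSymmetrization hε ρ σ) (s : 𝔤.Sym) :
    hρ.envelopingAction h0 (τ s) = PowerSeries.coeff 0 (σ s) := by
  have h1 := hτ.map (j' := coeffLin K 0 ∘ₗ ρ) (hρ.envelopingAction h0).toLinearMap
    (map_one (hρ.envelopingAction h0)) (fun x a => by
      rw [AlgHom.toLinearMap_apply, map_mul, hρ.envelopingAction_ι]; rfl)
  have h2 := hσ.map (j' := coeffLin K 0 ∘ₗ ρ) (coeffLin K 0) (by simp) (fun x a => by
      simp [PowerSeries.coeff_mul])
  exact LinearMap.congr_fun (h1.unique h2) s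

theorem IsSymmetrization.symbol_apply (hτ : 𝔤.IsSymmetrization hε 𝔤.ι τ)
    (hρ : 𝔤.IsSymRep hε φ ρ) (h0 : φ 0 = 𝔤.bracket) (s : 𝔤.Sym) : hρ.symbol h0 (τ s) = s := by
  obtain ⟨σ, hσ⟩ := exists_isSymmetrization 𝔤 hε ρ
  have := congrFun (hσ.evalSeries_one hρ s) 0
  rw [evalSeries_apply, Pi.single_eq_same, ← hτ.envelopingAction_apply hρ h0 hσ] at this
  exact this

/-- Every graded deformation of `𝔤` is the commutator of a graded deformation of `U(𝔤)`. -/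
theorem exists_assocDeformation (hε : IsAntisymmBicharacter ε) (hφ : 𝔤.IsGradedDeformation φ) :
    ∃ π, IsGradedAssocDeformation 𝔤.envelopingGrade π ∧
      ∀ m g h a b, a ∈ 𝔤.grade g → b ∈ 𝔤.grade h →
        π m (𝔤.ι a) (𝔤.ι b) - (ε g h : K) • π m (𝔤.ι b) (𝔤.ι a) = 𝔤.ι (φ m a b) := by
  obtain ⟨ρ, hρ⟩ := exists_isSymRep hε hφ
  obtain ⟨σ, hσ⟩ := exists_isSymmetrization 𝔤 hε ρ
  obtain ⟨τ, hτ⟩ := exists_isSymmetrization 𝔤 hε 𝔤.ι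
  have h0 := hφ.zero
  let θ := hρ.symbol h0
  have hθτ : ∀ s, θ (τ s) = s := hτ.symbol_apply hρ h0
  have hτθ : ∀ u, τ (θ u) = u := hτ.apply_symbol hφ.isHomogeneousFamily hρ h0
  let π : ℕ → 𝔤.Enveloping →ₗ[K] 𝔤.Enveloping →ₗ[K] 𝔤.Enveloping := fun m =>
    ((star σ m).compl₁₂ θ θ).compr₂ τ
  have hπ : ∀ m u v, π m u v = τ (star σ m (θ u) (θ v)) := fun m u v => rfl
  have hmul : ∀ x y : ℕ → 𝔤.Enveloping, seriesMul π x y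
      = fun n => τ (seriesMul (star σ) (fun i => θ (x i)) (fun i => θ (y i)) n) := by
    intro x y
    ext n
    simp only [seriesMul, hπ, map_sum]
  refine ⟨π, ⟨?_, ?_, ?_⟩, ?_⟩
  · refine LinearMap.ext₂ fun u v => ?_
    rw [hπ, star_apply, ← hτ.envelopingAction_apply hρ h0 hσ, hτθ,
      hτ.envelopingAction hφ.isHomogeneousFamily hρ h0, hτθ, LinearMap.mul_apply']
  · intro m g h u v hu hv
    rw [hπ]
    refine hτ.mem_envelopingGrade ?_
    have hu' : θ u ∈ 𝔤.abelian.envelopingGrade g := hρ.symbol_mem h0 hu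
    have hv' : θ v ∈ 𝔤.abelian.envelopingGrade h := hρ.symbol_mem h0 hv
    refine 𝔤.abelian.envelopingGrade_induction (f := (star σ m).flip (θ v)) (fun n s hs => ?_) hu'
    rw [LinearMap.flip_apply, star_apply, add_comm g h]
    exact opFilt_envelopingGrade (hσ.mem_opFilt hρ hs) m hv'
  · intro x y z
    rw [hmul, hmul, hmul, hmul]
    simp only [hθτ]
    rw [hσ.star_assoc hφ.isHomogeneousFamily hρ]
  · intro m g h a b ha hb
    rw [hπ, hπ, ← map_smul, ← map_sub]
    change τ (star σ m (hρ.symbol h0 (𝔤.ι a)) (hρ.symbol h0 (𝔤.ι b))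
      - (ε g h : K) • star σ m (hρ.symbol h0 (𝔤.ι b)) (hρ.symbol h0 (𝔤.ι a))) = _
    rw [hρ.symbol_ι, hρ.symbol_ι, hσ.star_commutator hρ m ha hb, hτ.apply_ι]

end PBW

end ColorLieAlgebra

namespace ColorLieAlgebra

variable {K G : Type*} [Field K] [AddCommGroup G] {ε : G → G → Kˣ} [DecidableEq G]
  {L : Type*} [AddCommGroup L] [Module K L] {M : Type*} [AddCommGroup M] [Module K M]

/-! ### The adjoint action and the equivariant projection -/

/-- An equivariant projection `P : U(𝔤) → 𝔤` that preserves degrees. -/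
structure IsEquivariantProjection (𝔤 : ColorLieAlgebra ε L) (P : 𝔤.Enveloping →ₗ[K] L) :
    Prop where
  apply_ι : ∀ x, P (𝔤.ι x) = x
  mem : ∀ g, ∀ u ∈ 𝔤.envelopingGrade g, P u ∈ 𝔤.grade g
  commutator : ∀ g h a u, a ∈ 𝔤.grade g → u ∈ 𝔤.envelopingGrade h →
    P (𝔤.ι a * u - (ε g h : K) • (u * 𝔤.ι a)) = 𝔤.bracket a (P u)

section Adjoint

variable (𝔤 : ColorLieAlgebra ε L) (hε : IsAntisymmBicharacter ε)

/-- The extension of `[a, ·]` to an `ε`-derivation of the color symmetric algebra. -/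
noncomputable def symAd (a : L) : 𝔤.Sym →ₗ[K] 𝔤.Sym :=
  𝔤.contract hε (LinearMap.mul K 𝔤.Sym ∘ₗ 𝔤.ιS ∘ₗ 𝔤.bracket a)

theorem symAd_one (a : L) : 𝔤.symAd hε a 1 = 0 := 𝔤.contract_one hε _

theorem symAd_ι_mul {g h : G} {a y : L} (ha : a ∈ 𝔤.grade g) (hy : y ∈ 𝔤.grade h) (s : 𝔤.Sym) :
    𝔤.symAd hε a (𝔤.ιS y * s)
      = 𝔤.ιS (𝔤.bracket a y) * s + (ε g h : K) • (𝔤.ιS y * 𝔤.symAd hε a s) := by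
  let B : L →ₗ[K] 𝔤.Sym →ₗ[K] 𝔤.Sym := LinearMap.mul K 𝔤.Sym ∘ₗ 𝔤.ιS ∘ₗ 𝔤.bracket a
  have hB : ∀ z s, B z s = 𝔤.ιS (𝔤.bracket a z) * s := fun _ _ => rfl
  have e : 𝔤.shift h y B = (ε g h : K) • B.compr₂ (LinearMap.mulLeft K (𝔤.ιS y)) := by
    refine internal_ext (M := 𝔤.Sym →ₗ[K] 𝔤.Sym) 𝔤.isInternal fun k z hz =>
      LinearMap.ext fun s => ?_
    have hb := 𝔤.isColorLieBracket.mem g k a z ha hz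
    rw [𝔤.shift_apply _ _ _ hz]
    simp only [hB, LinearMap.smul_apply, LinearMap.compr₂_apply, LinearMap.mulLeft_apply]
    rw [𝔤.ιS_comm_mul hb hy, smul_smul, hε.left, mul_left_comm, hε.mul_swap, mul_one]
  change 𝔤.contract hε B _ = _
  rw [𝔤.contract_ι_mul hε _ hy, e, map_smul, LinearMap.smul_apply, contract_compr₂]
  rfl

theorem symAd_mem_lengthPart (a : L) {n : ℕ} {g h : G} {s : 𝔤.Sym} (ha : a ∈ 𝔤.grade g)
    (hs : 𝔤.abelian.IsMonomial n h s) : 𝔤.symAd hε a s ∈ 𝔤.lengthPart n := by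
  cases n with
  | zero => cases hs; rw [symAd_one]; exact zero_mem _
  | succ n =>
    refine 𝔤.contract_mem hε _ _ (fun k l z s' hz hs' _ => ?_) hs
    exact mem_lengthPart
      (IsMonomial.mul (𝔤 := 𝔤.abelian) (𝔤.isColorLieBracket.mem g k a z ha hz) hs')

/-- The bilinear map `(z, s) ↦ E([a, z], s) + ε(g, |z|) E(z, [a, s])`, where `g` is the degree
of `a`. -/
noncomputable def adDual (g : G) (a : L) (E : L →ₗ[K] 𝔤.Sym →ₗ[K] M) : L →ₗ[K] 𝔤.Sym →ₗ[K] M :=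
  E ∘ₗ 𝔤.bracket a + (E ∘ₗ 𝔤.scale fun h => (ε g h : K)).compl₂ (𝔤.symAd hε a)

theorem adDual_apply {g h : G} (a : L) {z : L} (E : L →ₗ[K] 𝔤.Sym →ₗ[K] M) (hz : z ∈ 𝔤.grade h)
    (s : 𝔤.Sym) : 𝔤.adDual hε g a E z s
      = E (𝔤.bracket a z) s + (ε g h : K) • E z (𝔤.symAd hε a s) := by
  simp [adDual, 𝔤.scale_apply _ hz]

/-- `contract` is equivariant for the adjoint action. -/
theorem contract_symAd {g : G} {a : L} (ha : a ∈ 𝔤.grade g) (E : L →ₗ[K] 𝔤.Sym →ₗ[K] M)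
    (s : 𝔤.Sym) : 𝔤.contract hε E (𝔤.symAd hε a s) = 𝔤.contract hε (𝔤.adDual hε g a E) s := by
  have : 𝔤.contract hε E ∘ₗ 𝔤.symAd hε a = 𝔤.contract hε (𝔤.adDual hε g a E) := by
    refine 𝔤.abelian.monomial_ext fun n h s hs => ?_
    rw [LinearMap.comp_apply]
    induction hs generalizing E with
    | one => rw [symAd_one, map_zero, contract_one]
    | @mul n k h y s hy hs ih =>
      have e : 𝔤.shift k y (𝔤.adDual hε g a E) = 𝔤.shift (g + k) (𝔤.bracket a y) E
          + (ε g k : K) • 𝔤.adDual hε g a (𝔤.shift k y E) := by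
        refine internal_ext 𝔤.isInternal fun l z hz => LinearMap.ext fun s => ?_
        have hb := 𝔤.isColorLieBracket.mem g l a z ha hz
        rw [𝔤.shift_apply _ _ _ hz, 𝔤.adDual_apply hε _ _ hz, symAd_ι_mul 𝔤 hε ha hy,
          LinearMap.add_apply, LinearMap.add_apply, 𝔤.shift_apply _ _ _ hz, LinearMap.smul_apply,
          LinearMap.smul_apply, 𝔤.adDual_apply hε _ _ hz, 𝔤.shift_apply _ _ _ hb,
          𝔤.shift_apply _ _ _ hz, hε.left, hε.right]
        simp only [map_add, map_smul, smul_add, smul_smul]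
        rw [← mul_assoc (ε g k : K), hε.mul_swap, one_mul]
        module
      rw [symAd_ι_mul 𝔤 hε ha hy, map_add, map_smul, 𝔤.contract_ι_mul hε E hy,
        𝔤.contract_ι_mul hε E (𝔤.isColorLieBracket.mem g k a y ha hy), ih,
        𝔤.contract_ι_mul hε _ hy, e, 𝔤.adDual_apply hε _ _ hy, map_add, map_smul,
        LinearMap.add_apply, LinearMap.smul_apply]
      module
  exact LinearMap.congr_fun this s

variable {𝔤 hε} [CharZero K] {τ : 𝔤.Sym →ₗ[K] 𝔤.Enveloping}

/-- Symmetrization intertwines the adjoint actions. -/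
theorem IsSymmetrization.apply_symAd (hτ : 𝔤.IsSymmetrization hε 𝔤.ι τ) {g h : G} {a : L}
    {s : 𝔤.Sym} (ha : a ∈ 𝔤.grade g) (hs : s ∈ 𝔤.abelian.envelopingGrade h) :
    τ (𝔤.symAd hε a s) = 𝔤.ι a * τ s - (ε g h : K) • (τ s * 𝔤.ι a) := by
  have hlen : ∀ n, ∀ s ∈ 𝔤.lengthPart n,
      (n : K) • τ s = 𝔤.contract hε ((LinearMap.mul K 𝔤.Enveloping).compl₁₂ 𝔤.ι τ) s := by
    intro n s hs
    have : 𝔤.lengthPart n ≤ LinearMap.eqLocus ((n : K) • τ)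
        (𝔤.contract hε ((LinearMap.mul K 𝔤.Enveloping).compl₁₂ 𝔤.ι τ)) := by
      rw [lengthPart, Submodule.span_le]
      rintro s ⟨k, hs⟩
      exact hτ.smul_apply n k s hs
    exact this hs
  have key : ∀ n h s, 𝔤.abelian.IsMonomial n h s →
      τ (𝔤.symAd hε a s) = 𝔤.ι a * τ s - (ε g h : K) • (τ s * 𝔤.ι a) := by
    intro n
    induction n with
    | zero => intro h s hs; cases hs; simp [symAd_one, hτ.one, hε.zero_right]
    | succ n ih =>
      intro h s hs
      refine smul_right_injective _ (Nat.cast_ne_zero (R := K).2 n.succ_ne_zero) ?_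
      change ((n + 1 : ℕ) : K) • _ = ((n + 1 : ℕ) : K) • _
      let f : 𝔤.Enveloping →ₗ[K] 𝔤.Enveloping :=
        LinearMap.mulLeft K (𝔤.ι a) - (ε g h : K) • LinearMap.mulRight K (𝔤.ι a)
      have hf : ∀ u, f u = 𝔤.ι a * u - (ε g h : K) • (u * 𝔤.ι a) := fun u => rfl
      rw [hlen _ _ (𝔤.symAd_mem_lengthPart hε a ha hs), contract_symAd 𝔤 hε ha, ← hf,
        ← map_smul, hτ.smul_apply _ h s hs, ← contract_compr₂]
      refine 𝔤.contract_congr hε (fun k l z s' hz hs' e => ?_) hs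
      rw [𝔤.adDual_apply hε _ _ hz, LinearMap.compr₂_apply, hf]
      simp only [LinearMap.compl₁₂_apply, LinearMap.mul_apply']
      rw [ih l s' hs', ← e, hε.right, ← mul_assoc (𝔤.ι a), 𝔤.ι_mul_ι ha hz]
      simp only [add_mul, mul_sub, smul_mul_assoc, mul_smul_comm, mul_assoc]
      module
  have := 𝔤.abelian.envelopingGrade_induction (N := ⊥)
    (f := τ ∘ₗ 𝔤.symAd hε a
      - (LinearMap.mulLeft K (𝔤.ι a) - (ε g h : K) • LinearMap.mulRight K (𝔤.ι a)) ∘ₗ τ)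
    (fun n s hs => by
      rw [Submodule.mem_bot, LinearMap.sub_apply, sub_eq_zero]
      exact key n h s hs) hs
  rw [Submodule.mem_bot, LinearMap.sub_apply, sub_eq_zero] at this
  exact this

variable {φ : ℕ → L →ₗ[K] L →ₗ[K] L}

/-- The enveloping algebra retracts onto `𝔤`, equivariantly for the adjoint action. -/
theorem exists_equivariant_projection (hε : IsAntisymmBicharacter ε)
    (hφ : 𝔤.IsGradedDeformation φ) : ∃ P, 𝔤.IsEquivariantProjection P := by
  obtain ⟨ρ, hρ⟩ := exists_isSymRep hε hφ
  obtain ⟨τ, hτ⟩ := exists_isSymmetrization 𝔤 hε 𝔤.ι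
  have h0 := hφ.zero
  -- the projection to the linear part of the color symmetric algebra
  let E : L →ₗ[K] 𝔤.Sym →ₗ[K] L :=
    (LinearMap.lsmul K L).flip.compl₂ 𝔤.counit.toLinearMap
  have hE : ∀ z s, E z s = 𝔤.counit s • z := fun _ _ => rfl
  have hp : ∀ a g s, a ∈ 𝔤.grade g →
      𝔤.contract hε E (𝔤.symAd hε a s) = 𝔤.bracket a (𝔤.contract hε E s) := by
    intro a g s ha
    have hc : ∀ s, 𝔤.counit (𝔤.symAd hε a s) = 0 := by
      intro s
      have : 𝔤.counit.toLinearMap ∘ₗ 𝔤.symAd hε a = 0 := by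
        refine 𝔤.abelian.monomial_ext fun n h s hs => ?_
        have := 𝔤.symAd_mem_lengthPart hε a ha hs
        cases n with
        | zero => cases hs; simp [symAd_one]
        | succ n =>
          have hle : 𝔤.lengthPart (n + 1) ≤ LinearMap.ker 𝔤.counit.toLinearMap := by
            rw [lengthPart, Submodule.span_le]
            rintro s ⟨k, hs⟩
            exact counit_of_isMonomial hs
          exact hle this
      exact LinearMap.congr_fun this s
    rw [contract_symAd 𝔤 hε ha, ← contract_compr₂]
    congr 2
    refine internal_ext 𝔤.isInternal fun k z hz => LinearMap.ext fun s => ?_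
    rw [𝔤.adDual_apply hε _ _ hz, LinearMap.compr₂_apply, hE, hE, hE, hc, zero_smul, smul_zero,
      add_zero, map_smul]
  refine ⟨𝔤.contract hε E ∘ₗ hρ.symbol h0, fun x => ?_, fun g u hu => ?_, fun g h a u ha hu => ?_⟩
  · rw [LinearMap.comp_apply, hρ.symbol_ι, contract_ι, hE, map_one, one_smul]
  · refine 𝔤.abelian.envelopingGrade_induction (f := 𝔤.contract hε E) (fun n s hs => ?_)
      (hρ.symbol_mem h0 hu)
    cases n with
    | zero => cases hs; rw [contract_one]; exact zero_mem _
    | succ n =>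
      refine 𝔤.contract_mem hε _ _ (fun k l z s' hz hs' e => ?_) hs
      rw [hE]
      cases n with
      | zero => cases hs'; rw [← e, add_zero]; exact Submodule.smul_mem _ _ hz
      | succ n => rw [counit_of_isMonomial hs', zero_smul]; exact zero_mem _
  · have h1 := hτ.apply_symAd ha (hρ.symbol_mem h0 hu)
    rw [hτ.apply_symbol hφ.isHomogeneousFamily hρ h0] at h1
    rw [← h1, LinearMap.comp_apply, hτ.symbol_apply hρ h0, hp a g _ ha, LinearMap.comp_apply]

end Adjoint

end ColorLieAlgebra

/-! ### Exponentials of derivations -/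

section Exp

open Finset

variable {K A : Type*} [Field K] [Ring A] [Algebra K A]

/-- The coefficients of a power series, as a `K`-linear map. -/
noncomputable abbrev coeffs (K : Type*) {A : Type*} [Field K] [Ring A] [Algebra K A] :
    PowerSeries A →ₗ[K] (ℕ → A) :=
  mapCoeffs LinearMap.id

/-- The `K[[t]]`-linear extension of `E : A → A[[t]]` to `A[[t]]`. -/
noncomputable def seriesExtend (E : A →ₗ[K] PowerSeries A) : PowerSeries A →ₗ[K] PowerSeries A :=
  seriesLift E ∘ₗ coeffs K

theorem coeff_seriesExtend (E : A →ₗ[K] PowerSeries A) (a : PowerSeries A) (n : ℕ) :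
    PowerSeries.coeff n (seriesExtend E a)
      = ∑ p ∈ antidiagonal n, PowerSeries.coeff p.2 (E (PowerSeries.coeff p.1 a)) := by
  rw [seriesExtend, LinearMap.comp_apply, coeff_seriesLift]
  rfl

theorem seriesExtend_C (E : A →ₗ[K] PowerSeries A) (u : A) :
    seriesExtend E (PowerSeries.C u) = E u := by
  have : coeffs K (PowerSeries.C u) = (Pi.single 0 u : ℕ → A) := by
    ext n
    by_cases hn : n = 0
    · subst hn; simp
    · simp [PowerSeries.coeff_C, hn]
  rw [seriesExtend, LinearMap.comp_apply, this, seriesLift_single]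

theorem seriesExtend_seriesLift {V : Type*} [AddCommGroup V] [Module K V]
    (E : A →ₗ[K] PowerSeries A) (f : V →ₗ[K] PowerSeries A) (x : ℕ → V) :
    seriesExtend E (seriesLift f x) = seriesLift (seriesExtend E ∘ₗ f) x :=
  seriesLift_mapCoeffs E LinearMap.id f x

theorem seriesLift_constLin (a : PowerSeries A) :
    seriesLift (constLin K) (coeffs K a) = a := by
  ext n
  have := coeff_seriesLift_const (K := K) (LinearMap.id : A →ₗ[K] A) (coeffs K a) n
  rw [LinearMap.comp_id] at this
  rw [this]
  rfl

theorem seriesExtend_mul {E : A →ₗ[K] PowerSeries A} (hE : ∀ u v, E (u * v) = E u * E v)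
    (a b : PowerSeries A) : seriesExtend E (a * b) = seriesExtend E a * seriesExtend E b := by
  have h1 : ∀ u, seriesExtend E (PowerSeries.C u * b) = E u * seriesExtend E b := by
    intro u
    conv_lhs => rw [← seriesLift_constLin (K := K) b]
    rw [mul_seriesLift, seriesExtend_seriesLift]
    conv_rhs => rw [seriesExtend, LinearMap.comp_apply, mul_seriesLift]
    congr 2
    ext1 v
    change seriesExtend E (PowerSeries.C u * PowerSeries.C v) = E u * E v
    rw [← map_mul, seriesExtend_C, hE]
  conv_lhs => rw [← seriesLift_constLin (K := K) a]
  rw [seriesLift_mul, seriesExtend_seriesLift]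
  conv_rhs => rw [seriesExtend, LinearMap.comp_apply, seriesLift_mul]
  congr 2
  ext1 u
  exact h1 u

/-- The divided powers `Dᵏ / k!` of an operator. -/
noncomputable def dividedPower (D : A →ₗ[K] A) : ℕ → A →ₗ[K] A
  | 0 => LinearMap.id
  | k + 1 => ((k + 1 : ℕ) : K)⁻¹ • (D ∘ₗ dividedPower D k)

theorem dividedPower_mem {D : A →ₗ[K] A} {N : Submodule K A} (hN : ∀ u ∈ N, D u ∈ N) (k : ℕ)
    {u : A} (hu : u ∈ N) : dividedPower D k u ∈ N := by
  induction k with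
  | zero => exact hu
  | succ k ih => exact N.smul_mem _ (hN _ ih)

/-- The exponential `exp(tʳ D)`, as a map `A → A[[t]]`. -/
noncomputable def expSeries (D : A →ₗ[K] A) (r : ℕ) : A →ₗ[K] PowerSeries A where
  toFun u := PowerSeries.mk fun n => if r ∣ n then dividedPower D (n / r) u else 0
  map_add' u v := by
    ext n
    simp only [PowerSeries.coeff_mk, map_add]
    split_ifs <;> simp
  map_smul' c u := by
    ext n
    simp only [PowerSeries.coeff_mk, map_smul, coeff_smul', RingHom.id_apply]
    split_ifs <;> simp

theorem coeff_expSeries (D : A →ₗ[K] A) (r n : ℕ) (u : A) :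
    PowerSeries.coeff n (expSeries D r u) = if r ∣ n then dividedPower D (n / r) u else 0 := by
  simp [expSeries]

theorem coeff_zero_expSeries (D : A →ₗ[K] A) (r : ℕ) (u : A) :
    PowerSeries.coeff 0 (expSeries D r u) = u := by
  simp [coeff_expSeries, dividedPower]

theorem coeff_expSeries_of_lt (D : A →ₗ[K] A) {r n : ℕ} (h0 : 0 < n) (h : n < r) (u : A) :
    PowerSeries.coeff n (expSeries D r u) = 0 := by
  rw [coeff_expSeries, if_neg (Nat.not_dvd_of_pos_of_lt h0 h)]

theorem coeff_self_expSeries (D : A →ₗ[K] A) {r : ℕ} (hr : 0 < r) (u : A) :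
    PowerSeries.coeff r (expSeries D r u) = D u := by
  simp [coeff_expSeries, Nat.div_self hr, dividedPower]

theorem coeff_expSeries_mem {D : A →ₗ[K] A} {N : Submodule K A} (hN : ∀ u ∈ N, D u ∈ N) (r n : ℕ)
    {u : A} (hu : u ∈ N) : PowerSeries.coeff n (expSeries D r u) ∈ N := by
  rw [coeff_expSeries]
  split_ifs
  · exact dividedPower_mem hN _ hu
  · exact zero_mem _

variable [CharZero K]

theorem smul_dividedPower_succ (D : A →ₗ[K] A) (k : ℕ) (u : A) :
    ((k + 1 : ℕ) : K) • dividedPower D (k + 1) u = D (dividedPower D k u) := by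
  rw [dividedPower, LinearMap.smul_apply, smul_smul,
    mul_inv_cancel₀ (Nat.cast_ne_zero.2 k.succ_ne_zero), one_smul, LinearMap.comp_apply]

theorem dividedPower_mul {D : A →ₗ[K] A} (hD : ∀ u v, D (u * v) = D u * v + u * D v) (k : ℕ)
    (u v : A) : dividedPower D k (u * v)
      = ∑ p ∈ antidiagonal k, dividedPower D p.1 u * dividedPower D p.2 v := by
  induction k with
  | zero => simp [dividedPower]
  | succ k ih =>
    have hne : ((k + 1 : ℕ) : K) ≠ 0 := Nat.cast_ne_zero.2 k.succ_ne_zero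
    refine smul_right_injective _ hne ?_
    change ((k + 1 : ℕ) : K) • _ = ((k + 1 : ℕ) : K) • _
    have e1 : ∑ p ∈ antidiagonal k, D (dividedPower D p.1 u) * dividedPower D p.2 v
        = ∑ p ∈ antidiagonal (k + 1),
          (p.1 : K) • (dividedPower D p.1 u * dividedPower D p.2 v) := by
      rw [Nat.sum_antidiagonal_succ]
      simp only [Nat.cast_zero, zero_smul, zero_add]
      exact sum_congr rfl fun p _ => by rw [← smul_dividedPower_succ, smul_mul_assoc]
    have e2 : ∑ p ∈ antidiagonal k, dividedPower D p.1 u * D (dividedPower D p.2 v)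
        = ∑ p ∈ antidiagonal (k + 1),
          (p.2 : K) • (dividedPower D p.1 u * dividedPower D p.2 v) := by
      rw [Nat.sum_antidiagonal_succ']
      simp only [Nat.cast_zero, zero_smul, zero_add]
      exact sum_congr rfl fun p _ => by rw [← smul_dividedPower_succ, mul_smul_comm]
    rw [smul_dividedPower_succ, ih, map_sum, smul_sum]
    simp only [hD, sum_add_distrib]
    rw [e1, e2, ← sum_add_distrib]
    refine sum_congr rfl fun p hp => ?_
    rw [← add_smul, ← Nat.cast_add, HasAntidiagonal.mem_antidiagonal.1 hp]

theorem expSeries_mul {D : A →ₗ[K] A} (hD : ∀ u v, D (u * v) = D u * v + u * D v) {r : ℕ}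
    (hr : 0 < r) (u v : A) : expSeries D r (u * v) = expSeries D r u * expSeries D r v := by
  ext n
  rw [coeff_expSeries, PowerSeries.coeff_mul]
  simp only [coeff_expSeries]
  split_ifs with hn
  · obtain ⟨m, rfl⟩ := hn
    rw [sum_antidiagonal_mul_left hr, Nat.mul_div_cancel_left _ hr, dividedPower_mul hD]
    · simp [Nat.mul_div_cancel_left _ hr]
    · intro p _ h
      rw [if_neg h, zero_mul]
  · symm
    refine sum_eq_zero fun p hp => ?_
    rw [HasAntidiagonal.mem_antidiagonal] at hp
    by_cases h1 : r ∣ p.1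
    · rw [if_neg (fun h2 => hn (hp ▸ dvd_add h1 h2)), mul_zero]
    · rw [if_neg h1, zero_mul]

end Exp

namespace ColorLieAlgebra

variable {K G : Type*} [Field K] [AddCommGroup G] {ε : G → G → Kˣ} [DecidableEq G]
  {L : Type*} [AddCommGroup L] [Module K L] {𝔤 : ColorLieAlgebra ε L}

/-! ### Extension of derivations to the enveloping algebra -/

/-- A linear map `Q : 𝔤 → U(𝔤)` that is a derivation for the commutators extends to a derivation
of `U(𝔤)`: the map `a ↦ a + Q(a) δ` to the dual numbers over `U(𝔤)` satisfies the commutator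
relations. -/
theorem exists_derivation (Q : L →ₗ[K] 𝔤.Enveloping)
    (hQ : ∀ g h a b, a ∈ 𝔤.grade g → b ∈ 𝔤.grade h → Q (𝔤.bracket a b)
      = (𝔤.ι a * Q b - (ε g h : K) • (Q b * 𝔤.ι a)) + (Q a * 𝔤.ι b - (ε g h : K) • (𝔤.ι b * Q a))) :
    ∃ D : 𝔤.Enveloping →ₗ[K] 𝔤.Enveloping, (∀ x, D (𝔤.ι x) = Q x) ∧
      ∀ u v, D (u * v) = D u * v + u * D v := by
  let j : L →ₗ[K] DualNumber 𝔤.Enveloping :=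
    { toFun := fun x => TrivSqZeroExt.inl (𝔤.ι x) + TrivSqZeroExt.inr (Q x)
      map_add' := fun x y => by ext <;> simp
      map_smul' := fun c x => by ext <;> simp }
  have j1 : ∀ x, (j x).fst = 𝔤.ι x := fun x => by simp [j]
  have j2 : ∀ x, (j x).snd = Q x := fun x => by simp [j]
  let ψ : 𝔤.Enveloping →ₐ[K] DualNumber 𝔤.Enveloping := 𝔤.lift j fun g h a b ha hb => by
    ext
    · simp [j1, 𝔤.ι_mul_ι ha hb]
    · simp only [TrivSqZeroExt.snd_mul, TrivSqZeroExt.snd_add, TrivSqZeroExt.snd_smul, j1, j2,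
        hQ g h a b ha hb, smul_eq_mul, MulOpposite.smul_eq_mul_unop, MulOpposite.unop_op, smul_add]
      abel
  have hψ : ∀ x, ψ (𝔤.ι x) = j x := 𝔤.lift_ι j _
  have h1 : ∀ u, (ψ u).fst = u := by
    refine 𝔤.mem_of_left_stable (LinearMap.eqLocus
      ((TrivSqZeroExt.fstHom K 𝔤.Enveloping 𝔤.Enveloping).toLinearMap ∘ₗ ψ.toLinearMap)
      LinearMap.id) (by simp) fun g x _ u hu => ?_
    have hu' : (ψ u).fst = u := hu
    change (ψ (𝔤.ι x * u)).fst = 𝔤.ι x * u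
    rw [map_mul, TrivSqZeroExt.fst_mul, hψ, j1, hu']
  refine ⟨{ toFun := fun u => (ψ u).snd
            map_add' := fun u v => by simp
            map_smul' := fun c u => by simp }, fun x => ?_, fun u v => ?_⟩
  · change (ψ (𝔤.ι x)).snd = Q x
    rw [hψ, j2]
  · change (ψ (u * v)).snd = (ψ u).snd * v + u * (ψ v).snd
    rw [map_mul, TrivSqZeroExt.snd_mul, h1, h1, smul_eq_mul, MulOpposite.smul_eq_mul_unop,
      MulOpposite.unop_op, add_comm]

end ColorLieAlgebra

namespace ColorLieAlgebra

open Finset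

variable {K G : Type*} [Field K] [AddCommGroup G] {ε : G → G → Kˣ} [DecidableEq G]
  {L : Type*} [AddCommGroup L] [Module K L] {𝔤 : ColorLieAlgebra ε L}
  {φ : ℕ → L →ₗ[K] L →ₗ[K] L}

/-! ### Straightening a map from the deformed color Lie algebra to its enveloping algebra -/

/-- `F : 𝔤 → U(𝔤)[[t]]` is a perturbation of the canonical map, of degree zero, that sends the
bracket with coefficients `φ` to the color commutator. -/
structure IsEnvelopingMap (𝔤 : ColorLieAlgebra ε L) (φ : ℕ → L →ₗ[K] L →ₗ[K] L)
    (F : L →ₗ[K] PowerSeries 𝔤.Enveloping) : Prop where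
  zero : ∀ x, PowerSeries.coeff 0 (F x) = 𝔤.ι x
  mem : ∀ n g, ∀ x ∈ 𝔤.grade g, PowerSeries.coeff n (F x) ∈ 𝔤.envelopingGrade g
  rel : ∀ g h x y, x ∈ 𝔤.grade g → y ∈ 𝔤.grade h →
    F x * F y - (ε g h : K) • (F y * F x) = seriesLift F (coeffSeq φ x y)

theorem IsEnvelopingMap.coeff_rel {F : L →ₗ[K] PowerSeries 𝔤.Enveloping}
    (hF : 𝔤.IsEnvelopingMap φ F) (n : ℕ) {g h : G} {x y : L} (hx : x ∈ 𝔤.grade g)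
    (hy : y ∈ 𝔤.grade h) :
    ∑ p ∈ antidiagonal n, (PowerSeries.coeff p.1 (F x) * PowerSeries.coeff p.2 (F y)
      - (ε g h : K) • (PowerSeries.coeff p.2 (F y) * PowerSeries.coeff p.1 (F x)))
      = ∑ p ∈ antidiagonal n, PowerSeries.coeff p.2 (F (φ p.1 x y)) := by
  have := congrArg (PowerSeries.coeff n) (hF.rel g h x y hx hy)
  rw [map_sub, coeff_smul', PowerSeries.coeff_mul, PowerSeries.coeff_mul, coeff_seriesLift,
    ← Nat.sum_antidiagonal_swap (f := fun p : ℕ × ℕ =>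
      PowerSeries.coeff p.1 (F y) * PowerSeries.coeff p.2 (F x))] at this
  rw [sum_sub_distrib, ← smul_sum]
  exact this

/-- A series of automorphisms of `U(𝔤)` can be composed with maps to `U(𝔤)`. -/
theorem IsEnvelopingMap.comp {F : L →ₗ[K] PowerSeries 𝔤.Enveloping}
    (hF : 𝔤.IsEnvelopingMap φ F) {E : 𝔤.Enveloping →ₗ[K] PowerSeries 𝔤.Enveloping}
    (hmul : ∀ u v, E (u * v) = E u * E v) (h0 : ∀ u, PowerSeries.coeff 0 (E u) = u)
    (hmem : ∀ n g, ∀ u ∈ 𝔤.envelopingGrade g, PowerSeries.coeff n (E u) ∈ 𝔤.envelopingGrade g) :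
    𝔤.IsEnvelopingMap φ (seriesExtend E ∘ₗ F) := by
  refine ⟨fun x => ?_, fun n g x hx => ?_, fun g h x y hx hy => ?_⟩
  · rw [LinearMap.comp_apply, coeff_seriesExtend, Nat.antidiagonal_zero, sum_singleton, h0, hF.zero]
  · rw [LinearMap.comp_apply, coeff_seriesExtend]
    exact sum_mem fun p _ => hmem _ _ _ (hF.mem _ _ _ hx)
  · rw [LinearMap.comp_apply, LinearMap.comp_apply, ← seriesExtend_mul hmul,
      ← seriesExtend_mul hmul, ← map_smul, ← map_sub, hF.rel g h x y hx hy,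
      seriesExtend_seriesLift]

section Step

variable {P : 𝔤.Enveloping →ₗ[K] L} {F : L →ₗ[K] PowerSeries 𝔤.Enveloping}

/-- The first coefficient of `F` outside `𝔤` is, modulo `𝔤`, a derivation. -/
theorem IsEnvelopingMap.derivation (hε : IsAntisymmBicharacter ε) (h0 : φ 0 = 𝔤.bracket)
    (hP : 𝔤.IsEquivariantProjection P) (hF : 𝔤.IsEnvelopingMap φ F)
    {r : ℕ} (hr : 0 < r) (hlow : ∀ i < r, ∀ x, PowerSeries.coeff i (F x) ∈ LinearMap.range 𝔤.ι)
    {Q : L →ₗ[K] 𝔤.Enveloping}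
    (hQ : ∀ x, Q x = PowerSeries.coeff r (F x) - 𝔤.ι (P (PowerSeries.coeff r (F x))))
    {g h : G} {a b : L} (ha : a ∈ 𝔤.grade g) (hb : b ∈ 𝔤.grade h) :
    Q (𝔤.bracket a b) = (𝔤.ι a * Q b - (ε g h : K) • (Q b * 𝔤.ι a))
      + (Q a * 𝔤.ι b - (ε g h : K) • (𝔤.ι b * Q a)) := by
  -- the projection to a complement of `𝔤`
  let S : 𝔤.Enveloping →ₗ[K] 𝔤.Enveloping := LinearMap.id - 𝔤.ι ∘ₗ P
  have hS : ∀ u, S u = u - 𝔤.ι (P u) := fun _ => rfl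
  have hQS : ∀ x, Q x = S (PowerSeries.coeff r (F x)) := hQ
  have hSι : ∀ u ∈ LinearMap.range 𝔤.ι, S u = 0 := by
    rintro _ ⟨x, rfl⟩
    rw [hS, hP.apply_ι, sub_self]
  have hι : ∀ {g h : G} {a b : L}, a ∈ 𝔤.grade g → b ∈ 𝔤.grade h →
      𝔤.ι a * 𝔤.ι b - (ε g h : K) • (𝔤.ι b * 𝔤.ι a) = 𝔤.ι (𝔤.bracket a b) := by
    intro g h a b ha hb
    rw [𝔤.ι_mul_ι ha hb, add_sub_cancel_left]
  have hSl : ∀ {g h : G} {a : L} {u : 𝔤.Enveloping}, a ∈ 𝔤.grade g → u ∈ 𝔤.envelopingGrade h →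
      S (𝔤.ι a * u - (ε g h : K) • (u * 𝔤.ι a)) = 𝔤.ι a * S u - (ε g h : K) • (S u * 𝔤.ι a) := by
    intro g h a u ha hu
    rw [hS, hP.commutator g h a u ha hu, ← hι ha (hP.mem h u hu), hS]
    simp only [mul_sub, sub_mul, smul_sub]
    abel
  have hSr : ∀ {g h : G} {b : L} {u : 𝔤.Enveloping}, b ∈ 𝔤.grade h → u ∈ 𝔤.envelopingGrade g →
      S (u * 𝔤.ι b - (ε g h : K) • (𝔤.ι b * u)) = S u * 𝔤.ι b - (ε g h : K) • (𝔤.ι b * S u) := by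
    intro g h b u hb hu
    have e : ∀ u, u * 𝔤.ι b - (ε g h : K) • (𝔤.ι b * u)
        = -((ε g h : K) • (𝔤.ι b * u - (ε h g : K) • (u * 𝔤.ι b))) := by
      intro u
      rw [smul_sub, smul_smul, hε.mul_swap, one_smul, neg_sub]
    rw [e, e, map_neg, map_smul, hSl hb hu]
  have hlow' : ∀ i < r, ∀ g, ∀ x ∈ 𝔤.grade g,
      ∃ y ∈ 𝔤.grade g, 𝔤.ι y = PowerSeries.coeff i (F x) := by
    intro i hi g x hx
    obtain ⟨y, hy⟩ := hlow i hi x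
    refine ⟨y, ?_, hy⟩
    rw [← hP.apply_ι y, hy]
    exact hP.mem g _ (hF.mem i g x hx)
  have key := congrArg S (hF.coeff_rel r ha hb)
  rw [map_sum, map_sum, sum_antidiagonal_eq_add hr, sum_antidiagonal_eq_first] at key
  · rw [hF.zero, hF.zero, hSl ha (hF.mem r h b hb), hSr hb (hF.mem r g a ha), ← hQS, ← hQS,
      ← hQS, h0] at key
    exact key.symm
  · intro i j hij hi
    exact hSι _ (hlow j (by omega) _)
  · intro i j hij hi hj
    obtain ⟨x, hx, hx'⟩ := hlow' i (by omega) g a ha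
    obtain ⟨y, hy, hy'⟩ := hlow' j (by omega) h b hb
    rw [← hx', ← hy', hι hx hy]
    exact hSι _ ⟨_, rfl⟩

variable [CharZero K]

/-- Composition with the exponential of a derivation moves one more coefficient of `F`
into `𝔤`. -/
theorem IsEnvelopingMap.exists_straighten (hε : IsAntisymmBicharacter ε) (h0 : φ 0 = 𝔤.bracket)
    (hP : 𝔤.IsEquivariantProjection P) (hF : 𝔤.IsEnvelopingMap φ F)
    {r : ℕ} (hr : 0 < r)
    (hlow : ∀ i < r, ∀ x, PowerSeries.coeff i (F x) ∈ LinearMap.range 𝔤.ι) :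
    ∃ F', 𝔤.IsEnvelopingMap φ F' ∧
      (∀ i < r, ∀ x, PowerSeries.coeff i (F' x) = PowerSeries.coeff i (F x)) ∧
      ∀ x, PowerSeries.coeff r (F' x) ∈ LinearMap.range 𝔤.ι := by
  let Q : L →ₗ[K] 𝔤.Enveloping :=
    coeffLin K r ∘ₗ F - 𝔤.ι ∘ₗ P ∘ₗ coeffLin K r ∘ₗ F
  have hQ : ∀ x, Q x = PowerSeries.coeff r (F x) - 𝔤.ι (P (PowerSeries.coeff r (F x))) :=
    fun _ => rfl
  obtain ⟨D, hDι, hD⟩ := exists_derivation ((-1 : K) • Q) fun g h a b ha hb => by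
    simp only [LinearMap.smul_apply, hF.derivation hε h0 hP hr hlow hQ ha hb, mul_smul_comm,
      smul_mul_assoc]
    module
  have hDmem : ∀ g, ∀ u ∈ 𝔤.envelopingGrade g, D u ∈ 𝔤.envelopingGrade g := by
    intro g u hu
    refine 𝔤.envelopingGrade_induction (fun n s hs => ?_) hu
    clear hu
    induction hs with
    | one =>
      have := hD 1 1
      rw [mul_one, mul_one, one_mul, left_eq_add] at this
      rw [this]
      exact zero_mem _
    | @mul n g h x s hx hs ih =>
      rw [hD, hDι, LinearMap.smul_apply, hQ]
      have hFx := hF.mem r g x hx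
      exact add_mem (SetLike.mul_mem_graded
        (Submodule.smul_mem _ _ (sub_mem hFx (𝔤.ι_mem (hP.mem g _ hFx)))) hs.mem)
        (SetLike.mul_mem_graded (𝔤.ι_mem hx) ih)
  refine ⟨seriesExtend (expSeries D r) ∘ₗ F,
    hF.comp (expSeries_mul hD hr) (coeff_zero_expSeries D r)
      (fun n g u hu => coeff_expSeries_mem (hDmem g) r n hu), fun i hi x => ?_, fun x => ?_⟩
  · rw [LinearMap.comp_apply, coeff_seriesExtend, sum_antidiagonal_eq_last]
    · exact coeff_zero_expSeries D r _
    · intro k l _ hl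
      exact coeff_expSeries_of_lt D hl (by omega) _
  · rw [LinearMap.comp_apply, coeff_seriesExtend, sum_antidiagonal_eq_add hr]
    · rw [coeff_zero_expSeries, coeff_self_expSeries D hr, hF.zero, hDι, LinearMap.smul_apply, hQ,
        neg_smul, one_smul, neg_sub, sub_add_cancel]
      exact ⟨_, rfl⟩
    · intro i j hij hi hj
      exact coeff_expSeries_of_lt D hj (by omega) _

/-- If the deformed color Lie algebra maps to `U(𝔤)[[t]]`, then the deformation of `𝔤` is trivial;
the identity is stated coefficientwise, for elements of `𝔤`. -/
theorem IsEnvelopingMap.exists_equivalence (hε : IsAntisymmBicharacter ε)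
    (h0 : φ 0 = 𝔤.bracket) (hP : 𝔤.IsEquivariantProjection P) (hF : 𝔤.IsEnvelopingMap φ F) :
    ∃ H : ℕ → L →ₗ[K] L, H 0 = LinearMap.id ∧ (∀ n g, ∀ x ∈ 𝔤.grade g, H n x ∈ 𝔤.grade g) ∧
      ∀ n x y, ∑ p ∈ antidiagonal n, 𝔤.bracket (H p.1 x) (H p.2 y)
        = ∑ p ∈ antidiagonal n, H p.1 (φ p.2 x y) := by
  -- `good k F`: the coefficients of `F` up to `k` take values in `𝔤`
  let good : ℕ → (L →ₗ[K] PowerSeries 𝔤.Enveloping) → Prop := fun k F =>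
    𝔤.IsEnvelopingMap φ F ∧ ∀ i < k + 1, ∀ x, PowerSeries.coeff i (F x) ∈ LinearMap.range 𝔤.ι
  have step : ∀ k F, good k F → ∃ F', good (k + 1) F' ∧
      ∀ i < k + 1, ∀ x, PowerSeries.coeff i (F' x) = PowerSeries.coeff i (F x) := by
    rintro k F ⟨hF, hlow⟩
    obtain ⟨F', hF', hlow', hk⟩ := hF.exists_straighten hε h0 hP k.succ_pos hlow
    refine ⟨F', ⟨hF', fun i hi x => ?_⟩, hlow'⟩
    rcases Nat.lt_succ_iff_lt_or_eq.1 hi with hi | rfl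
    · rw [hlow' i hi]
      exact hlow i hi x
    · exact hk x
  choose! next hnext hagree using step
  let T : ℕ → L →ₗ[K] PowerSeries 𝔤.Enveloping := fun k => Nat.rec F next k
  have hT : ∀ k, good k (T k) := by
    intro k
    induction k with
    | zero =>
      refine ⟨hF, fun i hi x => ?_⟩
      obtain rfl : i = 0 := by omega
      exact ⟨x, (hF.zero x).symm⟩
    | succ k ih => exact hnext k (T k) ih
  have hTi : ∀ k i, i ≤ k → ∀ x, PowerSeries.coeff i (T k x) = PowerSeries.coeff i (T i x) := by
    intro k i hik x
    induction k, hik using Nat.le_induction with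
    | base => rfl
    | succ k hk ih =>
      rw [← ih]
      exact hagree k (T k) (hT k) i (by omega) x
  -- the `n`-th coefficient no longer changes after the step `n`
  let H : ℕ → L →ₗ[K] L := fun n => P ∘ₗ coeffLin K n ∘ₗ T n
  have hH : ∀ k i, i ≤ k → ∀ x, PowerSeries.coeff i (T k x) = 𝔤.ι (H i x) := by
    intro k i hik x
    rw [hTi k i hik]
    obtain ⟨y, hy⟩ := (hT i).2 i (by omega) x
    change _ = 𝔤.ι (P (PowerSeries.coeff i (T i x)))
    rw [← hy, hP.apply_ι]
  have hHmem : ∀ n g, ∀ x ∈ 𝔤.grade g, H n x ∈ 𝔤.grade g := fun n g x hx =>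
    hP.mem g _ ((hT n).1.mem n g x hx)
  refine ⟨H, ?_, hHmem, fun n x y => ?_⟩
  · ext x
    change P (PowerSeries.coeff 0 (F x)) = x
    rw [hF.zero, hP.apply_ι]
  · have key : ∑ p ∈ antidiagonal n, 𝔤.bracket.compl₁₂ (H p.1) (H p.2)
        = ∑ p ∈ antidiagonal n, (φ p.2).compr₂ (H p.1) := by
      refine internal_ext 𝔤.isInternal fun g x hx => internal_ext 𝔤.isInternal fun h y hy => ?_
      have h1 := (hT n).1.coeff_rel n hx hy
      have h2 : ∀ p ∈ antidiagonal n, (PowerSeries.coeff p.1 (T n x) * PowerSeries.coeff p.2 (T n y)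
          - (ε g h : K) • (PowerSeries.coeff p.2 (T n y) * PowerSeries.coeff p.1 (T n x)))
          = 𝔤.ι (𝔤.bracket (H p.1 x) (H p.2 y)) := by
        intro p hp
        rw [HasAntidiagonal.mem_antidiagonal] at hp
        rw [hH n p.1 (by omega), hH n p.2 (by omega),
          𝔤.ι_mul_ι (hHmem _ _ _ hx) (hHmem _ _ _ hy), add_sub_cancel_left]
      have h3 : ∀ p ∈ antidiagonal n, PowerSeries.coeff p.2 (T n (φ p.1 x y))
          = 𝔤.ι (H p.2 (φ p.1 x y)) := by
        intro p hp
        rw [HasAntidiagonal.mem_antidiagonal] at hp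
        rw [hH n p.2 (by omega)]
      rw [sum_congr rfl h2, sum_congr rfl h3, ← map_sum, ← map_sum,
        ← Nat.sum_antidiagonal_swap (f := fun p : ℕ × ℕ => H p.2 (φ p.1 x y))] at h1
      have h4 := congrArg P h1
      rw [hP.apply_ι, hP.apply_ι] at h4
      simpa [LinearMap.sum_apply] using h4
    have := LinearMap.congr_fun₂ key x y
    simpa [LinearMap.sum_apply] using this

end Step

end ColorLieAlgebra

open Finset

/-! ### Rigidity -/

section Series

variable {K V : Type*} [Field K] [AddCommGroup V] [Module K V]

theorem seriesMul_constSeries (m : V →ₗ[K] V →ₗ[K] V) (x y : ℕ → V) (n : ℕ) :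
    seriesMul (constSeries m) x y n = ∑ p ∈ antidiagonal n, m (x p.1) (y p.2) := by
  unfold seriesMul
  rw [sum_antidiagonal_eq_first]
  · simp [constSeries]
  · intro i j _ hi
    simp [constSeries, Pi.single_eq_of_ne hi.ne']

/-- A series of linear maps intertwines two multiplications on `V[[t]]` if it does so
on `V`. -/
theorem seriesMap_seriesMul_of_coeff {m : V →ₗ[K] V →ₗ[K] V} {φ : ℕ → V →ₗ[K] V →ₗ[K] V}
    {H : ℕ → V →ₗ[K] V}
    (hH : ∀ n x y, ∑ p ∈ antidiagonal n, m (H p.1 x) (H p.2 y)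
      = ∑ p ∈ antidiagonal n, H p.1 (φ p.2 x y)) (x y : ℕ → V) :
    seriesMap H (seriesMul φ x y) = seriesMul (constSeries m) (seriesMap H x) (seriesMap H y) := by
  ext n
  rw [seriesMul_constSeries]
  simp only [seriesMap, seriesMul, map_sum, LinearMap.sum_apply]
  rw [← sum_antidiagonal_assoc fun i j k => ∑ r ∈ antidiagonal k, H i (φ j (x r.1) (y r.2))]
  have e : ∀ p : ℕ × ℕ,
      ∑ q ∈ antidiagonal p.1, ∑ r ∈ antidiagonal p.2, H q.1 (φ q.2 (x r.1) (y r.2))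
        = ∑ q ∈ antidiagonal p.1, ∑ r ∈ antidiagonal p.2, m (H q.1 (x r.1)) (H q.2 (y r.2)) := by
    intro p
    rw [sum_comm, sum_comm (s := antidiagonal p.1)]
    exact sum_congr rfl fun r _ => (hH p.1 _ _).symm
  simp only [e]
  rw [sum_antidiagonal_antidiagonal fun i j k l => m (H i (x k)) (H j (y l))]
  exact sum_congr rfl fun p _ => sum_comm

end Series

namespace ColorLieAlgebra

variable {K G : Type*} [Field K] [AddCommGroup G] {ε : G → G → Kˣ} [DecidableEq G]
  {L : Type*} [AddCommGroup L] [Module K L] {𝔤 : ColorLieAlgebra ε L}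
  {φ : ℕ → L →ₗ[K] L →ₗ[K] L}

/-- A trivialization of a deformation of `U(𝔤)` restricts to a map on the deformed color Lie
algebra whose bracket is the commutator. -/
theorem exists_isEnvelopingMap {π : ℕ → 𝔤.Enveloping →ₗ[K] 𝔤.Enveloping →ₗ[K] 𝔤.Enveloping}
    (hπ : ∀ m g h a b, a ∈ 𝔤.grade g → b ∈ 𝔤.grade h →
      π m (𝔤.ι a) (𝔤.ι b) - (ε g h : K) • π m (𝔤.ι b) (𝔤.ι a) = 𝔤.ι (φ m a b))
    (h : GradedEquivalent 𝔤.envelopingGrade (constSeries (LinearMap.mul K 𝔤.Enveloping)) π) :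
    ∃ F, 𝔤.IsEnvelopingMap φ F := by
  obtain ⟨f, hf0, hf, hmul⟩ := h
  let F : L →ₗ[K] PowerSeries 𝔤.Enveloping :=
    { toFun := fun x => PowerSeries.mk fun n => f n (𝔤.ι x)
      map_add' := fun x y => by ext n; simp
      map_smul' := fun c x => by ext n; simp }
  have hF : ∀ n x, PowerSeries.coeff n (F x) = f n (𝔤.ι x) := fun n x => by simp [F]
  have hprod : ∀ n x y, PowerSeries.coeff n (F x * F y)
      = ∑ p ∈ antidiagonal n, f p.1 (π p.2 (𝔤.ι x) (𝔤.ι y)) := by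
    intro n x y
    have := congrFun (hmul (Pi.single 0 (𝔤.ι x)) (Pi.single 0 (𝔤.ι y))) n
    rw [seriesMap_single, seriesMap_single, seriesMul_constSeries, seriesMul_single_single] at this
    simp only [PowerSeries.coeff_mul, hF]
    exact this.symm
  refine ⟨F, fun x => ?_, fun n g x hx => ?_, fun g h x y hx hy => ?_⟩
  · rw [hF, hf0, LinearMap.id_apply]
  · rw [hF]
    exact hf n g _ (𝔤.ι_mem hx)
  · ext n
    rw [map_sub, coeff_smul', hprod, hprod, smul_sum, ← sum_sub_distrib, coeff_seriesLift,
      ← Nat.sum_antidiagonal_swap]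
    refine sum_congr rfl fun p _ => ?_
    rw [← map_smul, ← map_sub, hπ p.swap.2 g h x y hx hy, hF]
    rfl

end ColorLieAlgebra


theorem mainTheorem2 {K G : Type*} [Field K] [CharZero K] [AddCommGroup G] [DecidableEq G]
    (ε : G → G → Kˣ) (hε : IsAntisymmBicharacter ε)
    {L : Type*} [AddCommGroup L] [Module K L] (𝔤 : ColorLieAlgebra ε L)
    (h : IsGradedRigidAlgebra 𝔤.envelopingGrade) :
    𝔤.IsGradedRigid := by
  intro φ hφ
  obtain ⟨π, hπ, hcomm⟩ := ColorLieAlgebra.exists_assocDeformation hε hφ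
  obtain ⟨F, hF⟩ := ColorLieAlgebra.exists_isEnvelopingMap hcomm (h π hπ)
  obtain ⟨P, hP⟩ := ColorLieAlgebra.exists_equivariant_projection hε hφ
  obtain ⟨H, hH0, hHmem, hH⟩ := hF.exists_equivalence hε hφ.zero hP
  exact ⟨H, hH0, hHmem, seriesMap_seriesMul_of_coeff hH⟩
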